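/- **Setting.** Let $d\ge 1$, $s_1,s_2,T>0$, let $\Omega\subset\mathbb R^d$ be a bounded Lipschitz domain, and let $\mathcal P_0=\mathcal I_0\otimes\mathcal T_0=\{I\times S: I\in\mathcal I_0,\ S\in\mathcal T_0\}$. Here $0=t_0<\dots<t_N=T$ and $\mathcal I_0$ consists of $[t_i,t_{i+1})$ for $0\le i\le N-2$ and of $[t_{N-1},t_N]$. $\mathcal T_0$ is a finite, non-overlapping, conforming triangulation of $\overline\Omega$ into closed $d$-simplices (two simplices are equal, disjoint, or meet in a common proper face of both) and is well-labelled: its elements are tagged simplices $(x_0,\dots,x_d)_\gamma$, all of the same type $\gamma\in\{0,\dots,d-1\}$, satisfying Stevenson's matching condition. That is, if $S\neq S'$ in $\mathcal T_0$ share a hyperface and this hyperface contains the refinement edge $\mathrm{RE}(\cdot)=\overline{x_0x_d}$ of $S$ or of $S'$, then $S,S'$ are reflected neighbours; otherwise the children of $S$ and $S'$ containing the hyperface are reflected neighbours. (Reflected neighbours: the vertex list of $S'$ coincides in all but one position with that of $S=(x_0,\dots,x_d)_\gamma$ or with $(x_d,x_1,\dots,x_\gamma,x_{d-1},\dots,x_{\gamma+1},x_0)$.)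 $\mathrm{BISECT}(d,S)$ replaces $(x_0,\dots,x_d)_\gamma$, with $m=\frac{x_0+x_d}{2}$, by $(x_0,m,x_1,\dots,x_{d-1})_{\gamma'}$ and $(x_d,m,x_1,\dots,x_\gamma,x_{d-1},\dots,x_{\gamma+1})_{\gamma'}$, where $\gamma'=\gamma+1 \bmod d$; $\mathrm{BISECT}(1,I)$ halves intervals, $[a,b)\mapsto[a,\tfrac{a+b}2),[\tfrac{a+b}2,b)$ and $[a,b]\mapsto[a,\tfrac{a+b}2),[\tfrac{a+b}2,b]$. An atomic split of a prism $I\times S$ of level $\ell$ (the level is the number of atomic splits that led to it from $\mathcal P_0$) bisects $S$ once and $I$ successively $\lceil\frac{(\ell+1)s_2}{s_1d}\rceil-\lceil\frac{\ell s_2}{s_1d}\rceil$ times, and returns all products, which have level $\ell+1$. A space-time partition $\mathcal P$ of $[0,T]\times\overline\Omega$ is called *admissible* if it is obtained from $\mathcal P_0$ by finitely many atomic splits, the triangulation $\{S: I\times S\in\mathcal P,\ t\in I\}$ is conforming for every $t\in[0,T]$, and the levels of $I\times S,I'\times S'\in\mathcal P$ differ by at most $1$ whenever $\#(\overline I\cap\overline{I'})=1$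 and $\dim(S\cap S')=d$, and, if $d=1$, also whenever $|I\cap I'|>0$ and $\#(S\cap S')=1$. For $Q=I\times S\in\mathcal P$ let $\mathcal N(Q,\mathcal P)=\mathcal N_t(Q,\mathcal P)\cup\mathcal N_x(Q,\mathcal P)$. Here $\mathcal N_t(Q,\mathcal P)$ is the set of $I'\times S'\in\mathcal P\setminus\{Q\}$ with $\#(\overline I\cap\overline{I'})=1$, $\dim(S\cap S')=d$ and $\ell(I'\times S')=\ell(Q)-1$. If $d\ge2$, $\mathcal N_x(Q,\mathcal P)$ is the set of $I'\times S'\in\mathcal P\setminus\{Q\}$ with $|I\cap I'|>0$, $1\le\dim(S\cap S')\le d-1$ and $\mathrm{RE}(S)\subset S'$; if $d=1$, it is the set of those with $|I\cap I'|>0$, $\#(S\cap S')=1$ and $\ell(I'\times S')=\ell(Q)-1$. **Routine** $\mathrm{PATCH\_REFINE}(\mathcal P,E)$. Put $K=\emptyset$, $F=\{E\}$. While $F\ne\emptyset$: put $F_{new}=\emptyset$; for each $Q\in F$, as long as $\mathcal N(Q,\mathcal P)\setminus(K\cup F)$, formed with the current $\mathcal P$, has an element not yet visited in the loop for $Q$,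 visit such an element $R$: if $\ell(R)=\ell(Q)$, add $R$ to $F_{new}$; otherwise put $\mathcal P_{old}=\mathcal P$, replace $\mathcal P$ by $\mathrm{PATCH\_REFINE}(\mathcal P,R)$, and if $R\in\mathcal N_x(Q,\mathcal P_{old})$, add to $F_{new}$ all elements of the atomic split of $R$ that lie in $\mathcal N(Q,\mathcal P)$. Then put $K=K\cup F$ and $F=F_{new}$. After the while loop, replace in $\mathcal P$ every element of $K$ by its atomic split and return the result. The order in which the loops visit elements is arbitrary, except that for $d\ge3$ no $R$ with $\ell(R)<\ell(Q)-1$ is visited while an unvisited one with $\ell(R)\ge\ell(Q)-1$ is available. **Theorem.** Let $\mathcal P$ be admissible and $E\in\mathcal P$. Then, for every such order, $\mathrm{PATCH\_REFINE}(\mathcal P,E)$ terminates. It returns an admissible partition $\mathcal P'$ with $E\notin\mathcal P'$, which arises from $\mathcal P$ by exactly the $n$ atomic splits performed during the run (including the recursive calls). The number $n$ is minimal: if an admissible $\mathcal P''$ with $E\notin\mathcal P''$ is obtained from $\mathcal P$ by $k$ atomic splits, then $n\le k$. Every element of $\mathcal P'\setminus\mathcal P$ has level at most $\ell(E)+1$.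 -/

import Mathlib

/-! ### Tagged simplices and their bisection -/

/-- A tagged `d`-simplex `(x₀, …, x_d)_γ` in `ℝ^d`: an ordered list of vertices and a type `γ`,
together with its level, the number of bisections by which it was created. -/
structure TaggedSimplex (d : ℕ) where
  vertex : Fin (d + 1) → EuclideanSpace ℝ (Fin d)
  type : ℕ
  level : ℕ

namespace TaggedSimplex

variable {d : ℕ}

/-- The vertex `x_j`, for `j ≤ d`. -/
def v (S : TaggedSimplex d) (j : ℕ) : EuclideanSpace ℝ (Fin d) :=
  S.vertex (Fin.ofNat (d + 1) j)

/-- The set of vertices. -/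
def vertices (S : TaggedSimplex d) : Set (EuclideanSpace ℝ (Fin d)) :=
  Set.range S.vertex

/-- The closed simplex itself. -/
def carrier (S : TaggedSimplex d) : Set (EuclideanSpace ℝ (Fin d)) :=
  convexHull ℝ S.vertices

/-- The refinement edge `RE(S)`, which joins `x₀` and `x_d`. -/
def refinementEdge (S : TaggedSimplex d) : Set (EuclideanSpace ℝ (Fin d)) :=
  segment ℝ (S.v 0) (S.v d)

/-- The midpoint of the refinement edge. -/
noncomputable def newVertex (S : TaggedSimplex d) : EuclideanSpace ℝ (Fin d) :=
  midpoint ℝ (S.v 0) (S.v d)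

/-- The child `(x₀, m, x₁, …, x_γ, x_{γ+1}, …, x_{d-1})` of type `γ + 1 mod d`. -/
noncomputable def child₀ (S : TaggedSimplex d) : TaggedSimplex d where
  vertex j :=
    if (j : ℕ) = 0 then S.v 0
    else if (j : ℕ) = 1 then S.newVertex
    else S.v ((j : ℕ) - 1)
  type := (S.type + 1) % d
  level := S.level + 1

/-- The child `(x_d, m, x₁, …, x_γ, x_{d-1}, …, x_{γ+1})` of type `γ + 1 mod d`. -/
noncomputable def child₁ (S : TaggedSimplex d) : TaggedSimplex d where
  vertex j :=
    if (j : ℕ) = 0 then S.v d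
    else if (j : ℕ) = 1 then S.newVertex
    else if (j : ℕ) ≤ S.type + 1 then S.v ((j : ℕ) - 1)
    else S.v (d + S.type + 1 - (j : ℕ))
  type := (S.type + 1) % d
  level := S.level + 1

open Classical in
/-- `BISECT(d, S)`, the bisection rule of Maubach and Traxler. -/
noncomputable def bisect (S : TaggedSimplex d) : Finset (TaggedSimplex d) :=
  {S.child₀, S.child₁}

/-- The reflected tagged simplex `(x_d, x₁, …, x_γ, x_{d-1}, …, x_{γ+1}, x₀)_γ`; it has the same
children as `S`. -/
def reflect (S : TaggedSimplex d) : TaggedSimplex d where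
  vertex j :=
    if (j : ℕ) = 0 then S.v d
    else if (j : ℕ) = d then S.v 0
    else if (j : ℕ) ≤ S.type then S.v (j : ℕ)
    else S.v (d + S.type - (j : ℕ))
  type := S.type
  level := S.level

/-- The ordered vertices of `S` or of its reflection coincide with those of `S'` on all but one
position. -/
def ReflectedNeighbours (S S' : TaggedSimplex d) : Prop :=
  (∃ i, ∀ j, S.vertex j = S'.vertex j ↔ j ≠ i) ∨
    (∃ i, ∀ j, S.reflect.vertex j = S'.vertex j ↔ j ≠ i)

/-- The matching condition of Stevenson for two tagged simplices `S`, `S'` that share the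
hyperface with vertex set `S.vertices ∩ S'.vertices`: if the refinement edge of `S` or of `S'` lies
in that hyperface, then `S` and `S'` are reflected neighbours; otherwise the children of `S` and
`S'` that contain the hyperface are. -/
def Matching (S S' : TaggedSimplex d) : Prop :=
  (({S.v 0, S.v d} ⊆ S.vertices ∩ S'.vertices ∨ {S'.v 0, S'.v d} ⊆ S.vertices ∩ S'.vertices) →
      ReflectedNeighbours S S') ∧
    (¬({S.v 0, S.v d} ⊆ S.vertices ∩ S'.vertices ∨
        {S'.v 0, S'.v d} ⊆ S.vertices ∩ S'.vertices) →
      ∀ C ∈ S.bisect, ∀ C' ∈ S'.bisect,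
        S.vertices ∩ S'.vertices ⊆ C.vertices → S.vertices ∩ S'.vertices ⊆ C'.vertices →
          ReflectedNeighbours C C')

/-- `A` is a face of `S` of dimension at most `d - 1`: the convex hull of a nonempty proper subset
of the vertices. -/
def IsProperFace (A : Set (EuclideanSpace ℝ (Fin d))) (S : TaggedSimplex d) : Prop :=
  ∃ V : Set (EuclideanSpace ℝ (Fin d)), V.Nonempty ∧ V ⊂ S.vertices ∧ A = convexHull ℝ V

end TaggedSimplex

/-- A family of simplices is conforming: any two of them are equal, disjoint, or intersect in a
common face of both, of dimension at most `d - 1`. -/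
def Conforming {d : ℕ} (𝒮 : Set (TaggedSimplex d)) : Prop :=
  ∀ S ∈ 𝒮, ∀ S' ∈ 𝒮,
    S.carrier = S'.carrier ∨ S.carrier ∩ S'.carrier = ∅ ∨
      (TaggedSimplex.IsProperFace (S.carrier ∩ S'.carrier) S ∧
        TaggedSimplex.IsProperFace (S.carrier ∩ S'.carrier) S')

/-- The dimension of a convex set (of its affine hull; the empty set gets dimension `0`). -/
noncomputable def convexDim {d : ℕ} (A : Set (EuclideanSpace ℝ (Fin d))) : ℕ :=
  Module.finrank ℝ (vectorSpan ℝ A)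

/-! ### The domain and its initial triangulation -/

/-- A bounded Lipschitz domain: a bounded, open, connected set which near each of its boundary
points is, in suitable orthonormal coordinates, the open region above the graph of a Lipschitz
function. Here `e` is the direction of the last coordinate and `g`, being invariant along `e`, is a
function of the remaining coordinates. -/
structure IsBoundedLipschitzDomain {d : ℕ} (Ω : Set (EuclideanSpace ℝ (Fin d))) : Prop where
  isOpen : IsOpen Ω
  isConnected : IsConnected Ω
  isBounded : Bornology.IsBounded Ω
  lipschitz_boundary : ∀ x ∈ frontier Ω,
    ∃ (e : EuclideanSpace ℝ (Fin d)) (g : EuclideanSpace ℝ (Fin d) → ℝ) (L : NNReal) (r : ℝ),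
      ‖e‖ = 1 ∧ LipschitzWith L g ∧ (∀ y, ∀ s : ℝ, g (y + s • e) = g y) ∧ 0 < r ∧
        ∀ y ∈ Metric.ball x r, y ∈ Ω ↔ g y < inner ℝ e y

/-- `T₀` is a non-overlapping, conforming, well-labelled simplicial triangulation of (the closure
of) `Ω`. The field `matching` concerns two simplices that share a hyperface, that is, `d`
vertices. -/
structure IsInitialTriangulation {d : ℕ} (Ω : Set (EuclideanSpace ℝ (Fin d))) (γ : ℕ)
    (T₀ : Finset (TaggedSimplex d)) : Prop where
  nondegenerate : ∀ S ∈ T₀, AffineIndependent ℝ S.vertex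
  covering : (⋃ S ∈ T₀, S.carrier) = closure Ω
  nonoverlapping : ∀ S ∈ T₀, ∀ S' ∈ T₀, S ≠ S' →
    Disjoint (interior S.carrier) (interior S'.carrier)
  conforming : Conforming (T₀ : Set (TaggedSimplex d))
  level_eq_zero : ∀ S ∈ T₀, S.level = 0
  type_lt : γ < d
  type_eq : ∀ S ∈ T₀, S.type = γ
  matching : ∀ S ∈ T₀, ∀ S' ∈ T₀, S ≠ S' → (S.vertices ∩ S'.vertices).ncard = d →
    S.Matching S'

/-! ### Time intervals -/

/-- The interval `[left, right]` if `closed` and `[left, right)` otherwise. -/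
structure TimeInterval where
  left : ℝ
  right : ℝ
  closed : Bool

namespace TimeInterval

/-- The interval as a set. -/
def carrier (I : TimeInterval) : Set ℝ :=
  if I.closed then Set.Icc I.left I.right else Set.Ico I.left I.right

open Classical in
/-- `BISECT(1, I)`. -/
noncomputable def bisect (I : TimeInterval) : Finset TimeInterval :=
  {⟨I.left, (I.left + I.right) / 2, false⟩, ⟨(I.left + I.right) / 2, I.right, I.closed⟩}

open Classical in
/-- `BISECT(1, I)^{⊗ m}`. -/
noncomputable def bisectIter (I : TimeInterval) : ℕ → Finset TimeInterval
  | 0 => {I}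
  | m + 1 => (I.bisectIter m).biUnion bisect

end TimeInterval

/-! ### Prisms, atomic splits and space-time partitions -/

/-- A prism `I × S`. -/
structure Prism (d : ℕ) where
  time : TimeInterval
  space : TaggedSimplex d

namespace Prism

variable {d : ℕ}

/-- The prism as a subset of `ℝ × ℝ^d`. -/
def carrier (Q : Prism d) : Set (ℝ × EuclideanSpace ℝ (Fin d)) :=
  Q.time.carrier ×ˢ Q.space.carrier

/-- The level of a prism: the number of atomic splits by which it was created. Each atomic split
bisects the simplex once, so this is the level of the simplex. -/
def level (Q : Prism d) : ℕ :=
  Q.space.level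

open Classical in
/-- `ATOMIC_SPLIT(I × S, d, s₁, s₂)`: the simplex is bisected once, the interval `m` times, where
`m = ⌈n s₂ / (s₁ d)⌉ - ⌈(n - 1) s₂ / (s₁ d)⌉` and `n = ℓ(S) + 1`. -/
noncomputable def atomicSplit (s₁ s₂ : ℝ) (Q : Prism d) : Finset (Prism d) :=
  (Q.time.bisectIter
      (⌈((Q.space.level + 1 : ℕ) : ℝ) * s₂ / (s₁ * d)⌉₊ - ⌈(Q.space.level : ℝ) * s₂ / (s₁ * d)⌉₊)
    ×ˢ Q.space.bisect).image fun p => ⟨p.1, p.2⟩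

/-- The closures of the time intervals of `Q` and `Q'` meet in exactly one point. -/
def TimeAdjacent (Q Q' : Prism d) : Prop :=
  (closure Q.time.carrier ∩ closure Q'.time.carrier).ncard = 1

/-- The time intervals of `Q` and `Q'` overlap in a set of positive length. -/
def TimeOverlap (Q Q' : Prism d) : Prop :=
  0 < MeasureTheory.volume (Q.time.carrier ∩ Q'.time.carrier)

/-- `Q` and `Q'` touch in time: their closures share a `d`-dimensional hyperface `{t} × (S ∩ S')`. -/
def TouchInTime (Q Q' : Prism d) : Prop :=
  Q.TimeAdjacent Q' ∧ convexDim (Q.space.carrier ∩ Q'.space.carrier) = d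

/-- For `d = 1`: `Q` and `Q'` touch in space, that is, their closures share a one-dimensional
hyperface `(I ∩ I') × {x}`. -/
def TouchInSpace (Q Q' : Prism d) : Prop :=
  Q.TimeOverlap Q' ∧ (Q.space.carrier ∩ Q'.space.carrier).ncard = 1

open Classical in
/-- The neighbours in time `𝒩_t(Q, P)`. -/
noncomputable def timeNeighbours (Q : Prism d) (P : Finset (Prism d)) : Finset (Prism d) :=
  P.filter fun Q' => Q' ≠ Q ∧ Q.TimeAdjacent Q' ∧
    convexDim (Q.space.carrier ∩ Q'.space.carrier) = d ∧ Q'.level + 1 = Q.level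

open Classical in
/-- The neighbours in space `𝒩_x(Q, P)`. -/
noncomputable def spaceNeighbours (Q : Prism d) (P : Finset (Prism d)) : Finset (Prism d) :=
  if 2 ≤ d then
    P.filter fun Q' => Q' ≠ Q ∧ Q.TimeOverlap Q' ∧
      1 ≤ convexDim (Q.space.carrier ∩ Q'.space.carrier) ∧
      convexDim (Q.space.carrier ∩ Q'.space.carrier) ≤ d - 1 ∧
      Q.space.refinementEdge ⊆ Q'.space.carrier
  else
    P.filter fun Q' => Q' ≠ Q ∧ Q.TimeOverlap Q' ∧
      (Q.space.carrier ∩ Q'.space.carrier).ncard = 1 ∧ Q'.level + 1 = Q.level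

open Classical in
/-- The necessary refinements of neighbours `𝒩(Q, P)`. -/
noncomputable def neighbours (Q : Prism d) (P : Finset (Prism d)) : Finset (Prism d) :=
  Q.timeNeighbours P ∪ Q.spaceNeighbours P

end Prism

open Classical in
/-- The tensor product partition `P₀ = ℐ₀ ⊗ T₀`, where `ℐ₀` consists of the intervals
`[t_i, t_{i+1})`, `i < N - 1`, and `[t_{N-1}, t_N]`. -/
noncomputable def initialPartition {d N : ℕ} (t : Fin (N + 1) → ℝ) (T₀ : Finset (TaggedSimplex d)) :
    Finset (Prism d) :=
  ((Finset.univ : Finset (Fin N)) ×ˢ T₀).image fun p =>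
    ⟨⟨t p.1.castSucc, t p.1.succ, decide ((p.1 : ℕ) + 1 = N)⟩, p.2⟩

open Classical in
/-- `SplitsInto s₁ s₂ n P P'`: the partition `P'` is obtained from `P` by `n` successive
applications of `ATOMIC_SPLIT`, each replacing one element by its children. -/
inductive SplitsInto {d : ℕ} (s₁ s₂ : ℝ) : ℕ → Finset (Prism d) → Finset (Prism d) → Prop
  | refl (P : Finset (Prism d)) : SplitsInto s₁ s₂ 0 P P
  | step {n : ℕ} {P P' : Finset (Prism d)} (h : SplitsInto s₁ s₂ n P P') (Q : Prism d)
      (hQ : Q ∈ P') : SplitsInto s₁ s₂ (n + 1) P (P'.erase Q ∪ Q.atomicSplit s₁ s₂)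

/-- The active spatial triangulation at time `t`. -/
def activeTriangulation {d : ℕ} (t : ℝ) (P : Finset (Prism d)) : Set (TaggedSimplex d) :=
  {S | ∃ Q ∈ P, t ∈ Q.time.carrier ∧ Q.space = S}

/-- The partitions to which the refinement routine applies: space-time partitions of
`[0, T] × closure Ω` that are obtained from `P₀` by finitely many atomic splits, are conforming in
space, and are `1`-irregular in time and, if `d = 1`, also in space. -/
structure IsAdmissible {d : ℕ} (s₁ s₂ T : ℝ) (Ω : Set (EuclideanSpace ℝ (Fin d)))
    (P₀ P : Finset (Prism d)) : Prop where
  obtained : ∃ n, SplitsInto s₁ s₂ n P₀ P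
  covering : (⋃ Q ∈ P, Q.carrier) = Set.Icc 0 T ×ˢ closure Ω
  nonoverlapping : ∀ Q ∈ P, ∀ Q' ∈ P, Q ≠ Q' →
    Disjoint (interior Q.carrier) (interior Q'.carrier)
  conforming_in_space : ∀ t ∈ Set.Icc 0 T, Conforming (activeTriangulation t P)
  irregular_in_time : ∀ Q ∈ P, ∀ Q' ∈ P, Q.TouchInTime Q' → Q.level ≤ Q'.level + 1
  irregular_in_space : d = 1 →
    ∀ Q ∈ P, ∀ Q' ∈ P, Q.TouchInSpace Q' → Q.level ≤ Q'.level + 1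

/-! ### The routine `PATCH_REFINE` -/

/-- A rule that fixes the order in which the `for` loops pass through their sets. The loops ask for
an element of the set of those still to be visited; the first argument is the number of choices made
so far, so that the order may vary freely during a run. `outer` serves the loop over `F`, `inner`
the loop over the neighbours of `Q`. If `d ≥ 3`, the latter must not choose an element of level less
than `ℓ(Q) - 1` as long as there is another one to choose. -/
structure Scheduler (d : ℕ) where
  outer : ℕ → Finset (Prism d) → Prism d
  outer_mem : ∀ k A, A.Nonempty → outer k A ∈ A
  inner : ℕ → Prism d → Finset (Prism d) → Prism d
  inner_mem : ∀ k Q A, A.Nonempty → inner k Q A ∈ A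
  inner_level : 3 ≤ d → ∀ k Q A, ∀ R ∈ A, Q.level ≤ R.level + 1 →
    Q.level ≤ (inner k Q A).level + 1

/-- The global state of a run: the current partition, the number of atomic splits performed so far,
and the number of choices made so far. -/
structure RunState (d : ℕ) where
  part : Finset (Prism d)
  splits : ℕ
  choices : ℕ

/- In the following recursive routines the value `none` means that the computation does not
terminate: they are the least solutions of their defining equations. -/
section

open Classical

mutual

/-- `PATCH_REFINE(P, E, d, s₁, s₂)`: the `while` loop determines the set `K`, whose elements are
then split. -/
noncomputable def patchRefine {d : ℕ} (s₁ s₂ : ℝ) (σ : Scheduler d) (E : Prism d)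
    (st : RunState d) : Option (RunState d) := do
  let (st, K) ← whileLoop s₁ s₂ σ ∅ {E} st
  some { st with
    part := (st.part \ K) ∪ K.biUnion (Prism.atomicSplit s₁ s₂)
    splits := st.splits + K.card }
  partial_fixpoint

/-- `while F ≠ ∅ do …; K ← K ∪ F; F ← F_new`. -/
noncomputable def whileLoop {d : ℕ} (s₁ s₂ : ℝ) (σ : Scheduler d) (K F : Finset (Prism d))
    (st : RunState d) : Option (RunState d × Finset (Prism d)) :=
  if F = ∅ then some (st, K)
  else do
    let (st, Fnew) ← outerLoop s₁ s₂ σ K F F ∅ st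
    whileLoop s₁ s₂ σ (K ∪ F) Fnew st
  partial_fixpoint

/-- `for Q ∈ F do …`, where `todo` holds the elements of `F` that are still to be visited. -/
noncomputable def outerLoop {d : ℕ} (s₁ s₂ : ℝ) (σ : Scheduler d)
    (K F todo Fnew : Finset (Prism d)) (st : RunState d) :
    Option (RunState d × Finset (Prism d)) :=
  if todo = ∅ then some (st, Fnew)
  else do
    let Q := σ.outer st.choices todo
    let (st, Fnew) ← innerLoop s₁ s₂ σ K F Q ∅ Fnew { st with choices := st.choices + 1 }
    outerLoop s₁ s₂ σ K F (todo.erase Q) Fnew st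
  partial_fixpoint

/-- `for R ∈ 𝒩(Q, P) \ (K ∪ F) do …`, where `P` is the current partition and `seen` holds the
elements that have been visited already. -/
noncomputable def innerLoop {d : ℕ} (s₁ s₂ : ℝ) (σ : Scheduler d) (K F : Finset (Prism d))
    (Q : Prism d) (seen Fnew : Finset (Prism d)) (st : RunState d) :
    Option (RunState d × Finset (Prism d)) :=
  if (Q.neighbours st.part \ (K ∪ F)) \ seen = ∅ then some (st, Fnew)
  else
    let R := σ.inner st.choices Q ((Q.neighbours st.part \ (K ∪ F)) \ seen)
    if Q.level = R.level then
      innerLoop s₁ s₂ σ K F Q (insert R seen) (insert R Fnew)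
        { st with choices := st.choices + 1 }
    else do
      let st' ← patchRefine s₁ s₂ σ R { st with choices := st.choices + 1 }
      innerLoop s₁ s₂ σ K F Q (insert R seen)
        (if R ∈ Q.spaceNeighbours st.part then
          Fnew ∪ (R.atomicSplit s₁ s₂).filter (fun C => C ∈ Q.neighbours st'.part)
        else Fnew) st'
  partial_fixpoint

end

end

/-!
The uniform refinements of the initial triangulation and of the initial time intervals generate an
infinite forest of prisms, in which the children of a prism are the elements of its atomic split. A
partition that arises from the initial one by atomic splits is described by the finite set `D` of
the prisms that have been split: it consists of the leaves that `D` leaves behind, and the number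
of splits is the cardinality of `D` (`PrismForest.IsLower.exists_of_splitsInto` and
`PrismForest.IsLower.splitsInto`).

Admissibility turns into a closure property of `D`. A partition is admissible if and only if `D` is
saturated, that is, if `D` contains with each prism `Q` all prisms on which `Q` depends
(`PrismForest.isSaturated_of_isAdmissible`, `PrismForest.IsSaturated.isAdmissible`). A prism depends
on the prisms of the same level and with the same time interval that have the same refinement edge,
on the next coarser prisms adjacent to it in time and, if `d = 1`, on the next coarser ones adjacent
to it in space. Hence there is a least saturated set that contains a given one and a given leaf `E`,
and it remains to see that the routine terminates and computes it.

That conformity can be expressed by dependencies between prisms of equal level rests on the matching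
condition: the uniform refinements are conforming, and all simplices of a level that contain the
midpoint of a refinement edge have this edge as refinement edge. To prove this, each edge of a
tagged simplex gets an offset, the number of bisections after which it becomes a refinement edge.
That the simplices of a level agree on the offsets of their common edges is inherited by the
children (`IsCompatible.refine`). For the initial triangulation, the matching condition yields this
for simplices that share a hyperface; two arbitrary simplices with a common edge are linked by a
chain of simplices that contain the edge, in which consecutive ones share a hyperface. Such chains
exist in Lipschitz domains, by connectedness and general position (`exists_hyperface_chain`).

The same chains control the run of the routine. When a hyperface is crossed, the levels of the
leaves drop by at most one (`PrismForest.IsSaturated.level_le_of_mem_leaves`). If therefore no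
neighbour in space of a leaf `Q` is coarser by exactly one level, then all prisms with the
refinement edge of `Q` are leaves. With the rule on the order of the loops it follows that every
recursive call concerns a prism that is coarser by exactly one level
(`PrismForest.IsSaturated.level_le_inner`), so that its children join the patch `K` rightly. Every
prism that is split is forced by saturation, and at the end nothing is missing, because a leaf
without coarser neighbours depends on its neighbours and on prisms already split only
(`PrismForest.IsSaturated.mem_or_of_dep`). Induction on the level of `E` concludes
(`PrismForest.patchSpec`).
-/

open TaggedSimplex

/-! ### Bisection of a simplex -/

section Geometry

set_option linter.unusedSectionVars false

variable {E : Type*} [NormedAddCommGroup E] [NormedSpace ℝ E] [FiniteDimensional ℝ E]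

theorem AffineIndependent.convexHull_inter_set {V W₁ W₂ : Set E}
    (hV : AffineIndependent ℝ ((↑) : V → E)) (h₁ : W₁ ⊆ V) (h₂ : W₂ ⊆ V) :
    convexHull ℝ W₁ ∩ convexHull ℝ W₂ = convexHull ℝ (W₁ ∩ W₂) := by
  classical
  have hf : V.Finite := finite_set_of_fin_dim_affineIndependent ℝ hV
  have := AffineIndependent.convexHull_inter (R := ℝ) (s := hf.toFinset)
    (t₁ := (hf.subset h₁).toFinset) (t₂ := (hf.subset h₂).toFinset)
    (by
      have : (hf.toFinset : Set E) = V := hf.coe_toFinset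
      have h2 : ∀ V' : Set E, V' = V → AffineIndependent ℝ ((↑) : V' → E) := by
        rintro _ rfl; exact hV
      exact h2 _ this) (by simpa using h₁) (by simpa using h₂)
  simpa using this.symm

theorem AffineIndependent.mem_of_mem_convexHull {V W : Set E}
    (hV : AffineIndependent ℝ ((↑) : V → E)) (hW : W ⊆ V) {x : E} (hx : x ∈ V)
    (hxW : x ∈ convexHull ℝ W) : x ∈ W := by
  have : x ∈ convexHull ℝ {x} ∩ convexHull ℝ W := ⟨by simp, hxW⟩
  rw [hV.convexHull_inter_set (by simpa using hx) hW] at this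
  by_contra h
  rw [Set.singleton_inter_eq_empty.2 h] at this
  simp at this

/-- The vertex sets of nondegenerate simplices of full dimension. -/
structure IsSimplexSet (V : Set E) : Prop where
  indep : AffineIndependent ℝ ((↑) : V → E)
  ncard_eq : V.ncard = Module.finrank ℝ E + 1

namespace IsSimplexSet

variable {V : Set E}

theorem finite (h : IsSimplexSet V) : V.Finite :=
  finite_set_of_fin_dim_affineIndependent ℝ h.indep

theorem affineSpan_eq_top (h : IsSimplexSet V) : affineSpan ℝ V = ⊤ := by
  have := h.finite.fintype
  have h2 := h.indep.affineSpan_eq_top_iff_card_eq_finrank_add_one.2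
    (by rw [← h.ncard_eq, ← Nat.card_coe_set_eq, Nat.card_eq_fintype_card])
  simpa using h2

end IsSimplexSet

theorem isSimplexSet_of_affineSpan_eq_top {V : Set E} (hs : affineSpan ℝ V = ⊤)
    (hc : V.ncard = Module.finrank ℝ E + 1) : IsSimplexSet V := by
  have hf : V.Finite := Set.finite_of_ncard_ne_zero (by omega)
  have := hf.fintype
  refine ⟨?_, hc⟩
  rw [affineIndependent_iff_finrank_vectorSpan_eq ℝ _ (n := Module.finrank ℝ E)]
  · have := AffineSubspace.vectorSpan_eq_top_of_affineSpan_eq_top ℝ E E hs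
    rw [Subtype.range_coe, this, finrank_top]
  · rw [← hc, ← Nat.card_coe_set_eq, Nat.card_eq_fintype_card]

/-- The vertex set `V` of a simplex with an edge `{a, b}`, the other vertices being `U`. -/
structure EdgeSplit (V : Set E) (a b : E) (U : Set E) : Prop where
  simplex : IsSimplexSet V
  eq : V = insert a (insert b U)
  ne : a ≠ b
  a_notMem : a ∉ U
  b_notMem : b ∉ U

namespace EdgeSplit

variable {V U : Set E} {a b : E}

theorem symm (h : EdgeSplit V a b U) : EdgeSplit V b a U :=
  ⟨h.simplex, by rw [h.eq, Set.insert_comm], h.ne.symm, h.b_notMem, h.a_notMem⟩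

theorem exists_affineMap (h : EdgeSplit V a b U) :
    ∃ f : E →ᵃ[ℝ] ℝ, f a = 1 ∧ f b = -1 ∧ ∀ u ∈ U, f u = 0 := by
  classical
  let B : AffineBasis V ℝ E := ⟨(↑), h.simplex.indep, by simpa using h.simplex.affineSpan_eq_top⟩
  have ha : a ∈ V := by simp [h.eq]
  have hb : b ∈ V := by simp [h.eq]
  have key : ∀ (i : V) (x : E) (hx : x ∈ V), B.coord i x = if (i : E) = x then 1 else 0 := by
    intro i x hx
    have := B.coord_apply i ⟨x, hx⟩
    simp only [Subtype.ext_iff] at this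
    exact this
  refine ⟨B.coord ⟨a, ha⟩ - B.coord ⟨b, hb⟩, ?_, ?_, ?_⟩
  · simp [key _ a ha, h.ne.symm]
  · simp [key _ b hb, h.ne]
  · intro u hu
    have hu' : u ∈ V := by simp [h.eq, hu]
    simp only [AffineMap.coe_sub, Pi.sub_apply]
    rw [key _ u hu', key _ u hu', if_neg, if_neg, sub_zero]
    · rintro rfl; exact h.b_notMem hu
    · rintro rfl; exact h.a_notMem hu

theorem midpoint_notMem (h : EdgeSplit V a b U) : midpoint ℝ a b ∉ U := by
  intro hm
  have hab : midpoint ℝ a b ∈ convexHull ℝ {a, b} := by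
    rw [convexHull_pair]; exact midpoint_mem_segment _ _
  have h1 := h.simplex.indep.mem_of_mem_convexHull (W := {a, b}) (x := midpoint ℝ a b)
    (by rw [h.eq]; intro x; simp; tauto) (by simp [h.eq, hm]) hab
  rcases h1 with h1 | h1
  · exact h.a_notMem (h1 ▸ hm)
  · exact h.b_notMem (h1 ▸ hm)

theorem midpoint_ne_left (h : EdgeSplit V a b U) : midpoint ℝ a b ≠ a := by
  intro h1; exact h.ne ((midpoint_eq_left_iff (R := ℝ)).1 h1)

theorem midpoint_ne_right (h : EdgeSplit V a b U) : midpoint ℝ a b ≠ b := by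
  intro h1; exact h.ne ((midpoint_eq_right_iff (R := ℝ)).1 h1)

theorem midpoint_notMem_vertices (h : EdgeSplit V a b U) : midpoint ℝ a b ∉ V := by
  rw [h.eq]
  simp only [Set.mem_insert_iff, not_or]
  exact ⟨h.midpoint_ne_left, h.midpoint_ne_right, h.midpoint_notMem⟩

theorem midpoint_mem (h : EdgeSplit V a b U) : midpoint ℝ a b ∈ convexHull ℝ V := by
  refine convexHull_mono (s := {a, b}) ?_ ?_
  · rw [h.eq]; intro x; simp; tauto
  · rw [convexHull_pair]; exact midpoint_mem_segment _ _

/-- A face that contains the midpoint of an edge contains the edge. -/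
theorem mem_of_midpoint_mem (h : EdgeSplit V a b U) {W : Set E} (hW : W ⊆ V)
    (hm : midpoint ℝ a b ∈ convexHull ℝ W) : a ∈ W ∧ b ∈ W := by
  suffices H : ∀ {a b : E}, EdgeSplit V a b U → midpoint ℝ a b ∈ convexHull ℝ W → a ∈ W by
    exact ⟨H h hm, H h.symm (by rwa [midpoint_comm])⟩
  clear hm h
  intro a b h hm
  by_contra ha
  have hab : midpoint ℝ a b ∈ convexHull ℝ {a, b} := by
    rw [convexHull_pair]; exact midpoint_mem_segment _ _
  have h1 : midpoint ℝ a b ∈ convexHull ℝ ({a, b} ∩ W) := by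
    rw [← h.simplex.indep.convexHull_inter_set _ hW]
    · exact ⟨hab, hm⟩
    · rw [h.eq]; intro x; simp; tauto
  have h2 : midpoint ℝ a b ∈ convexHull ℝ {b} := by
    refine convexHull_mono ?_ h1
    rintro x ⟨rfl | hx, hxW⟩
    · exact absurd hxW ha
    · exact hx
  rw [convexHull_singleton] at h2
  exact h.midpoint_ne_right h2

/-- The halves of a bisected simplex are simplices. -/
theorem isSimplexSet_half (h : EdgeSplit V a b U) :
    IsSimplexSet (insert a (insert (midpoint ℝ a b) U)) := by
  have hfU : U.Finite := h.simplex.finite.subset (by rw [h.eq]; intro x hx; simp [hx])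
  apply isSimplexSet_of_affineSpan_eq_top
  · rw [eq_top_iff, ← h.simplex.affineSpan_eq_top, affineSpan_le]
    have hb : b ∈ affineSpan ℝ (insert a (insert (midpoint ℝ a b) U)) := by
      have h1 : a ∈ affineSpan ℝ (insert a (insert (midpoint ℝ a b) U)) :=
        subset_affineSpan _ _ (by simp)
      have h2 : midpoint ℝ a b ∈ affineSpan ℝ (insert a (insert (midpoint ℝ a b) U)) :=
        subset_affineSpan _ _ (by simp)
      have := AffineMap.lineMap_mem (2 : ℝ) h1 h2
      convert this using 1
      rw [AffineMap.lineMap_apply, midpoint_eq_smul_add]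
      simp only [invOf_eq_inv, vsub_eq_sub, vadd_eq_add]
      module
    rw [h.eq]
    rintro x (rfl | rfl | hx)
    · exact subset_affineSpan _ _ (by simp)
    · exact hb
    · exact subset_affineSpan _ _ (by simp [hx])
  · have := h.simplex.ncard_eq
    rw [h.eq, Set.ncard_insert_of_notMem (by simp [h.ne, h.a_notMem]) (hfU.insert _),
      Set.ncard_insert_of_notMem h.b_notMem hfU] at this
    rw [Set.ncard_insert_of_notMem _ (hfU.insert _),
      Set.ncard_insert_of_notMem h.midpoint_notMem hfU, this]
    simp [h.a_notMem, h.midpoint_ne_left.symm]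

/-- A simplex is the union of its halves. -/
theorem _root_.convexHull_insert_pair_subset (a b : E) (W : Set E) :
    convexHull ℝ (insert a (insert b W)) ⊆
      convexHull ℝ (insert a (insert (midpoint ℝ a b) W)) ∪
        convexHull ℝ (insert b (insert (midpoint ℝ a b) W)) := by
  have hseg : segment ℝ a b ⊆ segment ℝ a (midpoint ℝ a b) ∪ segment ℝ (midpoint ℝ a b) b := by
    rintro x ⟨s, t, hs, ht, hst, rfl⟩
    rcases le_total t s with h | h
    · left
      refine ⟨s - t, 2 * t, by linarith, by linarith, by linarith, ?_⟩
      rw [midpoint_eq_smul_add]; simp only [invOf_eq_inv]; module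
    · right
      refine ⟨2 * s, t - s, by linarith, by linarith, by linarith, ?_⟩
      rw [midpoint_eq_smul_add]; simp only [invOf_eq_inv]; module
  have hpair : ∀ x y : E, ∀ W : Set E, insert x (insert y W) = {x, y} ∪ W := by
    intro x y W; ext z; simp [or_assoc]
  rcases W.eq_empty_or_nonempty with rfl | hW
  · intro x hx
    have hx' : x ∈ segment ℝ a b := by
      have : x ∈ convexHull ℝ ({a, b} : Set E) := by simpa using hx
      rwa [convexHull_pair] at this
    rcases hseg hx' with h | h
    · left; rw [← convexHull_pair] at h; simpa using h
    · right; rw [segment_symm, ← convexHull_pair] at h; simpa using h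
  · intro x hx
    rw [hpair, convexHull_union (by simp) hW, mem_convexJoin] at hx
    obtain ⟨y, hy, w, hw, hx⟩ := hx
    rw [convexHull_pair] at hy
    have aux : ∀ c : E, y ∈ segment ℝ c (midpoint ℝ a b) →
        x ∈ convexHull ℝ (insert c (insert (midpoint ℝ a b) W)) := by
      intro c hc
      rw [hpair, convexHull_union (by simp) hW, mem_convexJoin]
      exact ⟨y, by rwa [convexHull_pair], w, hw, hx⟩
    rcases hseg hy with h | h
    · exact Or.inl (aux a h)
    · exact Or.inr (aux b (by rwa [segment_symm]))

theorem convexHull_half_subset (h : EdgeSplit V a b U) :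
    convexHull ℝ (insert a (insert (midpoint ℝ a b) U)) ⊆ convexHull ℝ V := by
  refine convexHull_min ?_ (convex_convexHull _ _)
  rintro x (rfl | rfl | hx)
  · exact subset_convexHull _ _ (by simp [h.eq])
  · exact h.midpoint_mem
  · exact subset_convexHull _ _ (by simp [h.eq, hx])

/-- The halves of a bisected simplex meet in the hyperface opposite to the end points of the
bisected edge. The proof uses the affine function with values `1`, `-1` at the end points and `0`
at the other vertices. -/
theorem inter_halves_subset (h : EdgeSplit V a b U) :
    convexHull ℝ (insert a (insert (midpoint ℝ a b) U)) ∩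
      convexHull ℝ (insert b (insert (midpoint ℝ a b) U)) ⊆
        convexHull ℝ (insert (midpoint ℝ a b) U) := by
  obtain ⟨f, fa, fb, fU⟩ := h.exists_affineMap
  have fm : f (midpoint ℝ a b) = 0 := by
    rw [AffineMap.map_midpoint, fa, fb]; simp [midpoint_eq_smul_add]
  have fnonpos : ∀ z ∈ convexHull ℝ (insert b (insert (midpoint ℝ a b) U)), f z ≤ 0 := by
    have : convexHull ℝ (insert b (insert (midpoint ℝ a b) U)) ⊆ f ⁻¹' Set.Iic 0 := by
      refine convexHull_min ?_ ((convex_Iic 0).affine_preimage f)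
      rintro x (rfl | rfl | hx)
      · simp [fb]
      · simp [fm]
      · simp [fU x hx]
    exact this
  have fzero : ∀ z ∈ convexHull ℝ (insert (midpoint ℝ a b) U), f z = 0 := by
    have : convexHull ℝ (insert (midpoint ℝ a b) U) ⊆ f ⁻¹' {0} := by
      refine convexHull_min ?_ ((convex_singleton 0).affine_preimage f)
      rintro x (rfl | hx)
      · simp [fm]
      · simp [fU x hx]
    exact this
  rintro z ⟨hz, hz'⟩
  rw [convexHull_insert (by simp), mem_convexJoin] at hz
  obtain ⟨a', ha', y, hy, s, t, hs, ht, hst, rfl⟩ := hz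
  rw [Set.mem_singleton_iff] at ha'
  subst a'
  have h1 := fnonpos _ hz'
  have h2 : f (s • a + t • y) = s * f a + t * f y := by
    have := Convex.combo_affine_apply (f := f) (x := a) (y := y) hst
    simpa using this
  rw [h2, fa, fzero y hy] at h1
  have hs0 : s = 0 := by linarith
  have ht1 : t = 1 := by linarith
  simpa [hs0, ht1] using hy

/-- A half of a bisected simplex meets a face that does not contain the bisected edge in a common
face. -/
theorem half_inter_face_subset (h : EdgeSplit V a b U) {W : Set E} (hW : W ⊆ V)
    (hab : ¬(a ∈ W ∧ b ∈ W)) :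
    convexHull ℝ (insert a (insert (midpoint ℝ a b) U)) ∩ convexHull ℝ W ⊆
      convexHull ℝ (W ∩ insert a (insert (midpoint ℝ a b) U)) := by
  by_cases hb : b ∈ W
  · have ha : a ∉ W := fun ha => hab ⟨ha, hb⟩
    have hWb : W ⊆ insert b (insert (midpoint ℝ a b) U) := by
      intro x hx
      have := hW hx
      rw [h.eq] at this
      rcases this with rfl | rfl | hx'
      · exact absurd hx ha
      · simp
      · simp [hx']
    rintro z ⟨hz, hzW⟩
    have h1 := h.inter_halves_subset ⟨hz, convexHull_mono hWb hzW⟩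
    have hs := h.symm.isSimplexSet_half
    rw [midpoint_comm] at hs
    have h2 : z ∈ convexHull ℝ (insert (midpoint ℝ a b) U) ∩ convexHull ℝ W := ⟨h1, hzW⟩
    rw [hs.indep.convexHull_inter_set (Set.subset_insert _ _) hWb] at h2
    refine convexHull_mono ?_ h2
    rintro x ⟨hx, hx'⟩
    exact ⟨hx', Set.mem_insert_of_mem _ hx⟩
  · rintro z ⟨-, hzW⟩
    refine convexHull_mono ?_ hzW
    intro x hx
    refine ⟨hx, ?_⟩
    have := hW hx
    rw [h.eq] at this
    rcases this with rfl | rfl | hx'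
    · simp
    · exact absurd hx hb
    · simp [hx']

/-- A half of a bisected simplex meets a face that contains the bisected edge in the corresponding
half of that face. -/
theorem half_inter_face_subset_of_mem (h : EdgeSplit V a b U) {W : Set E} (hW : W ⊆ V)
    (ha : a ∈ W) (hb : b ∈ W) :
    convexHull ℝ (insert a (insert (midpoint ℝ a b) U)) ∩ convexHull ℝ W ⊆
      convexHull ℝ (insert a (insert (midpoint ℝ a b) (W \ {a, b}))) := by
  rintro z ⟨hz, hzW⟩
  have hWeq : W = insert a (insert b (W \ {a, b})) := by
    ext x
    simp only [Set.mem_insert_iff, Set.mem_sdiff, Set.mem_singleton_iff]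
    constructor
    · intro hx; by_cases x = a <;> by_cases x = b <;> tauto
    · rintro (rfl | rfl | hx)
      exacts [ha, hb, hx.1]
  have hWU : W \ {a, b} ⊆ U := by
    rintro x ⟨hx, hx'⟩
    have := hW hx
    rw [h.eq] at this
    rcases this with rfl | rfl | hxU
    · simp at hx'
    · simp at hx'
    · exact hxU
  rw [hWeq] at hzW
  rcases convexHull_insert_pair_subset a b _ hzW with h1 | h1
  · exact h1
  · have h2 := h.inter_halves_subset ⟨hz, convexHull_mono
      (Set.insert_subset_insert (Set.insert_subset_insert hWU)) h1⟩
    have hs := h.symm.isSimplexSet_half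
    rw [midpoint_comm] at hs
    have h3 : z ∈ convexHull ℝ (insert (midpoint ℝ a b) U) ∩
      convexHull ℝ (insert b (insert (midpoint ℝ a b) (W \ {a, b}))) := ⟨h2, h1⟩
    rw [hs.indep.convexHull_inter_set (Set.subset_insert _ _)
      (Set.insert_subset_insert (Set.insert_subset_insert hWU))] at h3
    refine convexHull_mono ?_ h3
    rintro x ⟨hx, rfl | rfl | hx'⟩
    · rcases hx with hx | hx
      · exact absurd hx.symm h.midpoint_ne_right
      · exact absurd hx h.b_notMem
    · simp
    · simp [hx']

end EdgeSplit

end Geometry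

/-! ### Chains of simplices around a point -/

section Chains

theorem affineSpan_ne_top_of_ncard_le {E : Type*} [NormedAddCommGroup E] [NormedSpace ℝ E]
    [FiniteDimensional ℝ E] {W : Set E} (hW : W.Finite) (hc : W.ncard ≤ Module.finrank ℝ E) :
    affineSpan ℝ W ≠ ⊤ := by
  intro h
  rcases W.eq_empty_or_nonempty with rfl | hne
  · rw [AffineSubspace.span_empty] at h
    exact AffineSubspace.bot_ne_top ℝ E E h
  · have := hW.fintype
    have hpos : 0 < W.ncard := (Set.ncard_pos hW).2 hne
    obtain ⟨n, hn⟩ : ∃ n, W.ncard = n + 1 := ⟨W.ncard - 1, by omega⟩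
    have h1 := finrank_vectorSpan_range_le ℝ ((↑) : W → E) (n := n)
      (by rw [← hn, ← Nat.card_coe_set_eq, Nat.card_eq_fintype_card])
    rw [Subtype.range_coe, AffineSubspace.vectorSpan_eq_top_of_affineSpan_eq_top ℝ E E h,
      finrank_top] at h1
    omega

theorem exists_mem_forall_notMem_affineSubspace {d : ℕ} {ι : Type*} {s : Set ι} (hs : s.Finite)
    (A : ι → AffineSubspace ℝ (EuclideanSpace ℝ (Fin d))) (hA : ∀ i ∈ s, A i ≠ ⊤)
    {O : Set (EuclideanSpace ℝ (Fin d))} (hO : IsOpen O) (hne : O.Nonempty) :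
    ∃ p ∈ O, ∀ i ∈ s, p ∉ A i := by
  by_contra! h
  have hsub : O ⊆ ⋃ i ∈ s, (A i : Set (EuclideanSpace ℝ (Fin d))) := by
    intro p hp
    obtain ⟨i, hi, hpi⟩ := h p hp
    exact Set.mem_biUnion hi hpi
  have h0 : MeasureTheory.volume (⋃ i ∈ s, (A i : Set (EuclideanSpace ℝ (Fin d)))) = 0 :=
    (MeasureTheory.measure_biUnion_null_iff hs.countable).2 fun i hi =>
      MeasureTheory.Measure.addHaar_affineSubspace _ _ (hA i hi)
  exact (hO.measure_pos MeasureTheory.volume hne).ne' (MeasureTheory.measure_mono_null hsub h0)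

/-- Near a point of its closure, any two points of a Lipschitz domain can be joined inside the
domain: move both of them in the direction `w` of the last coordinate, then join the results by a
segment. -/
theorem IsBoundedLipschitzDomain.exists_local_path {d : ℕ} {Ω : Set (EuclideanSpace ℝ (Fin d))}
    (hΩ : IsBoundedLipschitzDomain Ω) {x : EuclideanSpace ℝ (Fin d)} (hx : x ∈ closure Ω)
    {r : ℝ} (hr : 0 < r) :
    ∃ ρ > 0, ∃ w : EuclideanSpace ℝ (Fin d), ∀ p ∈ Metric.ball x ρ ∩ Ω, ∀ q ∈ Metric.ball x ρ ∩ Ω,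
      segment ℝ p (p + w) ∪ (segment ℝ (p + w) (q + w) ∪ segment ℝ (q + w) q) ⊆
        Metric.ball x r ∩ Ω := by
  by_cases hxΩ : x ∈ Ω
  · obtain ⟨ε, hε, hεΩ⟩ := Metric.isOpen_iff.1 hΩ.isOpen x hxΩ
    refine ⟨min ε r, lt_min hε hr, 0, ?_⟩
    rintro p ⟨hp, -⟩ q ⟨hq, -⟩
    have hsub : Metric.ball x (min ε r) ⊆ Metric.ball x r ∩ Ω := fun y hy =>
      ⟨Metric.ball_subset_ball (min_le_right _ _) hy,
        hεΩ (Metric.ball_subset_ball (min_le_left _ _) hy)⟩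
    refine subset_trans ?_ hsub
    simp only [add_zero]
    have hc := convex_ball x (min ε r)
    exact Set.union_subset (hc.segment_subset hp hp)
      (Set.union_subset (hc.segment_subset hp hq) (hc.segment_subset hq hq))
  · have hfr : x ∈ frontier Ω := by
      rw [frontier, hΩ.isOpen.interior_eq]; exact ⟨hx, hxΩ⟩
    obtain ⟨e, g, L, r', he, hg, hge, hr', hball⟩ := hΩ.lipschitz_boundary x hfr
    set R := min r r' with hR
    have hRpos : 0 < R := lt_min hr hr'
    have hL : (0 : ℝ) ≤ L := L.2
    set ρ := R / (L + 4) with hρ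
    have hρpos : 0 < ρ := by positivity
    have hRρ : R = ρ * (L + 4) := by rw [hρ]; field_simp
    have hgx : g x ≤ inner ℝ e x := by
      have hcl : IsClosed {y | g y ≤ inner ℝ e y} :=
        isClosed_le hg.continuous (continuous_const.inner continuous_id)
      have : x ∈ closure (Ω ∩ Metric.ball x r') := by
        rw [Metric.mem_closure_iff]
        intro ε hε
        obtain ⟨y, hy, hxy⟩ := Metric.mem_closure_iff.1 hx (min ε r') (lt_min hε hr')
        exact ⟨y, ⟨hy, by rw [Metric.mem_ball, dist_comm]; exact hxy.trans_le (min_le_right _ _)⟩,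
          hxy.trans_le (min_le_left _ _)⟩
      exact closure_minimal (fun y hy => ((hball y hy.2).1 hy.1).le) hcl this
    have hee : inner ℝ e e = 1 := by rw [real_inner_self_eq_norm_sq, he]; norm_num
    set s := (L + 2) * ρ with hs
    have hspos : 0 < s := by positivity
    -- A vertical shift by at most `s` does not leave the ball and does not change `g`.
    have hin : ∀ y ∈ Metric.ball x ρ, ∀ τ : ℝ, 0 ≤ τ → τ ≤ s → g y < inner ℝ e y + τ →
        y + τ • e ∈ Metric.ball x r ∩ Ω := by
      intro y hy τ h0 h1 h2
      have hd : dist (y + τ • e) x < R := by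
        rw [Metric.mem_ball] at hy
        have h3 : dist (y + τ • e) y = τ := by
          rw [dist_eq_norm, add_sub_cancel_left, norm_smul, he, mul_one, Real.norm_of_nonneg h0]
        have := dist_triangle (y + τ • e) y x
        nlinarith
      refine ⟨Metric.ball_subset_ball (min_le_left _ _) hd, ?_⟩
      rw [hball _ (Metric.ball_subset_ball (min_le_right _ _) hd), hge, inner_add_right,
        inner_smul_right, hee, mul_one]
      exact h2
    have hver : ∀ p ∈ Metric.ball x ρ ∩ Ω, segment ℝ p (p + s • e) ⊆ Metric.ball x r ∩ Ω := by
      rintro p ⟨hp, hpΩ⟩ y ⟨a, b, ha, hb, hab, rfl⟩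
      have hp' : p ∈ Metric.ball x r' := by
        refine Metric.ball_subset_ball ?_ hp
        have : R ≤ r' := min_le_right _ _
        nlinarith
      have h1 := (hball p hp').1 hpΩ
      have h2 : a • p + b • (p + s • e) = p + (b * s) • e := by
        have : a = 1 - b := by linarith
        subst this; module
      rw [h2]
      exact hin p hp _ (by positivity) (by nlinarith) (by nlinarith)
    refine ⟨ρ, hρpos, s • e, ?_⟩
    rintro p hp q hq
    refine Set.union_subset (hver p hp) (Set.union_subset ?_ ?_)
    · rintro _ ⟨a, b, ha, hb, hab, rfl⟩
      have h2 : a • (p + s • e) + b • (q + s • e) = (a • p + b • q) + s • e := by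
        have : a = 1 - b := by linarith
        subst this; module
      rw [h2]
      have hy : a • p + b • q ∈ Metric.ball x ρ := (convex_ball x ρ) hp.1 hq.1 ha hb hab
      refine hin _ hy s hspos.le le_rfl ?_
      set y := a • p + b • q
      rw [Metric.mem_ball] at hy
      have h3 : g y ≤ g x + L * ρ := by
        have := hg.dist_le_mul y x
        rw [Real.dist_eq] at this
        have := le_abs_self (g y - g x)
        nlinarith
      have h4 : inner ℝ e x - inner ℝ e y ≤ ρ := by
        rw [← inner_sub_right]
        have := real_inner_le_norm e (x - y)
        rw [he, one_mul, ← dist_eq_norm, dist_comm] at this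
        linarith
      nlinarith
    · rw [segment_symm]; exact hver q hq

/-- In a conforming triangulation of a Lipschitz domain, any two simplices that contain a point `x`
are linked by a chain of simplices that contain `x`, in which consecutive ones share a hyperface.
A path in general position, which avoids all faces of codimension two, leads through such a
chain. -/
theorem exists_hyperface_chain {d : ℕ} {Ω : Set (EuclideanSpace ℝ (Fin d))}
    (hΩ : IsBoundedLipschitzDomain Ω) {𝒱 : Set (Set (EuclideanSpace ℝ (Fin d)))} (hfin : 𝒱.Finite)
    (hs : ∀ V ∈ 𝒱, IsSimplexSet V) (hcov : ⋃ V ∈ 𝒱, convexHull ℝ V = closure Ω)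
    (hconf : ∀ V ∈ 𝒱, ∀ V' ∈ 𝒱, convexHull ℝ V ∩ convexHull ℝ V' ⊆ convexHull ℝ (V ∩ V'))
    {x : EuclideanSpace ℝ (Fin d)} {V V' : Set (EuclideanSpace ℝ (Fin d))} (hV : V ∈ 𝒱)
    (hV' : V' ∈ 𝒱) (hxV : x ∈ convexHull ℝ V) (hxV' : x ∈ convexHull ℝ V') :
    Relation.ReflTransGen (fun A B => B ∈ 𝒱 ∧ x ∈ convexHull ℝ B ∧ d ≤ (A ∩ B).ncard) V V' := by
  classical
  have hcl : ∀ A ∈ 𝒱, IsClosed (convexHull ℝ A) := fun A hA =>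
    ((hs A hA).finite.isCompact_convexHull ℝ).isClosed
  have hclU : ∀ 𝒜 ⊆ 𝒱, IsClosed (⋃ A ∈ 𝒜, convexHull ℝ A) := fun 𝒜 h𝒜 =>
    (hfin.subset h𝒜).isClosed_biUnion fun A hA => hcl A (h𝒜 hA)
  have hxcl : x ∈ closure Ω := by rw [← hcov]; exact Set.mem_biUnion hV hxV
  -- A ball around `x` that meets only simplices containing `x`.
  obtain ⟨r, hr, hball⟩ : ∃ r > 0, ∀ y ∈ Metric.ball x r, ∀ A ∈ 𝒱, y ∈ convexHull ℝ A →
      x ∈ convexHull ℝ A := by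
    have h1 := hclU {A ∈ 𝒱 | x ∉ convexHull ℝ A} (Set.sep_subset _ _)
    have h2 : x ∉ ⋃ A ∈ {A ∈ 𝒱 | x ∉ convexHull ℝ A}, convexHull ℝ A := by
      simp only [Set.mem_iUnion, not_exists]
      intro A hA hxA
      exact hA.2 hxA
    obtain ⟨r, hr, hr'⟩ := Metric.isOpen_iff.1 h1.isOpen_compl x h2
    refine ⟨r, hr, fun y hy A hA hyA => ?_⟩
    by_contra hxA
    exact hr' hy (Set.mem_biUnion (show A ∈ {A ∈ 𝒱 | x ∉ convexHull ℝ A} from ⟨hA, hxA⟩) hyA)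
  obtain ⟨ρ, hρ, w, hpath⟩ := hΩ.exists_local_path hxcl hr
  have hopen : ∀ A ∈ 𝒱, x ∈ convexHull ℝ A →
      IsOpen (interior (convexHull ℝ A) ∩ Metric.ball x ρ ∩ Ω) ∧
        (interior (convexHull ℝ A) ∩ Metric.ball x ρ ∩ Ω).Nonempty := by
    intro A hA hxA
    refine ⟨(isOpen_interior.inter Metric.isOpen_ball).inter hΩ.isOpen, ?_⟩
    have hint : (interior (convexHull ℝ A)).Nonempty :=
      interior_convexHull_nonempty_iff_affineSpan_eq_top.2 (hs A hA).affineSpan_eq_top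
    have h1 : x ∈ closure (interior (convexHull ℝ A)) := by
      rw [(convex_convexHull ℝ A).closure_interior_eq_closure_of_nonempty_interior hint]
      exact subset_closure hxA
    obtain ⟨y, hy, hyb⟩ := mem_closure_iff.1 h1 _ Metric.isOpen_ball (Metric.mem_ball_self hρ)
    have h2 : y ∈ closure Ω := by
      rw [← hcov]; exact Set.mem_biUnion hA (interior_subset hyb)
    obtain ⟨z, hz, hzΩ⟩ := mem_closure_iff.1 h2 _ (isOpen_interior.inter Metric.isOpen_ball)
      ⟨hyb, hy⟩
    exact ⟨z, hz, hzΩ⟩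
  -- The low-dimensional faces, to be avoided.
  let 𝒲 : Set (Set (EuclideanSpace ℝ (Fin d))) :=
    {W | ∃ A ∈ 𝒱, W ⊆ A ∧ W.ncard < d}
  have h𝒲fin : 𝒲.Finite := by
    refine (hfin.biUnion fun A hA => (hs A hA).finite.finite_subsets).subset ?_
    rintro W ⟨A, hA, hWA, -⟩
    exact Set.mem_biUnion hA hWA
  have hfW : ∀ W ∈ 𝒲, W.Finite := by
    rintro W ⟨A, hA, hWA, -⟩
    exact (hs A hA).finite.subset hWA
  have hnetop : ∀ W ∈ 𝒲, ∀ y, affineSpan ℝ (insert y W) ≠ ⊤ := by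
    intro W hW y
    refine affineSpan_ne_top_of_ncard_le ((hfW W hW).insert _) ?_
    obtain ⟨A, hA, hWA, hc⟩ := hW
    have := Set.ncard_insert_le y W
    simp only [finrank_euclideanSpace, Fintype.card_fin]
    omega
  -- Points `y` such that the line `y + ℝ w` avoids the low-dimensional faces.
  have hline : ∀ y : EuclideanSpace ℝ (Fin d),
      (∀ W ∈ 𝒲, y ∉ affineSpan ℝ (insert ((if h : W.Nonempty then h.some else 0) + w) W)) →
      ∀ W ∈ 𝒲, ∀ τ : ℝ, y + τ • w ∉ affineSpan ℝ W := by
    intro y hy W hW τ hτ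
    have hne : W.Nonempty := by
      rw [← affineSpan_nonempty ℝ]; exact ⟨_, hτ⟩
    apply hy W hW
    rw [dif_pos hne]
    have h1 : y + τ • w ∈ affineSpan ℝ (insert (hne.some + w) W) :=
      affineSpan_mono ℝ (Set.subset_insert _ _) hτ
    have h2 : hne.some ∈ affineSpan ℝ (insert (hne.some + w) W) :=
      subset_affineSpan _ _ (Set.mem_insert_of_mem _ hne.some_mem)
    have h3 : hne.some + w ∈ affineSpan ℝ (insert (hne.some + w) W) :=
      subset_affineSpan _ _ (Set.mem_insert _ _)
    have := AffineSubspace.smul_vsub_vadd_mem _ (-τ) h3 h2 h1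
    convert this using 1
    simp only [vsub_eq_sub, vadd_eq_add]
    module
  obtain ⟨p, hp, hpW⟩ := exists_mem_forall_notMem_affineSubspace h𝒲fin
    (fun W => affineSpan ℝ (insert ((if h : W.Nonempty then h.some else 0) + w) W))
    (fun W hW => hnetop W hW _) (hopen V hV hxV).1 (hopen V hV hxV).2
  have hpl := hline p hpW
  obtain ⟨hqo, hqne⟩ := hopen V' hV' hxV'
  obtain ⟨q', hq', hqW⟩ := exists_mem_forall_notMem_affineSubspace (h𝒲fin.union h𝒲fin |>.prod
      (Set.finite_univ (α := Bool)))
    (fun W : Set (EuclideanSpace ℝ (Fin d)) × Bool => if W.2 then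
      affineSpan ℝ (insert ((if h : W.1.Nonempty then h.some else 0) + w) W.1)
      else affineSpan ℝ (insert (p + w) W.1))
    (by
      rintro ⟨W, b⟩ hW
      have hW' : W ∈ 𝒲 := by simpa using hW
      cases b
      · simpa using hnetop W hW' _
      · simpa using hnetop W hW' _)
    (hqo.preimage (continuous_id.sub continuous_const : Continuous fun y => y - w))
    (by obtain ⟨y, hy⟩ := hqne; exact ⟨y + w, by simpa using hy⟩)
  obtain ⟨q, rfl⟩ : ∃ q, q' = q + w := ⟨q' - w, by simp⟩
  have hq : q ∈ interior (convexHull ℝ V') ∩ Metric.ball x ρ ∩ Ω := by simpa using hq'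
  have hql := hline (q + w) fun W hW => by simpa using hqW (W, true) (by simpa using hW)
  have hqs : ∀ W ∈ 𝒲, q + w ∉ affineSpan ℝ (insert (p + w) W) := fun W hW => by
    simpa using hqW (W, false) (by simpa using hW)
  set Z := segment ℝ p (p + w) ∪ (segment ℝ (p + w) (q + w) ∪ segment ℝ (q + w) q) with hZ
  have hZsub := hpath p ⟨hp.1.2, hp.2⟩ q ⟨hq.1.2, hq.2⟩
  have hpZ : p ∈ Z := Or.inl (left_mem_segment _ _ _)
  have hqZ : q ∈ Z := Or.inr (Or.inr (right_mem_segment _ _ _))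
  have hZc : IsPreconnected Z := by
    refine IsPreconnected.union (p + w) (right_mem_segment _ _ _)
      (Or.inl (left_mem_segment _ _ _)) (convex_segment _ _).isPreconnected ?_
    exact IsPreconnected.union (q + w) (right_mem_segment _ _ _) (left_mem_segment _ _ _)
      (convex_segment _ _).isPreconnected (convex_segment _ _).isPreconnected
  have hZW : ∀ W ∈ 𝒲, ∀ z ∈ Z, z ∉ affineSpan ℝ W := by
    rintro W hW z (⟨a, b, ha, hb, hab, rfl⟩ | ⟨a, b, ha, hb, hab, rfl⟩ | ⟨a, b, ha, hb, hab, rfl⟩)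
    · have := hpl W hW b
      convert this using 2
      have : a = 1 - b := by linarith
      subst this; module
    · intro hz
      by_cases hb0 : b = 0
      · have ha1 : a = 1 := by linarith
        apply hpl W hW 1
        simpa [hb0, ha1] using hz
      · apply hqs W hW
        have h1 := affineSpan_mono ℝ (Set.subset_insert (p + w) W) hz
        have h2 : p + w ∈ affineSpan ℝ (insert (p + w) W) :=
          subset_affineSpan _ _ (Set.mem_insert _ _)
        have := AffineMap.lineMap_mem (b⁻¹) h2 h1
        convert this using 1
        have : a = 1 - b := by linarith
        subst this
        rw [AffineMap.lineMap_apply]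
        simp only [vsub_eq_sub, vadd_eq_add]
        have h3 : (1 - b) • (p + w) + b • (q + w) - (p + w) = b • (q - p) := by module
        rw [h3, smul_smul, inv_mul_cancel₀ hb0]; module
    · have := hql W hW (-b)
      convert this using 2
      have : a = 1 - b := by linarith
      subst this; module
  -- The simplices that can be reached and those that cannot would separate the path.
  by_contra hcon
  let Rel : Set (EuclideanSpace ℝ (Fin d)) → Set (EuclideanSpace ℝ (Fin d)) → Prop :=
    fun A B => B ∈ 𝒱 ∧ x ∈ convexHull ℝ B ∧ d ≤ (A ∩ B).ncard
  let 𝒜 : Set (Set (EuclideanSpace ℝ (Fin d))) := {A ∈ 𝒱 | Relation.ReflTransGen Rel V A}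
  let ℬ : Set (Set (EuclideanSpace ℝ (Fin d))) := {A ∈ 𝒱 | ¬Relation.ReflTransGen Rel V A}
  obtain ⟨z, hzZ, hz𝒜, hzℬ⟩ := isPreconnected_closed_iff.1 hZc (⋃ A ∈ 𝒜, convexHull ℝ A)
    (⋃ A ∈ ℬ, convexHull ℝ A) (hclU _ (Set.sep_subset _ _)) (hclU _ (Set.sep_subset _ _))
    (by
      intro z hz
      have hz' : z ∈ ⋃ V ∈ 𝒱, convexHull ℝ V := by rw [hcov]; exact subset_closure (hZsub hz).2
      simp only [Set.mem_iUnion, exists_prop] at hz'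
      obtain ⟨A, hA, hzA⟩ := hz'
      by_cases hr : Relation.ReflTransGen Rel V A
      · exact Or.inl (Set.mem_biUnion (show A ∈ 𝒜 from ⟨hA, hr⟩) hzA)
      · exact Or.inr (Set.mem_biUnion (show A ∈ ℬ from ⟨hA, hr⟩) hzA))
    ⟨p, hpZ, Set.mem_biUnion (show V ∈ 𝒜 from ⟨hV, Relation.ReflTransGen.refl⟩)
      (interior_subset hp.1.1)⟩
    ⟨q, hqZ, Set.mem_biUnion (show V' ∈ ℬ from ⟨hV', hcon⟩) (interior_subset hq.1.1)⟩
  simp only [Set.mem_iUnion, exists_prop] at hz𝒜 hzℬ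
  obtain ⟨A, ⟨hA, hVA⟩, hzA⟩ := hz𝒜
  obtain ⟨B, ⟨hB, hVB⟩, hzB⟩ := hzℬ
  refine hVB (hVA.tail ⟨hB, hball z (hZsub hzZ).1 B hB hzB, ?_⟩)
  by_contra hlt
  exact hZW (A ∩ B) ⟨A, hA, Set.inter_subset_left, by omega⟩ z hzZ
    (convexHull_subset_affineSpan _ (hconf A hA B hB ⟨hzA, hzB⟩))

end Chains

/-! ### Tagged simplices and their children -/

namespace TaggedSimplex

variable {d : ℕ} {S S' C C' : TaggedSimplex d}

theorem vertex_eq_v (S : TaggedSimplex d) (j : Fin (d + 1)) : S.vertex j = S.v j := by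
  simp [v]

theorem val_ofNat {j : ℕ} (hj : j ≤ d) : ((Fin.ofNat (d + 1) j : Fin (d + 1)) : ℕ) = j := by
  simp [Fin.ofNat, Nat.mod_eq_of_lt (Nat.lt_succ_of_le hj)]

theorem mem_vertices {x : EuclideanSpace ℝ (Fin d)} :
    x ∈ S.vertices ↔ ∃ j ≤ d, S.v j = x := by
  constructor
  · rintro ⟨j, rfl⟩
    exact ⟨j, by omega, (S.vertex_eq_v j).symm⟩
  · rintro ⟨j, -, rfl⟩
    exact ⟨_, rfl⟩

theorem v_mem_vertices (S : TaggedSimplex d) (j : ℕ) : S.v j ∈ S.vertices := ⟨_, rfl⟩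

/-- The vertices `x₁, …, x_{d-1}`, which do not lie on the refinement edge. -/
def innerVertices (S : TaggedSimplex d) : Set (EuclideanSpace ℝ (Fin d)) :=
  S.v '' Set.Icc 1 (d - 1)

theorem vertices_eq (S : TaggedSimplex d) :
    S.vertices = insert (S.v 0) (insert (S.v d) S.innerVertices) := by
  ext x
  rw [mem_vertices]
  simp only [innerVertices, Set.mem_insert_iff, Set.mem_image, Set.mem_Icc]
  constructor
  · rintro ⟨j, hj, rfl⟩
    by_cases h0 : j = 0
    · left; rw [h0]
    · by_cases h1 : j = d
      · right; left; rw [h1]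
      · right; right; exact ⟨j, by omega, rfl⟩
  · rintro (rfl | rfl | ⟨j, hj, rfl⟩)
    · exact ⟨0, by omega, rfl⟩
    · exact ⟨d, le_rfl, rfl⟩
    · exact ⟨j, by omega, rfl⟩

theorem v_injOn (hS : AffineIndependent ℝ S.vertex) {i j : ℕ} (hi : i ≤ d) (hj : j ≤ d)
    (h : S.v i = S.v j) : i = j := by
  have := hS.injective h
  have h2 := congrArg Fin.val this
  rwa [val_ofNat hi, val_ofNat hj] at h2

theorem isSimplexSet_vertices (hS : AffineIndependent ℝ S.vertex) : IsSimplexSet S.vertices := by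
  refine ⟨hS.range, ?_⟩
  rw [vertices, ← Set.image_univ, Set.ncard_image_of_injective _ hS.injective]
  simp [Set.ncard_univ]

theorem affineIndependent_of_isSimplexSet (h : IsSimplexSet S.vertices) :
    AffineIndependent ℝ S.vertex := by
  have hinj : Function.Injective S.vertex := by
    have h1 := h.ncard_eq
    rw [finrank_euclideanSpace, Fintype.card_fin] at h1
    have h2 : (Finset.univ.image S.vertex).card = (Finset.univ : Finset (Fin (d + 1))).card := by
      rw [← Set.ncard_coe_finset]; simpa [vertices] using h1
    exact Set.injOn_univ.1 (by simpa using Finset.card_image_iff.1 h2)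
  exact AffineIndependent.of_set_of_injective h.indep hinj

theorem edgeSplit (hd : 1 ≤ d) (hS : AffineIndependent ℝ S.vertex) :
    EdgeSplit S.vertices (S.v 0) (S.v d) S.innerVertices where
  simplex := isSimplexSet_vertices hS
  eq := S.vertices_eq
  ne h := by have := v_injOn hS (Nat.zero_le d) le_rfl h; omega
  a_notMem := by
    rintro ⟨j, hj, h⟩
    simp only [Set.mem_Icc] at hj
    have := v_injOn hS (by omega) (by omega) h
    omega
  b_notMem := by
    rintro ⟨j, hj, h⟩
    simp only [Set.mem_Icc] at hj
    have := v_injOn hS (by omega) (by omega) h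
    omega

theorem child₀_v {j : ℕ} (hj : j ≤ d) :
    S.child₀.v j = if j = 0 then S.v 0 else if j = 1 then S.newVertex else S.v (j - 1) := by
  simp only [v, child₀, val_ofNat hj]

theorem child₁_v {j : ℕ} (hj : j ≤ d) :
    S.child₁.v j = if j = 0 then S.v d else if j = 1 then S.newVertex
      else if j ≤ S.type + 1 then S.v (j - 1) else S.v (d + S.type + 1 - j) := by
  simp only [v, child₁, val_ofNat hj]

theorem reflect_v {j : ℕ} (hj : j ≤ d) :
    S.reflect.v j = if j = 0 then S.v d else if j = d then S.v 0
      else if j ≤ S.type then S.v j else S.v (d + S.type - j) := by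
  simp only [v, reflect, val_ofNat hj]

theorem child₀_vertices (hd : 1 ≤ d) :
    S.child₀.vertices = insert (S.v 0) (insert S.newVertex S.innerVertices) := by
  ext x
  rw [mem_vertices]
  simp only [innerVertices, Set.mem_insert_iff, Set.mem_image, Set.mem_Icc]
  constructor
  · rintro ⟨j, hj, rfl⟩
    rw [child₀_v hj]
    split_ifs with h0 h1
    · left; rfl
    · right; left; rfl
    · right; right; exact ⟨j - 1, by omega, rfl⟩
  · rintro (rfl | rfl | ⟨j, hj, rfl⟩)
    · exact ⟨0, by omega, by rw [child₀_v (by omega), if_pos rfl]⟩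
    · exact ⟨1, hd, by rw [child₀_v hd, if_neg one_ne_zero, if_pos rfl]⟩
    · refine ⟨j + 1, by omega, ?_⟩
      rw [child₀_v (by omega), if_neg (by omega), if_neg (by omega), Nat.add_sub_cancel]

theorem child₁_vertices (hd : 1 ≤ d) (ht : S.type < d) :
    S.child₁.vertices = insert (S.v d) (insert S.newVertex S.innerVertices) := by
  ext x
  rw [mem_vertices]
  simp only [innerVertices, Set.mem_insert_iff, Set.mem_image, Set.mem_Icc]
  constructor
  · rintro ⟨j, hj, rfl⟩
    rw [child₁_v hj]
    split_ifs with h0 h1 h2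
    · left; rfl
    · right; left; rfl
    · right; right; exact ⟨j - 1, by omega, rfl⟩
    · right; right; exact ⟨d + S.type + 1 - j, by omega, rfl⟩
  · rintro (rfl | rfl | ⟨j, hj, rfl⟩)
    · exact ⟨0, by omega, by rw [child₁_v (by omega), if_pos rfl]⟩
    · exact ⟨1, hd, by rw [child₁_v hd, if_neg one_ne_zero, if_pos rfl]⟩
    · by_cases hjt : j ≤ S.type
      · refine ⟨j + 1, by omega, ?_⟩
        rw [child₁_v (by omega), if_neg (by omega), if_neg (by omega), if_pos (by omega),
          Nat.add_sub_cancel]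
      · refine ⟨d + S.type + 1 - j, by omega, ?_⟩
        rw [child₁_v (by omega), if_neg (by omega), if_neg (by omega), if_neg (by omega)]
        congr 1; omega

/-- A description of the children of a simplex that treats the two end points of the refinement
edge alike: `a` is the end point that belongs to the child `C`. -/
structure IsHalf (S C : TaggedSimplex d) (a b : EuclideanSpace ℝ (Fin d)) : Prop where
  split : EdgeSplit S.vertices a b S.innerVertices
  vertices_eq : C.vertices = insert a (insert S.newVertex S.innerVertices)
  newVertex_eq : S.newVertex = midpoint ℝ a b
  ends : (a = S.v 0 ∧ b = S.v d) ∨ (a = S.v d ∧ b = S.v 0)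

theorem mem_bisect : C ∈ S.bisect ↔ C = S.child₀ ∨ C = S.child₁ := by
  classical
  simp [bisect]

theorem isHalf_child₀ (hd : 1 ≤ d) (hS : AffineIndependent ℝ S.vertex) :
    IsHalf S S.child₀ (S.v 0) (S.v d) :=
  ⟨edgeSplit hd hS, child₀_vertices hd, rfl, Or.inl ⟨rfl, rfl⟩⟩

theorem isHalf_child₁ (hd : 1 ≤ d) (hS : AffineIndependent ℝ S.vertex) (ht : S.type < d) :
    IsHalf S S.child₁ (S.v d) (S.v 0) :=
  ⟨(edgeSplit hd hS).symm, child₁_vertices hd ht, midpoint_comm _ _, Or.inr ⟨rfl, rfl⟩⟩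

theorem exists_isHalf (hd : 1 ≤ d) (hS : AffineIndependent ℝ S.vertex) (ht : S.type < d)
    (hC : C ∈ S.bisect) : ∃ a b, IsHalf S C a b := by
  rcases mem_bisect.1 hC with rfl | rfl
  · exact ⟨_, _, isHalf_child₀ hd hS⟩
  · exact ⟨_, _, isHalf_child₁ hd hS ht⟩

theorem affineIndependent_of_mem_bisect (hd : 1 ≤ d) (hS : AffineIndependent ℝ S.vertex)
    (ht : S.type < d) (hC : C ∈ S.bisect) : AffineIndependent ℝ C.vertex := by
  obtain ⟨a, b, h⟩ := exists_isHalf hd hS ht hC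
  apply affineIndependent_of_isSimplexSet
  rw [h.vertices_eq, h.newVertex_eq]
  exact h.split.isSimplexSet_half

theorem type_of_mem_bisect (hC : C ∈ S.bisect) : C.type = (S.type + 1) % d := by
  rcases mem_bisect.1 hC with rfl | rfl <;> rfl

theorem level_of_mem_bisect (hC : C ∈ S.bisect) : C.level = S.level + 1 := by
  rcases mem_bisect.1 hC with rfl | rfl <;> rfl

theorem carrier_subset_of_mem_bisect (hd : 1 ≤ d) (hS : AffineIndependent ℝ S.vertex)
    (ht : S.type < d) (hC : C ∈ S.bisect) : C.carrier ⊆ S.carrier := by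
  obtain ⟨a, b, h⟩ := exists_isHalf hd hS ht hC
  rw [carrier, h.vertices_eq, h.newVertex_eq]
  exact h.split.convexHull_half_subset

theorem carrier_eq_union (hd : 1 ≤ d) (hS : AffineIndependent ℝ S.vertex) (ht : S.type < d) :
    S.carrier = S.child₀.carrier ∪ S.child₁.carrier := by
  apply subset_antisymm
  · rw [carrier, carrier, carrier, child₀_vertices hd, child₁_vertices hd ht, vertices_eq]
    exact convexHull_insert_pair_subset _ _ _
  · exact Set.union_subset
      (carrier_subset_of_mem_bisect hd hS ht (mem_bisect.2 (Or.inl rfl)))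
      (carrier_subset_of_mem_bisect hd hS ht (mem_bisect.2 (Or.inr rfl)))

theorem newVertex_mem_carrier (hd : 1 ≤ d) (hS : AffineIndependent ℝ S.vertex) :
    S.newVertex ∈ S.carrier := (edgeSplit hd hS).midpoint_mem

theorem newVertex_notMem (hd : 1 ≤ d) (hS : AffineIndependent ℝ S.vertex) :
    S.newVertex ∉ S.vertices := (edgeSplit hd hS).midpoint_notMem_vertices

namespace IsHalf

variable {a b x : EuclideanSpace ℝ (Fin d)}

theorem mem_or (h : IsHalf S C a b) (hx : x ∈ C.vertices) : x = S.newVertex ∨ x ∈ S.vertices := by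
  rw [h.vertices_eq] at hx
  rw [h.split.eq]
  rcases hx with rfl | rfl | hx
  · right; simp
  · left; rfl
  · right; simp [hx]

theorem b_notMem (h : IsHalf S C a b) : b ∉ C.vertices := by
  rw [h.vertices_eq, h.newVertex_eq]
  rintro (hb | hb | hb)
  · exact h.split.ne hb.symm
  · exact h.split.midpoint_ne_right hb.symm
  · exact h.split.b_notMem hb

theorem b_notMem_carrier (h : IsHalf S C a b) : b ∉ C.carrier := by
  intro hb
  have h1 : b ∈ convexHull ℝ C.vertices ∩ convexHull ℝ {b} := ⟨hb, by simp⟩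
  rw [h.vertices_eq, h.newVertex_eq] at h1
  have h2 := h.split.half_inter_face_subset (W := {b}) (by simp [h.split.eq])
    (by simp [h.split.ne]) h1
  rw [← h.newVertex_eq, ← h.vertices_eq, Set.singleton_inter_eq_empty.2 h.b_notMem] at h2
  simp at h2

end IsHalf

theorem not_refinementEdge_subset_of_mem_bisect (hd : 1 ≤ d) (hS : AffineIndependent ℝ S.vertex)
    (ht : S.type < d) (hC : C ∈ S.bisect) : ¬(S.v 0 ∈ C.carrier ∧ S.v d ∈ C.carrier) := by
  obtain ⟨a, b, h⟩ := exists_isHalf hd hS ht hC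
  rintro ⟨h0, h1⟩
  apply h.b_notMem_carrier
  rcases h.ends with ⟨-, hb⟩ | ⟨-, hb⟩ <;> rw [hb] <;> assumption

/-! ### The offset of an edge -/

/-- The number of bisections after which the edge `x_i x_j` of a simplex of type `γ` in `ℝ^d` is
itself a refinement edge, that is, the difference between the level of any descendant with this
refinement edge and the level of the simplex. -/
def _root_.edgeOffset (d γ i j : ℕ) : ℕ :=
  if min i j = 0 then d - max i j
  else if γ < min i j then d + min i j - (γ + max i j)
  else if γ < max i j then d - min i j
  else 2 * d + min i j - (γ + max i j)

theorem _root_.edgeOffset_comm (d γ i j : ℕ) : edgeOffset d γ i j = edgeOffset d γ j i := by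
  simp only [edgeOffset, min_comm i j, max_comm i j]

theorem _root_.edgeOffset_eq_zero {d γ i j : ℕ} (hγ : γ < d) (hi : i ≤ d) (hj : j ≤ d)
    (h : edgeOffset d γ i j = 0) : (i = 0 ∧ j = d) ∨ (i = d ∧ j = 0) := by
  unfold edgeOffset at h
  split_ifs at h <;> omega

/-- `x` and `y` are the end points of an edge of `S` of offset `o`. -/
def HasOffset (S : TaggedSimplex d) (x y : EuclideanSpace ℝ (Fin d)) (o : ℕ) : Prop :=
  ∃ i ≤ d, ∃ j ≤ d, i ≠ j ∧ S.v i = x ∧ S.v j = y ∧ edgeOffset d S.type i j = o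

theorem HasOffset.symm {x y : EuclideanSpace ℝ (Fin d)} {o : ℕ} (h : S.HasOffset x y o) :
    S.HasOffset y x o := by
  obtain ⟨i, hi, j, hj, hij, hx, hy, ho⟩ := h
  exact ⟨j, hj, i, hi, hij.symm, hy, hx, by rw [edgeOffset_comm, ho]⟩

theorem exists_hasOffset {x y : EuclideanSpace ℝ (Fin d)} (hx : x ∈ S.vertices)
    (hy : y ∈ S.vertices) (hxy : x ≠ y) : ∃ o, S.HasOffset x y o := by
  obtain ⟨i, hi, rfl⟩ := mem_vertices.1 hx
  obtain ⟨j, hj, rfl⟩ := mem_vertices.1 hy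
  exact ⟨_, i, hi, j, hj, fun h => hxy (by rw [h]), rfl, rfl, rfl⟩

theorem HasOffset.left_mem {x y : EuclideanSpace ℝ (Fin d)} {o : ℕ} (h : S.HasOffset x y o) :
    x ∈ S.vertices := by
  obtain ⟨i, -, -, -, -, hx, -, -⟩ := h
  exact hx ▸ S.v_mem_vertices i

theorem HasOffset.right_mem {x y : EuclideanSpace ℝ (Fin d)} {o : ℕ} (h : S.HasOffset x y o) :
    y ∈ S.vertices := h.symm.left_mem

theorem HasOffset.ne (hS : AffineIndependent ℝ S.vertex) {x y : EuclideanSpace ℝ (Fin d)} {o : ℕ}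
    (h : S.HasOffset x y o) : x ≠ y := by
  obtain ⟨i, hi, j, hj, hij, rfl, rfl, -⟩ := h
  exact fun h => hij (v_injOn hS hi hj h)

theorem HasOffset.unique (hS : AffineIndependent ℝ S.vertex) {x y : EuclideanSpace ℝ (Fin d)}
    {o o' : ℕ} (h : S.HasOffset x y o) (h' : S.HasOffset x y o') : o = o' := by
  obtain ⟨i, hi, j, hj, -, rfl, rfl, rfl⟩ := h
  obtain ⟨i', hi', j', hj', -, hx, hy, rfl⟩ := h'
  rw [v_injOn hS hi' hi hx, v_injOn hS hj' hj hy]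

theorem hasOffset_refinementEdge (hd : 1 ≤ d) : S.HasOffset (S.v 0) (S.v d) 0 :=
  ⟨0, Nat.zero_le d, d, le_rfl, by omega, rfl, rfl, by simp [edgeOffset]⟩

/-- The position in `S` of the vertex of `S.child₀` in position `j ≠ 1`. -/
def _root_.parentPosition₀ (j : ℕ) : ℕ := j - 1

/-- The position in `S` of the vertex of `S.child₁` in position `j ≠ 1`, where `γ` is the type of
`S`. -/
def _root_.parentPosition₁ (d γ j : ℕ) : ℕ :=
  if j = 0 then d else if j ≤ γ + 1 then j - 1 else d + γ + 1 - j

theorem _root_.edgeOffset_of_lt {d γ i j : ℕ} (hij : i < j) :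
    edgeOffset d γ i j = if i = 0 then d - j else if γ < i then d + i - (γ + j)
      else if γ < j then d - i else 2 * d + i - (γ + j) := by
  rw [edgeOffset, min_eq_left hij.le, max_eq_right hij.le]

theorem _root_.edgeOffset_of_gt {d γ i j : ℕ} (hij : j < i) :
    edgeOffset d γ i j = if j = 0 then d - i else if γ < j then d + j - (γ + i)
      else if γ < i then d - j else 2 * d + j - (γ + i) := by
  rw [edgeOffset_comm, edgeOffset_of_lt hij]

theorem _root_.succ_mod_cases {d γ : ℕ} (hγ : γ < d) :
    (γ + 1 < d ∧ (γ + 1) % d = γ + 1) ∨ (d = γ + 1 ∧ (γ + 1) % d = 0) := by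
  rcases Nat.lt_or_ge (γ + 1) d with h | h
  · exact Or.inl ⟨h, Nat.mod_eq_of_lt h⟩
  · obtain rfl : d = γ + 1 := by omega
    exact Or.inr ⟨rfl, Nat.mod_self _⟩

theorem _root_.edgeOffset_parentPosition₀ {d γ i j : ℕ} (hγ : γ < d) (hi : i ≤ d) (hj : j ≤ d)
    (hij : i ≠ j) (hi1 : i ≠ 1) (hj1 : j ≠ 1) :
    edgeOffset d ((γ + 1) % d) i j + 1 =
      edgeOffset d γ (parentPosition₀ i) (parentPosition₀ j) := by
  wlog hlt : i < j generalizing i j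
  · rw [edgeOffset_comm, this hj hi hij.symm hj1 hi1 (by omega), edgeOffset_comm]
  unfold parentPosition₀
  rw [edgeOffset_of_lt hlt, edgeOffset_of_lt (by omega : i - 1 < j - 1)]
  rcases succ_mod_cases hγ with ⟨h, h'⟩ | ⟨h, h'⟩ <;> rw [h'] <;> split_ifs <;> omega

theorem _root_.edgeOffset_parentPosition₁ {d γ i j : ℕ} (hγ : γ < d) (hi : i ≤ d) (hj : j ≤ d)
    (hij : i ≠ j) (hi1 : i ≠ 1) (hj1 : j ≠ 1) :
    edgeOffset d ((γ + 1) % d) i j + 1 =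
      edgeOffset d γ (parentPosition₁ d γ i) (parentPosition₁ d γ j) := by
  wlog hlt : i < j generalizing i j
  · rw [edgeOffset_comm, this hj hi hij.symm hj1 hi1 (by omega), edgeOffset_comm]
  rw [edgeOffset_of_lt hlt]
  have hp : ∀ k, k ≠ 0 → k ≤ γ + 1 → parentPosition₁ d γ k = k - 1 := by
    intro k h0 h1; rw [parentPosition₁, if_neg h0, if_pos h1]
  have hq : ∀ k, γ + 1 < k → parentPosition₁ d γ k = d + γ + 1 - k := by
    intro k h1; rw [parentPosition₁, if_neg (by omega), if_neg (by omega)]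
  rcases Nat.eq_zero_or_pos i with rfl | hi0
  · rw [show parentPosition₁ d γ 0 = d from if_pos rfl, if_pos rfl]
    rcases Nat.lt_or_ge (γ + 1) j with h | h
    · rw [hq j h, edgeOffset_of_gt (by omega)]
      split_ifs <;> omega
    · rw [hp j (by omega) h, edgeOffset_of_gt (by omega)]
      split_ifs <;> omega
  rw [if_neg (by omega)]
  rcases Nat.lt_or_ge (γ + 1) i with h | h
  · rw [hq i h, hq j (by omega), edgeOffset_of_gt (by omega)]
    rcases succ_mod_cases hγ with ⟨h, h'⟩ | ⟨h, h'⟩ <;> rw [h'] <;> split_ifs <;> omega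
  · rw [hp i (by omega) h]
    rcases Nat.lt_or_ge (γ + 1) j with h2 | h2
    · rw [hq j h2, edgeOffset_of_lt (by omega)]
      rcases succ_mod_cases hγ with ⟨h, h'⟩ | ⟨h, h'⟩ <;> rw [h'] <;> split_ifs <;> omega
    · rw [hp j (by omega) h2, edgeOffset_of_lt (by omega)]
      rcases succ_mod_cases hγ with ⟨h, h'⟩ | ⟨h, h'⟩ <;> rw [h'] <;> split_ifs <;> omega

/-- The offset of the edge that joins the new vertex to a vertex with edges of offset `o₁` and `o₂`
to the end points of the refinement edge. The sum `o₁ + o₂` is `d - γ` for the vertices `x_p` with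
`p > γ` and `2 (d - p)`, which is larger, for those with `p ≤ γ`. -/
def _root_.newOffset (d γ o₁ o₂ : ℕ) : ℕ :=
  if o₁ + o₂ ≤ d - γ then d - 1 else d - γ - 1 + (o₁ + o₂) / 2

theorem _root_.edgeOffset_one {d γ j p : ℕ} (hγ : γ < d) (hj : j ≤ d) (hj2 : 2 ≤ j)
    (hp : p = parentPosition₀ j ∨ p = parentPosition₁ d γ j) :
    edgeOffset d ((γ + 1) % d) 1 j =
      newOffset d γ (edgeOffset d γ 0 p) (edgeOffset d γ d p) := by
  have h1 : (p = j - 1 ∧ j ≤ γ + 1) ∨ (γ < p ∧ p < d ∧ γ + 1 < j) := by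
    unfold parentPosition₀ parentPosition₁ at hp
    split_ifs at hp <;> omega
  clear hp
  have e0 : edgeOffset d γ 0 p = d - p := by rw [edgeOffset_of_lt (by omega), if_pos rfl]
  rcases h1 with ⟨h1, h2⟩ | ⟨h1, h2, h3⟩
  · have e1 : newOffset d γ (d - p) (d - p) = d - γ - 1 + (d - p) := by
      unfold newOffset; rw [if_neg (by omega)]; omega
    have e2 : edgeOffset d γ d p = d - p := by
      rw [edgeOffset_of_gt (by omega)]; split_ifs <;> omega
    rw [e0, e2, e1, edgeOffset_of_lt (by omega : 1 < j), if_neg one_ne_zero]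
    rcases succ_mod_cases hγ with ⟨h, h'⟩ | ⟨h, h'⟩ <;> rw [h'] <;> split_ifs <;> omega
  · have e1 : newOffset d γ (d - p) (d + p - (γ + d)) = d - 1 := by
      unfold newOffset; rw [if_pos (by omega)]
    have e2 : edgeOffset d γ d p = d + p - (γ + d) := by
      rw [edgeOffset_of_gt (by omega)]; split_ifs <;> omega
    rw [e0, e2, e1, edgeOffset_of_lt (by omega : 1 < j), if_neg one_ne_zero]
    rcases succ_mod_cases hγ with ⟨h, h'⟩ | ⟨h, h'⟩ <;> rw [h'] <;> split_ifs <;> omega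

end TaggedSimplex

namespace TaggedSimplex

variable {d : ℕ} {S S' C C' : TaggedSimplex d} {x y : EuclideanSpace ℝ (Fin d)} {o o' : ℕ}

/-- Bisection lowers the offset of an edge by one. -/
theorem HasOffset.parent (hd : 1 ≤ d) (ht : S.type < d)
    (hC : C ∈ S.bisect) (h : C.HasOffset x y o) (hx : x ≠ S.newVertex) (hy : y ≠ S.newVertex) :
    S.HasOffset x y (o + 1) := by
  have hCt := type_of_mem_bisect hC
  obtain ⟨i, hi, j, hj, hij, rfl, rfl, rfl⟩ := h
  rw [hCt]
  rcases mem_bisect.1 hC with rfl | rfl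
  · have key : ∀ k ≤ d, S.child₀.v k ≠ S.newVertex →
        k ≠ 1 ∧ S.child₀.v k = S.v (parentPosition₀ k) := by
      intro k hk hne
      rw [child₀_v hk] at hne ⊢
      split_ifs at hne ⊢ with h0 h1
      · exact ⟨by omega, by rw [h0]; rfl⟩
      · exact absurd rfl hne
      · exact ⟨h1, rfl⟩
    obtain ⟨hi1, hi2⟩ := key i hi hx
    obtain ⟨hj1, hj2⟩ := key j hj hy
    refine ⟨parentPosition₀ i, by unfold parentPosition₀; omega, parentPosition₀ j,
      by unfold parentPosition₀; omega, by unfold parentPosition₀; omega, hi2.symm, hj2.symm, ?_⟩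
    rw [edgeOffset_parentPosition₀ ht hi hj hij hi1 hj1]
  · have key : ∀ k ≤ d, S.child₁.v k ≠ S.newVertex →
        k ≠ 1 ∧ S.child₁.v k = S.v (parentPosition₁ d S.type k) := by
      intro k hk hne
      have h1 : k ≠ 1 := by
        rintro rfl; exact hne (by rw [child₁_v hk, if_neg one_ne_zero, if_pos rfl])
      refine ⟨h1, ?_⟩
      rw [child₁_v hk, parentPosition₁]
      by_cases h0 : k = 0
      · rw [if_pos h0, if_pos h0]
      · rw [if_neg h0, if_neg h1, if_neg h0]
        split_ifs <;> rfl
    obtain ⟨hi1, hi2⟩ := key i hi hx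
    obtain ⟨hj1, hj2⟩ := key j hj hy
    refine ⟨parentPosition₁ d S.type i, ?_, parentPosition₁ d S.type j, ?_, ?_, hi2.symm,
      hj2.symm, ?_⟩
    · unfold parentPosition₁; split_ifs <;> omega
    · unfold parentPosition₁; split_ifs <;> omega
    · unfold parentPosition₁; split_ifs <;> omega
    rw [edgeOffset_parentPosition₁ ht hi hj hij hi1 hj1]

/-- The offset of a new edge is determined by the offsets, in the parent, of the edges that join its
old end point to the ends of the refinement edge. -/
theorem HasOffset.parent_newVertex (hd : 1 ≤ d) (hS : AffineIndependent ℝ S.vertex)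
    (ht : S.type < d) (hC : C ∈ S.bisect) (h : C.HasOffset S.newVertex y o) :
    (y = S.v 0 ∨ y = S.v d) ∧ o = d - 1 ∨
      (y ≠ S.v 0 ∧ y ≠ S.v d) ∧ ∃ o₁ o₂, S.HasOffset (S.v 0) y o₁ ∧ S.HasOffset (S.v d) y o₂ ∧
        o = newOffset d S.type o₁ o₂ := by
  have hCt := type_of_mem_bisect hC
  have hCi := affineIndependent_of_mem_bisect hd hS ht hC
  obtain ⟨i, hi, j, hj, hij, hx, rfl, rfl⟩ := h
  rw [hCt]
  have hi1 : i = 1 := by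
    refine v_injOn hCi hi hd (hx.trans ?_)
    rcases mem_bisect.1 hC with rfl | rfl
    · rw [child₀_v hd, if_neg one_ne_zero, if_pos rfl]
    · rw [child₁_v hd, if_neg one_ne_zero, if_pos rfl]
  subst hi1
  by_cases hj0 : j = 0
  · left
    subst hj0
    refine ⟨?_, ?_⟩
    · rcases mem_bisect.1 hC with rfl | rfl
      · left; rw [child₀_v hj, if_pos rfl]
      · right; rw [child₁_v hj, if_pos rfl]
    · rw [edgeOffset_of_gt one_pos, if_pos rfl]
  · right
    obtain ⟨p, hp, hp1, hpd, hv⟩ : ∃ p, (p = parentPosition₀ j ∨ p = parentPosition₁ d S.type j) ∧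
        1 ≤ p ∧ p < d ∧ C.v j = S.v p := by
      rcases mem_bisect.1 hC with rfl | rfl
      · refine ⟨parentPosition₀ j, Or.inl rfl, ?_, ?_, ?_⟩
        · unfold parentPosition₀; omega
        · unfold parentPosition₀; omega
        · rw [child₀_v hj, if_neg hj0, if_neg hij.symm]; rfl
      · refine ⟨parentPosition₁ d S.type j, Or.inr rfl, ?_, ?_, ?_⟩
        · unfold parentPosition₁; split_ifs <;> omega
        · unfold parentPosition₁; split_ifs <;> omega
        · rw [child₁_v hj, if_neg hj0, if_neg hij.symm]
          unfold parentPosition₁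
          rw [if_neg hj0]
          split_ifs <;> rfl
    rw [hv]
    refine ⟨⟨fun h => ?_, fun h => ?_⟩, _, _, ⟨0, by omega, p, hpd.le, by omega, rfl, rfl, rfl⟩,
      ⟨d, le_rfl, p, hpd.le, by omega, rfl, rfl, rfl⟩, edgeOffset_one ht hj (by omega) hp⟩
    · have := v_injOn hS hpd.le (by omega) h; omega
    · have := v_injOn hS hpd.le (by omega) h; omega

/-- Reflected neighbours assign the same offset to a common edge. -/
theorem ReflectedNeighbours.offset_eq (hd : 1 ≤ d) (hS : AffineIndependent ℝ S.vertex)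
    (hS' : AffineIndependent ℝ S'.vertex) (htt : S.type = S'.type) (ht : S.type < d)
    (hr : ReflectedNeighbours S S') (h : S.HasOffset x y o) (h' : S'.HasOffset x y o') :
    o = o' := by
  -- Equal vertices have equal positions in lists that differ in exactly one position.
  have pos : ∀ f f' : ℕ → EuclideanSpace ℝ (Fin d),
      (∀ i ≤ d, ∀ j ≤ d, f i = f j → i = j) → (∀ i ≤ d, ∀ j ≤ d, f' i = f' j → i = j) →
      (∃ k ≤ d, ∀ j ≤ d, f j = f' j ↔ j ≠ k) → ∀ i ≤ d, ∀ j ≤ d, f i = f' j → i = j := by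
    rintro f f' hf hf' ⟨k, hk, hkk⟩ i hi j hj hij
    by_cases hik : i = k
    · by_cases hjk : j = k
      · rw [hik, hjk]
      · exact hf i hi j hj (hij.trans ((hkk j hj).2 hjk).symm)
    · exact hf' i hi j hj (((hkk i hi).2 hik).symm.trans hij)
  have conv : ∀ A B : TaggedSimplex d, (∃ i, ∀ j, A.vertex j = B.vertex j ↔ j ≠ i) →
      ∃ k ≤ d, ∀ j ≤ d, A.v j = B.v j ↔ j ≠ k := by
    rintro A B ⟨i, hi⟩
    refine ⟨i, by omega, fun j hj => ?_⟩
    rw [v, v, hi, ← Fin.val_inj.ne, val_ofNat hj]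
  obtain ⟨i, hi, j, hj, hij, rfl, rfl, rfl⟩ := h
  obtain ⟨i', hi', j', hj', hij', hx, hy, rfl⟩ := h'
  rw [← htt]
  rcases hr with hr | hr
  · have := pos S.v S'.v (fun i hi j hj => v_injOn hS hi hj) (fun i hi j hj => v_injOn hS' hi hj)
      (conv _ _ hr)
    rw [this i hi i' hi' hx.symm, this j hj j' hj' hy.symm]
  · let ρ : ℕ → ℕ := fun j => if j = 0 then d else if j = d then 0
      else if j ≤ S.type then j else d + S.type - j
    have hρd : ∀ k ≤ d, ρ k ≤ d := by intro k hk; simp only [ρ]; split_ifs <;> omega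
    have hρρ : ∀ k ≤ d, ρ (ρ k) = k := by intro k hk; simp only [ρ]; split_ifs <;> omega
    have hSρ : ∀ k ≤ d, S.reflect.v k = S.v (ρ k) := by
      intro k hk; rw [reflect_v hk]; simp only [ρ]; split_ifs <;> rfl
    have hρ0 : ρ 0 = d := if_pos rfl
    have hρl : ρ d = 0 := by simp only [ρ]; rw [if_neg (by omega), if_pos trivial]
    have hρi : ∀ k, 1 ≤ k → k ≤ S.type → ρ k = k := by
      intro k h0 h1; simp only [ρ]; rw [if_neg (by omega), if_neg (by omega), if_pos h1]
    have hρt : ∀ k, S.type < k → k < d → ρ k = d + S.type - k := by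
      intro k h0 h1; simp only [ρ]; rw [if_neg (by omega), if_neg (by omega), if_neg (by omega)]
    have hoff : ∀ k ≤ d, ∀ l ≤ d, k ≠ l →
        edgeOffset d S.type (ρ k) (ρ l) = edgeOffset d S.type k l := by
      intro k hk l hl hkl
      wlog hlt : k < l generalizing k l
      · rw [edgeOffset_comm, this l hl k hk hkl.symm (by omega), edgeOffset_comm]
      rw [edgeOffset_of_lt hlt]
      rcases Nat.eq_zero_or_pos k with rfl | hk0
      · rw [hρ0, if_pos rfl]
        rcases hl.eq_or_lt with rfl | hl'
        · rw [hρl, edgeOffset_of_gt (by omega), if_pos rfl]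
        rcases Nat.lt_or_ge S.type l with h | h
        · rw [hρt l h hl', edgeOffset_of_gt (by omega), if_neg (by omega), if_pos (by omega)]
          omega
        · rw [hρi l hlt h, edgeOffset_of_gt (by omega), if_neg (by omega), if_neg (by omega),
            if_pos ht]
      rw [if_neg (by omega)]
      rcases Nat.lt_or_ge S.type k with h | h
      · rw [hρt k h (by omega), if_pos h]
        rcases hl.eq_or_lt with rfl | hl'
        · rw [hρl, edgeOffset_of_gt (by omega), if_pos rfl]; omega
        · rw [hρt l (by omega) hl', edgeOffset_of_gt (by omega), if_neg (by omega),
            if_pos (by omega)]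
          omega
      · rw [hρi k hk0 h, if_neg (by omega)]
        rcases hl.eq_or_lt with rfl | hl'
        · rw [hρl, edgeOffset_of_gt (by omega), if_pos rfl, if_pos ht]
        rcases Nat.lt_or_ge S.type l with h2 | h2
        · rw [hρt l h2 hl', edgeOffset_of_lt (by omega), if_neg (by omega), if_neg (by omega),
            if_pos (by omega), if_pos h2]
        · rw [hρi l (by omega) h2, edgeOffset_of_lt hlt, if_neg (by omega), if_neg (by omega)]
    have := pos S.reflect.v S'.v (fun i hi j hj h => by
        rw [hSρ i hi, hSρ j hj] at h
        rw [← hρρ i hi, v_injOn hS (hρd i hi) (hρd j hj) h, hρρ j hj])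
      (fun i hi j hj => v_injOn hS' hi hj) (conv _ _ hr)
    have hi2 : ρ i = i' := this _ (hρd i hi) i' hi' (by rw [hSρ _ (hρd i hi), hρρ i hi, hx])
    have hj2 : ρ j = j' := this _ (hρd j hj) j' hj' (by rw [hSρ _ (hρd j hj), hρρ j hj, hy])
    rw [← hi2, ← hj2, hoff i hi j hj hij]

/-- Simplices that share a hyperface and satisfy the matching condition assign the same offset to a
common edge. -/
theorem Matching.offset_eq (hd : 1 ≤ d) (hS : AffineIndependent ℝ S.vertex)
    (hS' : AffineIndependent ℝ S'.vertex) (htt : S.type = S'.type) (ht : S.type < d)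
    (hm : S.Matching S')
    (h : S.HasOffset x y o) (h' : S'.HasOffset x y o') : o = o' := by
  by_cases hre : {S.v 0, S.v d} ⊆ S.vertices ∩ S'.vertices ∨
      {S'.v 0, S'.v d} ⊆ S.vertices ∩ S'.vertices
  · exact (hm.1 hre).offset_eq hd hS hS' htt ht h h'
  · -- The common hyperface belongs to a child.
    have child : ∀ A : TaggedSimplex d, AffineIndependent ℝ A.vertex → A.type < d →
        ∀ W ⊆ A.vertices, ¬ {A.v 0, A.v d} ⊆ W →
        ∃ C ∈ A.bisect, W ⊆ C.vertices := by
      intro A hA hAt W hW hsub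
      have key : ∀ a b, ∀ C ∈ A.bisect, IsHalf A C a b → b ∉ W →
          ∃ C ∈ A.bisect, W ⊆ C.vertices := by
        intro a b C hC hh hb
        refine ⟨C, hC, fun z hz => ?_⟩
        have hz' := hW hz
        rw [hh.split.eq] at hz'
        rw [hh.vertices_eq]
        rcases hz' with rfl | rfl | hz'
        · simp
        · exact absurd hz hb
        · simp [hz']
      rw [Set.pair_subset_iff, not_and_or] at hsub
      rcases hsub with h | h
      · exact key _ _ _ (mem_bisect.2 (Or.inr rfl)) (isHalf_child₁ hd hA hAt) h
      · exact key _ _ _ (mem_bisect.2 (Or.inl rfl)) (isHalf_child₀ hd hA) h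
    rw [not_or] at hre
    have ht' : S'.type < d := htt ▸ ht
    obtain ⟨C, hC, hWC⟩ := child S hS ht _ Set.inter_subset_left hre.1
    obtain ⟨C', hC', hWC'⟩ := child S' hS' ht' _ Set.inter_subset_right hre.2
    have hrn := hm.2 (by rw [not_or]; exact hre) C hC C' hC' hWC hWC'
    have hxW : x ∈ S.vertices ∩ S'.vertices := ⟨h.left_mem, h'.left_mem⟩
    have hyW : y ∈ S.vertices ∩ S'.vertices := ⟨h.right_mem, h'.right_mem⟩
    have hxy := h.ne hS
    obtain ⟨p, hp⟩ := exists_hasOffset (hWC hxW) (hWC hyW) hxy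
    obtain ⟨p', hp'⟩ := exists_hasOffset (hWC' hxW) (hWC' hyW) hxy
    have h1 := hrn.offset_eq hd (affineIndependent_of_mem_bisect hd hS ht hC)
      (affineIndependent_of_mem_bisect hd hS' ht' hC')
      (by rw [type_of_mem_bisect hC, type_of_mem_bisect hC', htt])
      (by rw [type_of_mem_bisect hC]; exact Nat.mod_lt _ hd) hp hp'
    have hne : ∀ (A : TaggedSimplex d), AffineIndependent ℝ A.vertex → ∀ z ∈ A.vertices,
        z ≠ A.newVertex := fun A hA z hz e => newVertex_notMem hd hA (e ▸ hz)
    have h2 := h.unique hS (hp.parent hd ht hC (hne S hS x hxW.1) (hne S hS y hyW.1))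
    have h3 := h'.unique hS' (hp'.parent hd ht' hC' (hne S' hS' x hxW.2) (hne S' hS' y hyW.2))
    omega

end TaggedSimplex

/-! ### Compatible families of tagged simplices -/

/-- A family of simplices of type `γ` that meet in common faces and agree on the offsets of their
edges. Unlike the matching condition, this condition is inherited by the family of children. -/
structure IsCompatible {d : ℕ} (γ : ℕ) (T : Finset (TaggedSimplex d)) : Prop where
  indep : ∀ S ∈ T, AffineIndependent ℝ S.vertex
  type_eq : ∀ S ∈ T, S.type = γ
  eq_of_vertices_eq : ∀ S ∈ T, ∀ S' ∈ T, S.vertices = S'.vertices → S = S'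
  inter_subset : ∀ S ∈ T, ∀ S' ∈ T,
    S.carrier ∩ S'.carrier ⊆ convexHull ℝ (S.vertices ∩ S'.vertices)
  offset_eq : ∀ S ∈ T, ∀ S' ∈ T, ∀ x y o o', S.HasOffset x y o → S'.HasOffset x y o' → o = o'

namespace IsCompatible

variable {d γ : ℕ} {T : Finset (TaggedSimplex d)} {S S' C C' : TaggedSimplex d}

/-- If the midpoint of the refinement edge of `S` lies in `S'`, then `S` and `S'` share their
refinement edges. -/
theorem refinementEdge_eq (hT : IsCompatible γ T) (hd : 1 ≤ d) (hγ : γ < d) (hS : S ∈ T)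
    (hS' : S' ∈ T) (hm : S.newVertex ∈ S'.carrier) :
    (S'.v 0 = S.v 0 ∧ S'.v d = S.v d) ∨ (S'.v 0 = S.v d ∧ S'.v d = S.v 0) := by
  have hsp := edgeSplit hd (hT.indep S hS)
  have h1 := hT.inter_subset S hS S' hS' ⟨newVertex_mem_carrier hd (hT.indep S hS), hm⟩
  obtain ⟨ha, hb⟩ := hsp.mem_of_midpoint_mem Set.inter_subset_left h1
  obtain ⟨o, ho⟩ := exists_hasOffset ha.2 hb.2 hsp.ne
  have h0 := hT.offset_eq S hS S' hS' _ _ _ _ (hasOffset_refinementEdge hd) ho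
  subst h0
  obtain ⟨i, hi, j, hj, hij, hx, hy, ho⟩ := ho
  rcases edgeOffset_eq_zero (by rw [hT.type_eq S' hS']; exact hγ) hi hj ho with
    ⟨rfl, rfl⟩ | ⟨rfl, rfl⟩
  · exact Or.inl ⟨hx, hy⟩
  · exact Or.inr ⟨hy, hx⟩

theorem newVertex_eq (hT : IsCompatible γ T) (hd : 1 ≤ d) (hγ : γ < d) (hS : S ∈ T)
    (hS' : S' ∈ T) (hm : S.newVertex ∈ S'.carrier) : S'.newVertex = S.newVertex := by
  rcases hT.refinementEdge_eq hd hγ hS hS' hm with ⟨h1, h2⟩ | ⟨h1, h2⟩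
  · rw [newVertex, newVertex, h1, h2]
  · rw [newVertex, newVertex, h1, h2, midpoint_comm]

theorem eq_of_isSimplexSet_subset (hT : IsCompatible γ T) (hS : S ∈ T) (hS' : S' ∈ T)
    {V : Set (EuclideanSpace ℝ (Fin d))} (hV : IsSimplexSet V) (h : V ⊆ S.carrier ∩ S'.carrier) :
    S = S' := by
  have h1 : V ⊆ affineSpan ℝ (S.vertices ∩ S'.vertices) :=
    (h.trans (hT.inter_subset S hS S' hS')).trans (convexHull_subset_affineSpan _)
  have h2 : affineSpan ℝ (S.vertices ∩ S'.vertices) = ⊤ := by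
    rw [eq_top_iff, ← hV.affineSpan_eq_top]; exact affineSpan_le.2 h1
  have hs := isSimplexSet_vertices (hT.indep S hS)
  have hs' := isSimplexSet_vertices (hT.indep S' hS')
  have h3 : d + 1 ≤ (S.vertices ∩ S'.vertices).ncard := by
    by_contra hlt
    refine affineSpan_ne_top_of_ncard_le (hs.finite.subset Set.inter_subset_left) ?_ h2
    simp only [finrank_euclideanSpace, Fintype.card_fin]
    omega
  have hc := hs.ncard_eq
  have hc' := hs'.ncard_eq
  simp only [finrank_euclideanSpace, Fintype.card_fin] at hc hc'
  apply hT.eq_of_vertices_eq S hS S' hS'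
  have e1 : S.vertices ∩ S'.vertices = S.vertices :=
    Set.eq_of_subset_of_ncard_le Set.inter_subset_left (by omega) hs.finite
  have e2 : S.vertices ∩ S'.vertices = S'.vertices :=
    Set.eq_of_subset_of_ncard_le Set.inter_subset_right (by omega) hs'.finite
  rw [← e1, e2]

/-- The family of children of a compatible family is compatible. -/
theorem refine [DecidableEq (TaggedSimplex d)] (hT : IsCompatible γ T) (hd : 1 ≤ d) (hγ : γ < d) :
    IsCompatible ((γ + 1) % d) (T.biUnion bisect) := by
  have hmem : ∀ {C}, C ∈ T.biUnion bisect → ∃ S ∈ T, C ∈ S.bisect := fun h => by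
    simpa using h
  have hlt : ∀ S ∈ T, S.type < d := fun S hS => by rw [hT.type_eq S hS]; exact hγ
  constructor
  · intro C hC
    obtain ⟨S, hS, hCS⟩ := hmem hC
    exact affineIndependent_of_mem_bisect hd (hT.indep S hS) (hlt S hS) hCS
  · intro C hC
    obtain ⟨S, hS, hCS⟩ := hmem hC
    rw [type_of_mem_bisect hCS, hT.type_eq S hS]
  · intro C hC C' hC' hv
    obtain ⟨S, hS, hCS⟩ := hmem hC
    obtain ⟨S', hS', hCS'⟩ := hmem hC'
    have hCi := affineIndependent_of_mem_bisect hd (hT.indep S hS) (hlt S hS) hCS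
    have h1 := carrier_subset_of_mem_bisect hd (hT.indep S hS) (hlt S hS) hCS
    have h2 := carrier_subset_of_mem_bisect hd (hT.indep S' hS') (hlt S' hS') hCS'
    obtain rfl : S = S' := hT.eq_of_isSimplexSet_subset hS hS' (isSimplexSet_vertices hCi)
      (fun x hx => ⟨h1 (subset_convexHull _ _ hx), h2 (subset_convexHull _ _ (hv ▸ hx))⟩)
    have hd0 := isHalf_child₀ hd (hT.indep S hS)
    have hd1 := isHalf_child₁ hd (hT.indep S hS) (hlt S hS)
    have key : S.child₀.vertices ≠ S.child₁.vertices := by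
      intro h
      apply hd0.b_notMem
      rw [h, hd1.vertices_eq]; simp
    rcases mem_bisect.1 hCS with rfl | rfl <;> rcases mem_bisect.1 hCS' with rfl | rfl
    · rfl
    · exact absurd hv key
    · exact absurd hv.symm key
    · rfl
  · intro C hC C' hC'
    obtain ⟨S, hS, hCS⟩ := hmem hC
    obtain ⟨S', hS', hCS'⟩ := hmem hC'
    have h1 := carrier_subset_of_mem_bisect hd (hT.indep S hS) (hlt S hS) hCS
    have h2 := carrier_subset_of_mem_bisect hd (hT.indep S' hS') (hlt S' hS') hCS'
    obtain ⟨a, b, hh⟩ := exists_isHalf hd (hT.indep S hS) (hlt S hS) hCS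
    obtain ⟨a', b', hh'⟩ := exists_isHalf hd (hT.indep S' hS') (hlt S' hS') hCS'
    rintro z ⟨hz, hz'⟩
    set W := S.vertices ∩ S'.vertices with hW
    have hzW := hT.inter_subset S hS S' hS' ⟨h1 hz, h2 hz'⟩
    have hzC : z ∈ convexHull ℝ (insert a (insert (midpoint ℝ a b) S.innerVertices)) := by
      rw [← hh.newVertex_eq, ← hh.vertices_eq]; exact hz
    have hzC' : z ∈ convexHull ℝ (insert a' (insert (midpoint ℝ a' b') S'.innerVertices)) := by
      rw [← hh'.newVertex_eq, ← hh'.vertices_eq]; exact hz'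
    by_cases hm : S.newVertex ∈ S'.carrier
    · -- Both simplices are bisected at the same edge.
      have hre := hT.refinementEdge_eq hd hγ hS hS' hm
      have hmm := hT.newVertex_eq hd hγ hS hS' hm
      have hends : (a' = a ∧ b' = b) ∨ (a' = b ∧ b' = a) := by
        rcases hh.ends with ⟨rfl, rfl⟩ | ⟨rfl, rfl⟩ <;>
        rcases hh'.ends with ⟨rfl, rfl⟩ | ⟨rfl, rfl⟩ <;>
        rcases hre with ⟨e1, e2⟩ | ⟨e1, e2⟩ <;> simp [e1, e2]
      have haS : a ∈ S.vertices := by simp [hh.split.eq]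
      have hbS : b ∈ S.vertices := by simp [hh.split.eq]
      have haS' : a' ∈ S'.vertices := by simp [hh'.split.eq]
      have hbS' : b' ∈ S'.vertices := by simp [hh'.split.eq]
      have haW : a ∈ W := ⟨haS, by
        rcases hends with ⟨e1, e2⟩ | ⟨e1, e2⟩ <;> subst e1 e2 <;> assumption⟩
      have hbW : b ∈ W := ⟨hbS, by
        rcases hends with ⟨e1, e2⟩ | ⟨e1, e2⟩ <;> subst e1 e2 <;> assumption⟩
      have hpair : ({a', b'} : Set (EuclideanSpace ℝ (Fin d))) = {a, b} := by
        rcases hends with ⟨rfl, rfl⟩ | ⟨rfl, rfl⟩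
        · rfl
        · exact Set.pair_comm _ _
      have ha'W : a' ∈ W := by rcases hends with ⟨e1, e2⟩ | ⟨e1, e2⟩ <;> rw [e1] <;> assumption
      have hb'W : b' ∈ W := by rcases hends with ⟨e1, e2⟩ | ⟨e1, e2⟩ <;> rw [e2] <;> assumption
      have hz1 := hh.split.half_inter_face_subset_of_mem (W := W) Set.inter_subset_left haW hbW
        ⟨hzC, hzW⟩
      have hz2 := hh'.split.half_inter_face_subset_of_mem (W := W) Set.inter_subset_right ha'W hb'W
        ⟨hzC', hzW⟩
      rw [← hh.newVertex_eq] at hz1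
      rw [← hh'.newVertex_eq, hmm, hpair] at hz2
      have hinner : ∀ u ∈ W \ {a, b}, u ∈ C.vertices ∩ C'.vertices := by
        rintro u ⟨⟨hu, hu'⟩, hne⟩
        rw [hh.vertices_eq, hh'.vertices_eq]
        rw [hh.split.eq] at hu
        rw [hh'.split.eq] at hu'
        simp only [Set.mem_insert_iff, Set.mem_singleton_iff, not_or] at hne hu hu'
        have : ¬ (u = a' ∨ u = b') := by
          rcases hends with ⟨rfl, rfl⟩ | ⟨rfl, rfl⟩ <;> tauto
        constructor <;> simp only [Set.mem_insert_iff] <;> tauto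
      rcases hends with ⟨rfl, rfl⟩ | ⟨rfl, rfl⟩
      · refine convexHull_mono ?_ hz1
        rintro u (rfl | rfl | hu)
        · exact ⟨by simp [hh.vertices_eq], by simp [hh'.vertices_eq]⟩
        · exact ⟨by simp [hh.vertices_eq], by simp [hh'.vertices_eq, hmm]⟩
        · exact hinner u hu
      · have hsp : EdgeSplit S.vertices b' a' S.innerVertices := hh.split
        have hsub : W \ {b', a'} ⊆ S.innerVertices := by
          rintro u ⟨⟨hu, -⟩, hne⟩
          rw [hsp.eq] at hu
          simp only [Set.mem_insert_iff, Set.mem_singleton_iff, not_or] at hne hu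
          tauto
        -- The halves of the common face lie on different sides.
        have hz3 := hsp.inter_halves_subset ⟨hzC, by
          rw [← hh.newVertex_eq]
          exact convexHull_mono (Set.insert_subset_insert (Set.insert_subset_insert hsub)) hz2⟩
        have hz4 : z ∈ convexHull ℝ (insert (midpoint ℝ b' a') S.innerVertices) ∩
            convexHull ℝ (insert b' (insert S.newVertex (W \ {b', a'}))) := ⟨hz3, hz1⟩
        rw [hh.newVertex_eq] at hz4
        rw [hsp.isSimplexSet_half.indep.convexHull_inter_set (Set.subset_insert _ _)
          (Set.insert_subset_insert (Set.insert_subset_insert hsub))] at hz4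
        refine convexHull_mono ?_ hz4
        rintro u ⟨hu, rfl | rfl | hu'⟩
        · rcases hu with hu | hu
          · exact absurd hu.symm hsp.midpoint_ne_left
          · exact absurd hu hsp.a_notMem
        · rw [← hh.newVertex_eq]
          exact ⟨by simp [hh.vertices_eq], by simp [hh'.vertices_eq, hmm]⟩
        · exact hinner u hu'
    · -- Neither refinement edge belongs to the common face.
      have hm' : S'.newVertex ∉ S.carrier := by
        intro hm'
        apply hm
        rw [hT.newVertex_eq hd hγ hS' hS hm']
        exact newVertex_mem_carrier hd (hT.indep S' hS')
      have hab : ¬(a ∈ W ∧ b ∈ W) := by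
        rintro ⟨ha, hb⟩
        apply hm
        rw [hh.newVertex_eq]
        exact (convex_convexHull ℝ _).midpoint_mem (subset_convexHull _ _ ha.2)
          (subset_convexHull _ _ hb.2)
      have hab' : ¬(a' ∈ W ∧ b' ∈ W) := by
        rintro ⟨ha, hb⟩
        apply hm'
        rw [hh'.newVertex_eq]
        exact (convex_convexHull ℝ _).midpoint_mem (subset_convexHull _ _ ha.1)
          (subset_convexHull _ _ hb.1)
      have hz1 := hh.split.half_inter_face_subset (W := W) Set.inter_subset_left hab ⟨hzC, hzW⟩
      have hz2 := hh'.split.half_inter_face_subset (W := W) Set.inter_subset_right hab' ⟨hzC', hzW⟩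
      rw [← hh.newVertex_eq, ← hh.vertices_eq] at hz1
      rw [← hh'.newVertex_eq, ← hh'.vertices_eq] at hz2
      have hz3 : z ∈ convexHull ℝ (W ∩ C.vertices) ∩ convexHull ℝ (W ∩ C'.vertices) := ⟨hz1, hz2⟩
      rw [(isSimplexSet_vertices (hT.indep S hS)).indep.convexHull_inter_set
        (Set.inter_subset_left.trans Set.inter_subset_left)
        (Set.inter_subset_left.trans Set.inter_subset_left)] at hz3
      refine convexHull_mono ?_ hz3
      rintro u ⟨hu, hu'⟩
      exact ⟨hu.2, hu'.2⟩
  · intro C hC C' hC' x y o o' h h'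
    obtain ⟨S, hS, hCS⟩ := hmem hC
    obtain ⟨S', hS', hCS'⟩ := hmem hC'
    obtain ⟨a, b, hh⟩ := exists_isHalf hd (hT.indep S hS) (hlt S hS) hCS
    obtain ⟨a', b', hh'⟩ := exists_isHalf hd (hT.indep S' hS') (hlt S' hS') hCS'
    have hCi := affineIndependent_of_mem_bisect hd (hT.indep S hS) (hlt S hS) hCS
    -- A vertex cannot be new for one of the parents and old for the other.
    have new : ∀ {A A' D D' : TaggedSimplex d} {p q p' q' : EuclideanSpace ℝ (Fin d)}, A ∈ T →
        A' ∈ T → IsHalf A D p q → IsHalf A' D' p' q' → A.newVertex ∈ D'.vertices →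
        A'.newVertex = A.newVertex := by
      intro A A' D D' p q p' q' hA hA' hhA hhA' hv
      rcases hhA'.mem_or hv with h | h
      · exact h.symm
      · exact hT.newVertex_eq hd hγ hA hA' (subset_convexHull _ _ h)
    have main : ∀ x y o o', C.HasOffset x y o → C'.HasOffset x y o' → x = S.newVertex → o = o' := by
      rintro x y o o' h h' rfl
      have hmm : S'.newVertex = S.newVertex := new hS hS' hh hh' h'.left_mem
      have hre := hT.refinementEdge_eq hd hγ hS hS'
        (hmm ▸ newVertex_mem_carrier hd (hT.indep S' hS'))
      have h'' := h'
      rw [← hmm] at h''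
      have key := h.parent_newVertex hd (hT.indep S hS) (hlt S hS) hCS
      have key' := h''.parent_newVertex hd (hT.indep S' hS') (hlt S' hS') hCS'
      rcases key with ⟨hy, rfl⟩ | ⟨hy, o₁, o₂, h1, h2, rfl⟩ <;>
        rcases key' with ⟨hy', rfl⟩ | ⟨hy', o₁', o₂', h1', h2', rfl⟩
      · rfl
      · rcases hre with ⟨e1, e2⟩ | ⟨e1, e2⟩ <;> rw [e1, e2] at hy' <;> tauto
      · rcases hre with ⟨e1, e2⟩ | ⟨e1, e2⟩ <;> rw [e1, e2] at hy' <;> tauto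
      · rw [hT.type_eq S hS, hT.type_eq S' hS']
        rcases hre with ⟨e1, e2⟩ | ⟨e1, e2⟩
        · rw [e1] at h1'
          rw [e2] at h2'
          rw [hT.offset_eq S hS S' hS' _ _ _ _ h1 h1', hT.offset_eq S hS S' hS' _ _ _ _ h2 h2']
        · rw [e1] at h1'
          rw [e2] at h2'
          rw [hT.offset_eq S hS S' hS' _ _ _ _ h1 h2', hT.offset_eq S hS S' hS' _ _ _ _ h2 h1',
            newOffset, newOffset, add_comm]
    by_cases hx : x = S.newVertex
    · exact main x y o o' h h' hx
    by_cases hy : y = S.newVertex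
    · exact main y x o o' h.symm h'.symm hy
    have hx' : x ≠ S'.newVertex := by
      rintro rfl
      exact hx (new hS' hS hh' hh h.left_mem).symm
    have hy' : y ≠ S'.newVertex := by
      rintro rfl
      exact hy (new hS' hS hh' hh h.right_mem).symm
    have := hT.offset_eq S hS S' hS' _ _ _ _ (h.parent hd (hlt S hS) hCS hx hy)
      (h'.parent hd (hlt S' hS') hCS' hx' hy')
    omega

end IsCompatible

/-! ### Uniform refinements -/

theorem AffineIndependent.mem_extremePoints {E : Type*} [NormedAddCommGroup E]
    [NormedSpace ℝ E] [FiniteDimensional ℝ E] {V : Set E}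
    (hV : AffineIndependent ℝ ((↑) : V → E)) {x : E} (hx : x ∈ V) :
    x ∈ (convexHull ℝ V).extremePoints ℝ := by
  have hf : V.Finite := finite_set_of_fin_dim_affineIndependent ℝ hV
  have hZ : (convexHull ℝ V).extremePoints ℝ ⊆ V := extremePoints_convexHull_subset
  have hcl := closure_convexHull_extremePoints (hf.isCompact_convexHull ℝ) (convex_convexHull ℝ V)
  rw [((hf.subset hZ).isCompact_convexHull ℝ).isClosed.closure_eq] at hcl
  exact hV.mem_of_mem_convexHull hZ hx (by rw [hcl]; exact subset_convexHull _ _ hx)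

theorem AffineIndependent.subset_of_convexHull_eq {E : Type*} [NormedAddCommGroup E]
    [NormedSpace ℝ E] [FiniteDimensional ℝ E] {V W W' : Set E}
    (hV : AffineIndependent ℝ ((↑) : V → E)) (hW : W ⊆ V)
    (h : convexHull ℝ W = convexHull ℝ W') : W ⊆ W' := by
  intro w hw
  have h1 := (hV.mono hW).mem_extremePoints hw
  rw [h] at h1
  exact extremePoints_convexHull_subset h1

theorem AffineIndependent.ncard_le_of_subset_affineSpan {E : Type*} [NormedAddCommGroup E]
    [NormedSpace ℝ E] [FiniteDimensional ℝ E] {W Z : Set E}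
    (hW : AffineIndependent ℝ ((↑) : W → E)) (hZ : Z.Finite) (h : W ⊆ affineSpan ℝ Z) :
    W.ncard ≤ Z.ncard := by
  classical
  have hf : W.Finite := finite_set_of_fin_dim_affineIndependent ℝ hW
  have h1 : ∀ V' : Set E, V' = W → AffineIndependent ℝ ((↑) : V' → E) := by
    rintro _ rfl; exact hW
  have := AffineIndependent.card_le_card_of_subset_affineSpan (k := ℝ) (s := hf.toFinset)
    (t := hZ.toFinset) (h1 _ hf.coe_toFinset) (by simpa using h)
  rwa [← Set.ncard_eq_toFinset_card _ hf, ← Set.ncard_eq_toFinset_card _ hZ] at this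

/-- The simplices obtained from those in `T₀` by `ℓ` uniform bisections. -/
noncomputable def uniformRefinement {d : ℕ} (T₀ : Finset (TaggedSimplex d)) :
    ℕ → Finset (TaggedSimplex d)
  | 0 => T₀
  | ℓ + 1 => by classical exact (uniformRefinement T₀ ℓ).biUnion bisect

theorem mem_uniformRefinement_succ {d : ℕ} {T₀ : Finset (TaggedSimplex d)} {ℓ : ℕ}
    {C : TaggedSimplex d} : C ∈ uniformRefinement T₀ (ℓ + 1) ↔
      ∃ S ∈ uniformRefinement T₀ ℓ, C ∈ S.bisect := by
  classical
  simp [uniformRefinement]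

/-- The matching condition passes from hyperfaces to all edges, along chains of simplices that
contain the edge. -/
theorem IsInitialTriangulation.isCompatible {d γ : ℕ} (hd : 1 ≤ d)
    {Ω : Set (EuclideanSpace ℝ (Fin d))} (hΩ : IsBoundedLipschitzDomain Ω)
    {T₀ : Finset (TaggedSimplex d)} (hT₀ : IsInitialTriangulation Ω γ T₀) :
    IsCompatible γ T₀ := by
  have hint : ∀ S ∈ T₀, (interior S.carrier).Nonempty := fun S hS =>
    interior_convexHull_nonempty_iff_affineSpan_eq_top.2
      (isSimplexSet_vertices (hT₀.nondegenerate S hS)).affineSpan_eq_top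
  have hne : ∀ S ∈ T₀, ∀ S' ∈ T₀, S.carrier = S'.carrier → S = S' := by
    intro S hS S' hS' h
    by_contra hSS
    have := hT₀.nonoverlapping S hS S' hS' hSS
    rw [h, disjoint_self] at this
    exact (hint S' hS').ne_empty this
  have hconf : ∀ S ∈ T₀, ∀ S' ∈ T₀,
      S.carrier ∩ S'.carrier ⊆ convexHull ℝ (S.vertices ∩ S'.vertices) := by
    intro S hS S' hS'
    rcases hT₀.conforming S hS S' hS' with h | h | ⟨⟨W, -, hW, hSW⟩, W', -, hW', hSW'⟩
    · obtain rfl := hne S hS S' hS' h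
      rw [Set.inter_self, Set.inter_self]; rfl
    · rw [h]; exact Set.empty_subset _
    · have hWW : W ⊆ W' := (isSimplexSet_vertices (hT₀.nondegenerate S hS)).indep
        |>.subset_of_convexHull_eq hW.subset (hSW.symm.trans hSW')
      rw [hSW]
      exact convexHull_mono (Set.subset_inter hW.subset (hWW.trans hW'.subset))
  refine ⟨hT₀.nondegenerate, hT₀.type_eq, fun S hS S' hS' h => hne S hS S' hS' ?_, hconf, ?_⟩
  · rw [carrier, carrier, h]
  intro S hS S' hS' x y o o' h h'
  have hpair : ∀ A ∈ T₀, midpoint ℝ x y ∈ A.carrier → x ∈ A.vertices ∧ y ∈ A.vertices := by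
    intro A hA hm
    -- The midpoint of an edge of `S` lies in the relative interior of that edge.
    have hxy := h.ne (hT₀.nondegenerate S hS)
    have hsp : EdgeSplit S.vertices x y (S.vertices \ {x, y}) := by
      refine ⟨isSimplexSet_vertices (hT₀.nondegenerate S hS), ?_, hxy, by simp, by simp⟩
      ext z
      have h1 := h.left_mem
      have h2 := h.right_mem
      simp only [Set.mem_insert_iff, Set.mem_sdiff, Set.mem_singleton_iff]
      constructor
      · intro hz; by_cases z = x <;> by_cases z = y <;> tauto
      · rintro (rfl | rfl | hz)
        exacts [h1, h2, hz.1]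
    have := hsp.mem_of_midpoint_mem Set.inter_subset_left
      (hconf S hS A hA ⟨hsp.midpoint_mem, hm⟩)
    exact ⟨this.1.2, this.2.2⟩
  have hmid : ∀ A : TaggedSimplex d, x ∈ A.vertices → y ∈ A.vertices → midpoint ℝ x y ∈ A.carrier :=
    fun A hx hy => (convex_convexHull ℝ _).midpoint_mem (subset_convexHull _ _ hx)
      (subset_convexHull _ _ hy)
  have hchain := exists_hyperface_chain hΩ (𝒱 := vertices '' (T₀ : Set (TaggedSimplex d)))
    (T₀.finite_toSet.image _)
    (by rintro _ ⟨A, hA, rfl⟩; exact isSimplexSet_vertices (hT₀.nondegenerate A hA))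
    (by rw [Set.biUnion_image]; exact hT₀.covering)
    (by rintro _ ⟨A, hA, rfl⟩ _ ⟨B, hB, rfl⟩; exact hconf A hA B hB)
    ⟨S, hS, rfl⟩ ⟨S', hS', rfl⟩ (hmid S h.left_mem h.right_mem) (hmid S' h'.left_mem h'.right_mem)
  suffices H : ∀ V, Relation.ReflTransGen (fun A B => B ∈ vertices '' (T₀ : Set (TaggedSimplex d)) ∧
      midpoint ℝ x y ∈ convexHull ℝ B ∧ d ≤ (A ∩ B).ncard) S.vertices V →
      ∀ A ∈ T₀, A.vertices = V → ∀ p, A.HasOffset x y p → o = p from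
    H _ hchain S' hS' rfl o' h'
  intro V hV
  induction hV with
  | refl =>
    intro A hA hAV p hp
    obtain rfl := hne A hA S hS (by rw [carrier, carrier, hAV])
    exact h.unique (hT₀.nondegenerate A hA) hp
  | tail hab hbc ih =>
    rename_i V₁ V₂
    intro A hA hAV p hp
    obtain ⟨B, hB, rfl⟩ : ∃ B ∈ T₀, B.vertices = V₁ := by
      rcases Relation.ReflTransGen.cases_tail hab with h1 | ⟨_, _, ⟨B, hB, hBV⟩, -⟩
      · exact ⟨S, hS, h1.symm⟩
      · exact ⟨B, hB, hBV⟩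
    subst hAV
    have hBm : midpoint ℝ x y ∈ B.carrier := by
      rcases Relation.ReflTransGen.cases_tail hab with h1 | ⟨_, _, -, h2, -⟩
      · have := hmid S h.left_mem h.right_mem
        rw [carrier, ← h1] at this; exact this
      · exact h2
    obtain ⟨hxB, hyB⟩ := hpair B hB hBm
    obtain ⟨q, hq⟩ := exists_hasOffset hxB hyB (h.ne (hT₀.nondegenerate S hS))
    rw [ih B hB rfl q hq]
    by_cases hBA : B = A
    · subst hBA; exact hq.unique (hT₀.nondegenerate B hB) hp
    have hcard : (B.vertices ∩ A.vertices).ncard = d := by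
      have hs := isSimplexSet_vertices (hT₀.nondegenerate B hB)
      have hs' := isSimplexSet_vertices (hT₀.nondegenerate A hA)
      have hc := hs.ncard_eq
      have hc' := hs'.ncard_eq
      simp only [finrank_euclideanSpace, Fintype.card_fin] at hc hc'
      have h1 := hbc.2.2
      have h2 := Set.ncard_inter_le_ncard_left B.vertices A.vertices hs.finite
      by_contra hcon
      have e1 : B.vertices ∩ A.vertices = B.vertices :=
        Set.eq_of_subset_of_ncard_le Set.inter_subset_left (by omega) hs.finite
      have e2 : B.vertices ∩ A.vertices = A.vertices :=
        Set.eq_of_subset_of_ncard_le Set.inter_subset_right (by omega) hs'.finite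
      exact hBA (hne B hB A hA (by rw [carrier, carrier, ← e1.symm.trans e2]))
    exact (hT₀.matching B hB A hA hBA hcard).offset_eq hd (hT₀.nondegenerate B hB)
      (hT₀.nondegenerate A hA) ((hT₀.type_eq B hB).trans (hT₀.type_eq A hA).symm)
      (by rw [hT₀.type_eq B hB]; exact hT₀.type_lt) hq hp

/-- The uniform refinements `T ℓ` of a triangulation of `closure Ω`, each consisting of the children
of the simplices in the preceding one. -/
structure IsBisectionForest {d : ℕ} (Ω : Set (EuclideanSpace ℝ (Fin d)))
    (T : ℕ → Finset (TaggedSimplex d)) : Prop where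
  one_le : 1 ≤ d
  domain : IsBoundedLipschitzDomain Ω
  compatible : ∀ ℓ, ∃ γ < d, IsCompatible γ (T ℓ)
  level_eq : ∀ ℓ, ∀ S ∈ T ℓ, S.level = ℓ
  mem_succ : ∀ ℓ C, C ∈ T (ℓ + 1) ↔ ∃ S ∈ T ℓ, C ∈ S.bisect
  covering : ∀ ℓ, ⋃ S ∈ T ℓ, S.carrier = closure Ω

theorem isBisectionForest_uniformRefinement {d γ : ℕ} (hd : 1 ≤ d)
    {Ω : Set (EuclideanSpace ℝ (Fin d))} (hΩ : IsBoundedLipschitzDomain Ω)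
    {T₀ : Finset (TaggedSimplex d)} (hT₀ : IsInitialTriangulation Ω γ T₀) :
    IsBisectionForest Ω (uniformRefinement T₀) := by
  have hcomp : ∀ ℓ, ∃ γ < d, IsCompatible γ (uniformRefinement T₀ ℓ) := by
    intro ℓ
    induction ℓ with
    | zero => exact ⟨γ, hT₀.type_lt, hT₀.isCompatible hd hΩ⟩
    | succ ℓ ih =>
      obtain ⟨γ', hγ', h⟩ := ih
      exact ⟨(γ' + 1) % d, Nat.mod_lt _ hd, by classical exact h.refine hd hγ'⟩
  refine ⟨hd, hΩ, hcomp, ?_, fun ℓ C => mem_uniformRefinement_succ, ?_⟩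
  · intro ℓ
    induction ℓ with
    | zero => exact hT₀.level_eq_zero
    | succ ℓ ih =>
      intro C hC
      obtain ⟨S, hS, hCS⟩ := mem_uniformRefinement_succ.1 hC
      rw [level_of_mem_bisect hCS, ih S hS]
  · intro ℓ
    induction ℓ with
    | zero => exact hT₀.covering
    | succ ℓ ih =>
      obtain ⟨γ', hγ', h⟩ := hcomp ℓ
      rw [← ih]
      have hun : ∀ S ∈ uniformRefinement T₀ ℓ, S.carrier = S.child₀.carrier ∪ S.child₁.carrier :=
        fun S hS => carrier_eq_union hd (h.indep S hS) (by rw [h.type_eq S hS]; exact hγ')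
      ext x
      simp only [Set.mem_iUnion, exists_prop]
      constructor
      · rintro ⟨C, hC, hx⟩
        obtain ⟨S, hS, hCS⟩ := mem_uniformRefinement_succ.1 hC
        refine ⟨S, hS, ?_⟩
        rw [hun S hS]
        rcases mem_bisect.1 hCS with rfl | rfl
        · exact Or.inl hx
        · exact Or.inr hx
      · rintro ⟨S, hS, hx⟩
        rw [hun S hS] at hx
        rcases hx with hx | hx
        · exact ⟨_, mem_uniformRefinement_succ.2 ⟨S, hS, mem_bisect.2 (Or.inl rfl)⟩, hx⟩
        · exact ⟨_, mem_uniformRefinement_succ.2 ⟨S, hS, mem_bisect.2 (Or.inr rfl)⟩, hx⟩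

namespace IsBisectionForest

variable {d : ℕ} {Ω : Set (EuclideanSpace ℝ (Fin d))} {T : ℕ → Finset (TaggedSimplex d)}
  {S S' A B C X X' : TaggedSimplex d} {j ℓ ℓ' : ℕ}

theorem indep (h : IsBisectionForest Ω T) (hS : S ∈ T ℓ) : AffineIndependent ℝ S.vertex := by
  obtain ⟨γ, -, hc⟩ := h.compatible ℓ
  exact hc.indep S hS

theorem type_lt (h : IsBisectionForest Ω T) (hS : S ∈ T ℓ) : S.type < d := by
  obtain ⟨γ, hγ, hc⟩ := h.compatible ℓ
  rw [hc.type_eq S hS]; exact hγ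

theorem isSimplexSet (h : IsBisectionForest Ω T) (hS : S ∈ T ℓ) : IsSimplexSet S.vertices :=
  isSimplexSet_vertices (h.indep hS)

theorem ncard_vertices (h : IsBisectionForest Ω T) (hS : S ∈ T ℓ) : S.vertices.ncard = d + 1 := by
  simpa using (h.isSimplexSet hS).ncard_eq

theorem ne_ends (h : IsBisectionForest Ω T) (hS : S ∈ T ℓ) : S.v 0 ≠ S.v d :=
  (edgeSplit h.one_le (h.indep hS)).ne

theorem newVertex_mem (h : IsBisectionForest Ω T) (hS : S ∈ T ℓ) : S.newVertex ∈ S.carrier :=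
  newVertex_mem_carrier h.one_le (h.indep hS)

theorem carrier_subset (h : IsBisectionForest Ω T) (hS : S ∈ T ℓ) (hC : C ∈ S.bisect) :
    C.carrier ⊆ S.carrier :=
  carrier_subset_of_mem_bisect h.one_le (h.indep hS) (h.type_lt hS) hC

theorem exists_mem_bisect (h : IsBisectionForest Ω T) (hS : S ∈ T ℓ)
    {x : EuclideanSpace ℝ (Fin d)} (hx : x ∈ S.carrier) : ∃ C ∈ S.bisect, x ∈ C.carrier := by
  rw [carrier_eq_union h.one_le (h.indep hS) (h.type_lt hS)] at hx
  rcases hx with hx | hx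
  · exact ⟨_, mem_bisect.2 (Or.inl rfl), hx⟩
  · exact ⟨_, mem_bisect.2 (Or.inr rfl), hx⟩

theorem inter_subset (h : IsBisectionForest Ω T) (hS : S ∈ T ℓ) (hS' : S' ∈ T ℓ) :
    S.carrier ∩ S'.carrier ⊆ convexHull ℝ (S.vertices ∩ S'.vertices) := by
  obtain ⟨γ, -, hc⟩ := h.compatible ℓ
  exact hc.inter_subset S hS S' hS'

theorem eq_of_subset (h : IsBisectionForest Ω T) (hS : S ∈ T ℓ) (hS' : S' ∈ T ℓ) (hX : X ∈ T j)
    (h1 : X.carrier ⊆ S.carrier) (h2 : X.carrier ⊆ S'.carrier) : S = S' := by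
  obtain ⟨γ, -, hc⟩ := h.compatible ℓ
  exact hc.eq_of_isSimplexSet_subset hS hS' (h.isSimplexSet hX)
    (Set.subset_inter ((subset_convexHull _ _).trans h1) ((subset_convexHull _ _).trans h2))

theorem newVertex_eq (h : IsBisectionForest Ω T) (hS : S ∈ T ℓ) (hS' : S' ∈ T ℓ)
    (hm : S.newVertex ∈ S'.carrier) : S'.newVertex = S.newVertex := by
  obtain ⟨γ, hγ, hc⟩ := h.compatible ℓ
  exact hc.newVertex_eq h.one_le hγ hS hS' hm

theorem ends_mem_vertices (h : IsBisectionForest Ω T) (hS : S ∈ T ℓ) (hS' : S' ∈ T ℓ)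
    (hm : S.newVertex ∈ S'.carrier) : S.v 0 ∈ S'.vertices ∧ S.v d ∈ S'.vertices := by
  obtain ⟨γ, hγ, hc⟩ := h.compatible ℓ
  rcases hc.refinementEdge_eq h.one_le hγ hS hS' hm with ⟨h1, h2⟩ | ⟨h1, h2⟩
  · rw [← h1, ← h2]; exact ⟨S'.v_mem_vertices _, S'.v_mem_vertices _⟩
  · rw [← h1, ← h2]; exact ⟨S'.v_mem_vertices _, S'.v_mem_vertices _⟩

theorem exists_ancestor (h : IsBisectionForest Ω T) (hS : S ∈ T ℓ) (hj : j ≤ ℓ) :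
    ∃ A ∈ T j, S.carrier ⊆ A.carrier := by
  induction ℓ, hj using Nat.le_induction generalizing S with
  | base => exact ⟨S, hS, subset_rfl⟩
  | succ ℓ hj ih =>
    obtain ⟨P, hP, hSP⟩ := (h.mem_succ ℓ S).1 hS
    obtain ⟨A, hA, hPA⟩ := ih hP
    exact ⟨A, hA, (h.carrier_subset hP hSP).trans hPA⟩

theorem exists_descendant (h : IsBisectionForest Ω T) (hS : S ∈ T j) (hj : j ≤ ℓ)
    {x : EuclideanSpace ℝ (Fin d)} (hx : x ∈ S.carrier) :
    ∃ B ∈ T ℓ, B.carrier ⊆ S.carrier ∧ x ∈ B.carrier := by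
  induction ℓ, hj using Nat.le_induction with
  | base => exact ⟨S, hS, subset_rfl, hx⟩
  | succ ℓ hj ih =>
    obtain ⟨B, hB, hBS, hxB⟩ := ih
    obtain ⟨C, hC, hxC⟩ := h.exists_mem_bisect hB hxB
    exact ⟨C, (h.mem_succ ℓ C).2 ⟨B, hB, hC⟩, (h.carrier_subset hB hC).trans hBS, hxC⟩

theorem subset_of_subset (h : IsBisectionForest Ω T) (hS : S ∈ T ℓ) (hA : A ∈ T j) (hj : j ≤ ℓ)
    {k : ℕ} (hX : X ∈ T k) (h1 : X.carrier ⊆ S.carrier) (h2 : X.carrier ⊆ A.carrier) :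
    S.carrier ⊆ A.carrier := by
  obtain ⟨A', hA', hSA⟩ := h.exists_ancestor hS hj
  obtain rfl := h.eq_of_subset hA hA' hX h2 (h1.trans hSA)
  exact hSA

/-- A simplex that contains the refinement edge of a simplex of level `ℓ` has at most that level. -/
theorem level_le_of_ends_mem (h : IsBisectionForest Ω T) (hS : S ∈ T ℓ) (hS' : S' ∈ T ℓ')
    (h0 : S.v 0 ∈ S'.carrier) (h1 : S.v d ∈ S'.carrier) : ℓ' ≤ ℓ := by
  by_contra hlt
  obtain ⟨C, hC, hSC⟩ := h.exists_ancestor hS' (j := ℓ + 1) (by omega)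
  obtain ⟨A, hA, hCA⟩ := (h.mem_succ ℓ C).1 hC
  have hsub := h.carrier_subset hA hCA
  have hm : S.newVertex ∈ A.carrier :=
    (convex_convexHull ℝ _).midpoint_mem (hsub (hSC h0)) (hsub (hSC h1))
  obtain ⟨γ, hγ, hc⟩ := h.compatible ℓ
  apply not_refinementEdge_subset_of_mem_bisect h.one_le (h.indep hA) (h.type_lt hA) hCA
  rcases hc.refinementEdge_eq h.one_le hγ hS hA hm with ⟨e1, e2⟩ | ⟨e1, e2⟩ <;> rw [e1, e2]
  · exact ⟨hSC h0, hSC h1⟩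
  · exact ⟨hSC h1, hSC h0⟩

theorem exists_descendant_newVertex_eq (h : IsBisectionForest Ω T) (hS : S ∈ T ℓ) (hA : A ∈ T j)
    (hj : j ≤ ℓ) (hm : S.newVertex ∈ A.carrier) :
    ∃ B ∈ T ℓ, B.carrier ⊆ A.carrier ∧ B.newVertex = S.newVertex := by
  obtain ⟨B, hB, hBA, hmB⟩ := h.exists_descendant hA hj hm
  exact ⟨B, hB, hBA, h.newVertex_eq hS hB hmB⟩

/-! #### Dimensions of intersections -/

theorem _root_.convexDim_le {d : ℕ} (A : Set (EuclideanSpace ℝ (Fin d))) : convexDim A ≤ d := by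
  have := Submodule.finrank_le (vectorSpan ℝ A)
  simpa [convexDim] using this

theorem _root_.one_le_convexDim {d : ℕ} {A : Set (EuclideanSpace ℝ (Fin d))}
    {x y : EuclideanSpace ℝ (Fin d)} (hx : x ∈ A) (hy : y ∈ A) (hxy : x ≠ y) :
    1 ≤ convexDim A := by
  have : Nontrivial (vectorSpan ℝ A) := by
    refine ⟨⟨⟨x -ᵥ y, vsub_mem_vectorSpan ℝ hx hy⟩, 0, ?_⟩⟩
    intro h
    exact hxy (sub_eq_zero.1 (congrArg Subtype.val h))
  exact Module.finrank_pos

theorem convexDim_carrier (h : IsBisectionForest Ω T) (hS : S ∈ T ℓ) : convexDim S.carrier = d := by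
  rw [convexDim, carrier, ← direction_affineSpan, affineSpan_convexHull,
    (h.isSimplexSet hS).affineSpan_eq_top, AffineSubspace.direction_top, finrank_top]
  simp

theorem convexDim_inter_eq_iff (h : IsBisectionForest Ω T) (hS : S ∈ T ℓ) (hA : A ∈ T j)
    (hj : j ≤ ℓ) : convexDim (S.carrier ∩ A.carrier) = d ↔ S.carrier ⊆ A.carrier := by
  constructor
  · intro hdim
    obtain ⟨A', hA', hSA⟩ := h.exists_ancestor hS hj
    have hsub : S.carrier ∩ A.carrier ⊆ convexHull ℝ (A'.vertices ∩ A.vertices) :=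
      (Set.inter_subset_inter_left _ hSA).trans (h.inter_subset hA' hA)
    have hspan : vectorSpan ℝ (A'.vertices ∩ A.vertices) = ⊤ := by
      rw [← direction_affineSpan, ← affineSpan_convexHull, direction_affineSpan, eq_top_iff]
      refine le_trans (le_of_eq ?_) (vectorSpan_mono ℝ hsub)
      refine (Submodule.eq_top_of_finrank_eq ?_).symm
      simpa [convexDim] using hdim
    have hne : (A'.vertices ∩ A.vertices).Nonempty := by
      rw [Set.nonempty_iff_ne_empty]
      intro he
      rw [he, vectorSpan_empty] at hspan
      have := congrArg (fun W : Submodule ℝ (EuclideanSpace ℝ (Fin d)) => Module.finrank ℝ W) hspan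
      simp only [finrank_bot, finrank_top, finrank_euclideanSpace, Fintype.card_fin] at this
      have := h.one_le
      omega
    have htop : affineSpan ℝ (A'.vertices ∩ A.vertices) = ⊤ :=
      (AffineSubspace.affineSpan_eq_top_iff_vectorSpan_eq_top_of_nonempty ℝ _ _ hne).2 hspan
    have hle : d + 1 ≤ (A'.vertices ∩ A.vertices).ncard := by
      rw [← h.ncard_vertices hA]
      refine (h.isSimplexSet hA).indep.ncard_le_of_subset_affineSpan
        ((h.isSimplexSet hA).finite.subset Set.inter_subset_right) ?_
      rw [htop]; exact Set.subset_univ _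
    have e2 : A'.vertices ∩ A.vertices = A.vertices :=
      Set.eq_of_subset_of_ncard_le Set.inter_subset_right
        (by rw [h.ncard_vertices hA]; exact hle) (h.isSimplexSet hA).finite
    have : A.carrier ⊆ A'.carrier := convexHull_mono (e2 ▸ Set.inter_subset_left)
    obtain rfl := h.eq_of_subset hA' hA hA this subset_rfl
    exact hSA
  · intro hsub
    rw [Set.inter_eq_left.2 hsub, h.convexDim_carrier hS]

/-- For `d = 1`: two simplices that are not nested have at most one common point. -/
theorem inter_subsingleton (h : IsBisectionForest Ω T) (hd : d = 1) (hS : S ∈ T ℓ) (hA : A ∈ T j)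
    (hj : j ≤ ℓ) (hns : ¬S.carrier ⊆ A.carrier) : (S.carrier ∩ A.carrier).Subsingleton := by
  obtain ⟨A', hA', hSA⟩ := h.exists_ancestor hS hj
  have hsub : S.carrier ∩ A.carrier ⊆ convexHull ℝ (A'.vertices ∩ A.vertices) :=
    (Set.inter_subset_inter_left _ hSA).trans (h.inter_subset hA' hA)
  have hfin := (h.isSimplexSet hA).finite
  have hss : (A'.vertices ∩ A.vertices).Subsingleton := by
    have := (hfin.subset (Set.inter_subset_right (s := A'.vertices))).to_subtype
    rw [← Set.ncard_le_one_iff_subsingleton]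
    by_contra hlt
    have e2 : A'.vertices ∩ A.vertices = A.vertices :=
      Set.eq_of_subset_of_ncard_le Set.inter_subset_right
        (by rw [h.ncard_vertices hA]; omega) hfin
    have : A.carrier ⊆ A'.carrier := convexHull_mono (e2 ▸ Set.inter_subset_left)
    obtain rfl := h.eq_of_subset hA' hA hA this subset_rfl
    exact hns hSA
  refine Set.Subsingleton.anti ?_ hsub
  rcases hss.eq_empty_or_singleton with he | ⟨x, hx⟩
  · rw [he, convexHull_empty]; exact Set.subsingleton_empty
  · rw [hx, convexHull_singleton]; exact Set.subsingleton_singleton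

/-- The parents of simplices that share a hyperface share a hyperface (or are equal). -/
theorem le_ncard_parent (h : IsBisectionForest Ω T) (hX : X ∈ T ℓ) (hX' : X' ∈ T ℓ)
    (hB : B ∈ X.bisect) {B' : TaggedSimplex d} (hB' : B' ∈ X'.bisect)
    (hc : d ≤ (B.vertices ∩ B'.vertices).ncard) : d ≤ (X.vertices ∩ X'.vertices).ncard := by
  have hBT : B ∈ T (ℓ + 1) := (h.mem_succ ℓ B).2 ⟨X, hX, hB⟩
  refine hc.trans (((h.isSimplexSet hBT).indep.mono
    Set.inter_subset_left).ncard_le_of_subset_affineSpan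
    ((h.isSimplexSet hX).finite.subset Set.inter_subset_left) ?_)
  refine subset_trans ?_ ((h.inter_subset hX hX').trans (convexHull_subset_affineSpan _))
  exact Set.inter_subset_inter ((subset_convexHull _ _).trans (h.carrier_subset hX hB))
    ((subset_convexHull _ _).trans (h.carrier_subset hX' hB'))

/-- If two children share a hyperface, then their parents or they themselves have the same
refinement edge. Indeed, if the parents do not, then the hyperface is opposite to the new vertex,
and hence contains the refinement edge of a child. -/
theorem newVertex_mem_or (h : IsBisectionForest Ω T) (hd : 2 ≤ d) (hX : X ∈ T ℓ) (hX' : X' ∈ T ℓ)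
    (hB : B ∈ X.bisect) {B' : TaggedSimplex d} (hB' : B' ∈ X'.bisect)
    (hc : d ≤ (B.vertices ∩ B'.vertices).ncard) :
    X.newVertex ∈ X'.carrier ∨ B.newVertex ∈ B'.carrier := by
  by_cases hm : X.newVertex ∈ B'.vertices
  · exact Or.inl (h.carrier_subset hX' hB' (subset_convexHull _ _ hm))
  · right
    have hBT : B ∈ T (ℓ + 1) := (h.mem_succ ℓ B).2 ⟨X, hX, hB⟩
    have hfin := (h.isSimplexSet hBT).finite
    have hBm : B.v 1 = X.newVertex := by
      rcases mem_bisect.1 hB with rfl | rfl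
      · rw [child₀_v h.one_le, if_neg one_ne_zero, if_pos rfl]
      · rw [child₁_v h.one_le, if_neg one_ne_zero, if_pos rfl]
    have hsub : B.vertices ∩ B'.vertices ⊆ B.vertices \ {B.v 1} := by
      rintro x ⟨hx, hx'⟩
      refine ⟨hx, ?_⟩
      rintro rfl
      exact hm (hBm ▸ hx')
    have hcard : (B.vertices \ {B.v 1}).ncard = d := by
      have := Set.ncard_sdiff_singleton_add_one (B.v_mem_vertices 1) hfin
      rw [h.ncard_vertices hBT] at this
      omega
    have heq : B.vertices ∩ B'.vertices = B.vertices \ {B.v 1} :=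
      Set.eq_of_subset_of_ncard_le hsub (by omega) (hfin.subset Set.sdiff_subset)
    have hmem : ∀ i ≤ d, i ≠ 1 → B.v i ∈ B'.carrier := by
      intro i hi hi1
      have : B.v i ∈ B.vertices ∩ B'.vertices := by
        rw [heq]
        refine ⟨B.v_mem_vertices i, fun he => hi1 (v_injOn (h.indep hBT) hi (by omega) he)⟩
      exact subset_convexHull _ _ this.2
    exact (convex_convexHull ℝ _).midpoint_mem (hmem 0 (by omega) (by omega))
      (hmem d le_rfl (by omega))

/-- The simplices of level `ℓ` with a given refinement edge are linked through hyperfaces. -/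
theorem exists_chain (h : IsBisectionForest Ω T) (hS : S ∈ T ℓ) (hS' : S' ∈ T ℓ)
    (hm : S'.newVertex = S.newVertex) :
    Relation.ReflTransGen (fun A B => B ∈ T ℓ ∧ B.newVertex = S.newVertex ∧
      d ≤ (A.vertices ∩ B.vertices).ncard) S S' := by
  have hchain := exists_hyperface_chain h.domain (𝒱 := vertices '' (T ℓ : Set (TaggedSimplex d)))
    ((T ℓ).finite_toSet.image _)
    (by rintro _ ⟨A, hA, rfl⟩; exact h.isSimplexSet hA)
    (by rw [Set.biUnion_image]; exact h.covering ℓ)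
    (by rintro _ ⟨A, hA, rfl⟩ _ ⟨B, hB, rfl⟩; exact h.inter_subset hA hB)
    ⟨S, hS, rfl⟩ ⟨S', hS', rfl⟩ (h.newVertex_mem hS) (hm ▸ h.newVertex_mem hS')
  obtain ⟨γ, -, hcomp⟩ := h.compatible ℓ
  suffices H : ∀ V, Relation.ReflTransGen (fun A B => B ∈ vertices '' (T ℓ : Set (TaggedSimplex d)) ∧
      S.newVertex ∈ convexHull ℝ B ∧ d ≤ (A ∩ B).ncard) S.vertices V →
      ∃ A ∈ T ℓ, A.vertices = V ∧ Relation.ReflTransGen (fun A B => B ∈ T ℓ ∧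
        B.newVertex = S.newVertex ∧ d ≤ (A.vertices ∩ B.vertices).ncard) S A by
    obtain ⟨A, hA, hAS, hr⟩ := H _ hchain
    rwa [hcomp.eq_of_vertices_eq A hA S' hS' hAS] at hr
  intro V hV
  induction hV with
  | refl => exact ⟨S, hS, rfl, Relation.ReflTransGen.refl⟩
  | tail hab hbc ih =>
    obtain ⟨A, hA, rfl, hr⟩ := ih
    obtain ⟨⟨B, hB, rfl⟩, hmB, hcard⟩ := hbc
    exact ⟨B, hB, rfl, hr.tail ⟨hB, h.newVertex_eq hS hB hmB, hcard⟩⟩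

end IsBisectionForest

/-! ### Time intervals -/

namespace TimeInterval

variable {I J K : TimeInterval} {s : ℝ}

theorem Ico_subset_carrier (I : TimeInterval) : Set.Ico I.left I.right ⊆ I.carrier := by
  unfold carrier
  split_ifs
  exacts [Set.Ico_subset_Icc_self, subset_rfl]

theorem carrier_subset_Icc (I : TimeInterval) : I.carrier ⊆ Set.Icc I.left I.right := by
  unfold carrier
  split_ifs
  exacts [subset_rfl, Set.Ico_subset_Icc_self]

theorem closure_carrier (hI : I.left < I.right) : closure I.carrier = Set.Icc I.left I.right := by
  apply subset_antisymm
  · exact closure_minimal I.carrier_subset_Icc isClosed_Icc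
  · rw [← closure_Ico hI.ne]
    exact closure_mono I.Ico_subset_carrier

theorem left_mem (hI : I.left < I.right) : I.left ∈ I.carrier :=
  I.Ico_subset_carrier ⟨le_rfl, hI⟩

theorem le_of_carrier_subset (hI : I.left < I.right) (hJ : J.left < J.right)
    (h : J.carrier ⊆ I.carrier) : I.left ≤ J.left ∧ J.right ≤ I.right := by
  have := closure_mono h
  rw [closure_carrier hI, closure_carrier hJ, Set.Icc_subset_Icc_iff hJ.le] at this
  exact this

/-- The closures of the intervals have exactly one common point. -/
def Adjacent (I J : TimeInterval) : Prop := I.right = J.left ∨ J.right = I.left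

theorem Adjacent.symm (h : I.Adjacent J) : J.Adjacent I := Or.symm h

theorem ncard_closure_inter_eq_one_iff (hI : I.left < I.right) (hJ : J.left < J.right) :
    (closure I.carrier ∩ closure J.carrier).ncard = 1 ↔ I.Adjacent J := by
  rw [closure_carrier hI, closure_carrier hJ, Set.Icc_inter_Icc, Set.ncard_eq_one, Adjacent]
  constructor
  · rintro ⟨a, ha⟩
    obtain ⟨h1, h2⟩ := Set.Icc_eq_singleton_iff.1 ha
    rcases max_choice I.left J.left with h3 | h3 <;> rcases min_choice I.right J.right with h4 | h4
    · exact absurd (h3.symm.trans (h1.trans (h2.symm.trans h4))) hI.ne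
    · right; exact (h4.symm.trans (h2.trans (h1.symm.trans h3)))
    · left; exact (h4.symm.trans (h2.trans (h1.symm.trans h3)))
    · exact absurd (h3.symm.trans (h1.trans (h2.symm.trans h4))) hJ.ne
  · rintro (h | h)
    · refine ⟨J.left, Set.Icc_eq_singleton_iff.2 ⟨max_eq_right (by linarith), ?_⟩⟩
      rw [h]; exact min_eq_left hJ.le
    · refine ⟨I.left, Set.Icc_eq_singleton_iff.2 ⟨max_eq_left (by linarith), ?_⟩⟩
      rw [h]; exact min_eq_right hI.le

theorem Adjacent.not_subset (hI : I.left < I.right) (hJ : J.left < J.right) (h : I.Adjacent J) :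
    ¬(J.carrier ⊆ I.carrier) := by
  intro hs
  have := le_of_carrier_subset hI hJ hs
  rcases h with h | h <;> linarith

/-- Enlarging one of two adjacent intervals keeps them adjacent, unless they overlap then. -/
theorem Adjacent.of_subset (hI : I.left < I.right) (hJ : J.left < J.right) (hK : K.left < K.right)
    (hs : J.carrier ⊆ I.carrier) (hd : I.carrier ∩ K.carrier = ∅) (h : J.Adjacent K) :
    I.Adjacent K := by
  obtain ⟨h1, h2⟩ := le_of_carrier_subset hI hJ hs
  have hno : ¬(I.left < K.right ∧ K.left < I.right) := by
    rintro ⟨h3, h4⟩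
    have : max I.left K.left ∈ I.carrier ∩ K.carrier :=
      ⟨I.Ico_subset_carrier ⟨le_max_left _ _, max_lt hI h4⟩,
        K.Ico_subset_carrier ⟨le_max_right _ _, max_lt h3 hK⟩⟩
    rw [hd] at this
    exact this
  rw [not_and_or, not_lt, not_lt] at hno
  rcases h with h | h
  · left
    rcases hno with h3 | h3 <;> linarith
  · right
    rcases hno with h3 | h3 <;> linarith

theorem mem_bisect : J ∈ I.bisect ↔ J = ⟨I.left, (I.left + I.right) / 2, false⟩ ∨
    J = ⟨(I.left + I.right) / 2, I.right, I.closed⟩ := by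
  classical
  simp [bisect]

theorem left_lt_right_of_mem_bisect (hI : I.left < I.right) (hJ : J ∈ I.bisect) :
    J.left < J.right := by
  rcases mem_bisect.1 hJ with rfl | rfl <;> dsimp only <;> linarith

theorem mem_carrier_iff : s ∈ I.carrier ↔ I.left ≤ s ∧ (s < I.right ∨ (I.closed ∧ s = I.right ∧
    I.left ≤ I.right)) := by
  unfold carrier
  split_ifs with h
  · simp only [Set.mem_Icc, h, true_and]
    constructor
    · rintro ⟨h1, h2⟩
      rcases h2.lt_or_eq with h3 | h3
      · exact ⟨h1, Or.inl h3⟩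
      · exact ⟨h1, Or.inr ⟨h3, h1.trans h2⟩⟩
    · rintro ⟨h1, h2 | ⟨h2, -⟩⟩
      · exact ⟨h1, h2.le⟩
      · exact ⟨h1, h2.le⟩
  · simp [h]

theorem carrier_subset_of_mem_bisect (hI : I.left < I.right) (hJ : J ∈ I.bisect) :
    J.carrier ⊆ I.carrier := by
  intro s hs
  rw [mem_carrier_iff] at hs ⊢
  rcases mem_bisect.1 hJ with rfl | rfl
  · simp only [Bool.false_eq_true, false_and, or_false] at hs
    exact ⟨hs.1, Or.inl (by linarith)⟩
  · refine ⟨by dsimp only at hs; linarith, ?_⟩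
    rcases hs.2 with h | ⟨h1, h2, -⟩
    · exact Or.inl h
    · exact Or.inr ⟨h1, h2, hI.le⟩

theorem exists_mem_bisect (hI : I.left < I.right) (hs : s ∈ I.carrier) :
    ∃ J ∈ I.bisect, s ∈ J.carrier := by
  rw [mem_carrier_iff] at hs
  rcases lt_or_ge s ((I.left + I.right) / 2) with h | h
  · refine ⟨_, mem_bisect.2 (Or.inl rfl), mem_carrier_iff.2 ⟨hs.1, Or.inl h⟩⟩
  · refine ⟨_, mem_bisect.2 (Or.inr rfl), mem_carrier_iff.2 ⟨h, ?_⟩⟩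
    rcases hs.2 with h' | ⟨h1, h2, -⟩
    · exact Or.inl h'
    · exact Or.inr ⟨h1, h2, by dsimp only; linarith⟩

theorem eq_of_mem_bisect (hJ : J ∈ I.bisect) (hK : K ∈ I.bisect)
    (h1 : s ∈ J.carrier) (h2 : s ∈ K.carrier) : J = K := by
  rw [mem_carrier_iff] at h1 h2
  rcases mem_bisect.1 hJ with rfl | rfl <;> rcases mem_bisect.1 hK with rfl | rfl
  · rfl
  · simp only [Bool.false_eq_true, false_and, or_false] at h1
    have := h2.1
    dsimp only at this
    linarith [h1.2]
  · simp only [Bool.false_eq_true, false_and, or_false] at h2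
    have := h1.1
    dsimp only at this
    linarith [h2.2]
  · rfl

theorem mem_bisectIter_succ {m : ℕ} :
    J ∈ I.bisectIter (m + 1) ↔ ∃ K ∈ I.bisectIter m, J ∈ K.bisect := by
  classical
  simp [bisectIter]

theorem exists_right_eq (I : TimeInterval) (m : ℕ) : ∃ J ∈ I.bisectIter m, J.right = I.right := by
  induction m with
  | zero => exact ⟨I, by simp [bisectIter], rfl⟩
  | succ m ih =>
    obtain ⟨J, hJ, h⟩ := ih
    exact ⟨_, mem_bisectIter_succ.2 ⟨J, hJ, mem_bisect.2 (Or.inr rfl)⟩, h⟩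

theorem exists_left_eq (I : TimeInterval) (m : ℕ) : ∃ J ∈ I.bisectIter m, J.left = I.left := by
  induction m with
  | zero => exact ⟨I, by simp [bisectIter], rfl⟩
  | succ m ih =>
    obtain ⟨J, hJ, h⟩ := ih
    exact ⟨_, mem_bisectIter_succ.2 ⟨J, hJ, mem_bisect.2 (Or.inl rfl)⟩, h⟩

theorem exists_adjacent (I : TimeInterval) (m : ℕ) (h : I.Adjacent K) :
    ∃ J ∈ I.bisectIter m, J.Adjacent K := by
  rcases h with h | h
  · obtain ⟨J, hJ, h'⟩ := I.exists_right_eq m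
    exact ⟨J, hJ, Or.inl (h'.trans h)⟩
  · obtain ⟨J, hJ, h'⟩ := I.exists_left_eq m
    exact ⟨J, hJ, Or.inr (h.trans h'.symm)⟩

end TimeInterval

section IntervalForest

open TimeInterval

/-- The intervals in `G n` are those obtained from the initial ones by `n` bisections; the
intervals in each `G n` are disjoint. -/
structure IsIntervalForest (G : ℕ → Finset TimeInterval) : Prop where
  left_lt_right : ∀ n, ∀ I ∈ G n, I.left < I.right
  eq_of_mem : ∀ n, ∀ I ∈ G n, ∀ J ∈ G n, ∀ s, s ∈ I.carrier → s ∈ J.carrier → I = J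
  mem_succ : ∀ n J, J ∈ G (n + 1) ↔ ∃ I ∈ G n, J ∈ I.bisect

/-- The intervals obtained from those in `G₀` by `n` bisections. -/
noncomputable def intervalRefinement (G₀ : Finset TimeInterval) : ℕ → Finset TimeInterval
  | 0 => G₀
  | n + 1 => by classical exact (intervalRefinement G₀ n).biUnion bisect

theorem mem_intervalRefinement_succ {G₀ : Finset TimeInterval} {n : ℕ} {J : TimeInterval} :
    J ∈ intervalRefinement G₀ (n + 1) ↔ ∃ I ∈ intervalRefinement G₀ n, J ∈ I.bisect := by
  classical
  simp [intervalRefinement]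

theorem isIntervalForest_intervalRefinement {G₀ : Finset TimeInterval}
    (h₀ : ∀ I ∈ G₀, I.left < I.right)
    (h₁ : ∀ I ∈ G₀, ∀ J ∈ G₀, ∀ s, s ∈ I.carrier → s ∈ J.carrier → I = J) :
    IsIntervalForest (intervalRefinement G₀) := by
  have hlt : ∀ n, ∀ I ∈ intervalRefinement G₀ n, I.left < I.right := by
    intro n
    induction n with
    | zero => exact h₀
    | succ n ih =>
      intro J hJ
      obtain ⟨I, hI, hJI⟩ := mem_intervalRefinement_succ.1 hJ
      exact left_lt_right_of_mem_bisect (ih I hI) hJI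
  refine ⟨hlt, ?_, fun n J => mem_intervalRefinement_succ⟩
  intro n
  induction n with
  | zero => exact h₁
  | succ n ih =>
    intro J hJ J' hJ' s hs hs'
    obtain ⟨I, hI, hJI⟩ := mem_intervalRefinement_succ.1 hJ
    obtain ⟨I', hI', hJI'⟩ := mem_intervalRefinement_succ.1 hJ'
    obtain rfl := ih I hI I' hI' s (carrier_subset_of_mem_bisect (hlt n I hI) hJI hs)
      (carrier_subset_of_mem_bisect (hlt n I' hI') hJI' hs')
    exact eq_of_mem_bisect hJI hJI' hs hs'

namespace IsIntervalForest

variable {G : ℕ → Finset TimeInterval} {I J K : TimeInterval} {n m : ℕ} {s : ℝ}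

theorem mem_bisectIter (h : IsIntervalForest G) (hI : I ∈ G n) (hJ : J ∈ I.bisectIter m) :
    J ∈ G (n + m) ∧ J.carrier ⊆ I.carrier := by
  induction m generalizing J with
  | zero => simp only [bisectIter, Finset.mem_singleton] at hJ; subst hJ; exact ⟨hI, subset_rfl⟩
  | succ m ih =>
    obtain ⟨K, hK, hJK⟩ := mem_bisectIter_succ.1 hJ
    obtain ⟨h1, h2⟩ := ih hK
    exact ⟨(h.mem_succ _ _).2 ⟨K, h1, hJK⟩,
      (carrier_subset_of_mem_bisect (h.left_lt_right _ K h1) hJK).trans h2⟩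

theorem exists_mem_bisectIter (h : IsIntervalForest G) (hJ : J ∈ G (n + m)) :
    ∃ I ∈ G n, J ∈ I.bisectIter m := by
  induction m generalizing J with
  | zero => exact ⟨J, hJ, by simp [bisectIter]⟩
  | succ m ih =>
    obtain ⟨K, hK, hJK⟩ := (h.mem_succ _ _).1 hJ
    obtain ⟨I, hI, hKI⟩ := ih hK
    exact ⟨I, hI, mem_bisectIter_succ.2 ⟨K, hKI, hJK⟩⟩

theorem exists_mem_bisectIter_of_mem (h : IsIntervalForest G) (hI : I ∈ G n) (m : ℕ)
    (hs : s ∈ I.carrier) : ∃ J ∈ I.bisectIter m, s ∈ J.carrier := by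
  induction m with
  | zero => exact ⟨I, by simp [bisectIter], hs⟩
  | succ m ih =>
    obtain ⟨K, hK, hsK⟩ := ih
    obtain ⟨J, hJ, hsJ⟩ := TimeInterval.exists_mem_bisect
      (h.left_lt_right _ K (h.mem_bisectIter hI hK).1) hsK
    exact ⟨J, mem_bisectIter_succ.2 ⟨K, hK, hJ⟩, hsJ⟩

theorem carrier_nonempty (h : IsIntervalForest G) (hI : I ∈ G n) : I.carrier.Nonempty :=
  ⟨_, left_mem (h.left_lt_right n I hI)⟩

theorem mem_bisectIter_of_mem (h : IsIntervalForest G) (hI : I ∈ G n) (hJ : J ∈ G (n + m))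
    (hs : s ∈ I.carrier) (hs' : s ∈ J.carrier) : J ∈ I.bisectIter m := by
  obtain ⟨I', hI', hJI⟩ := h.exists_mem_bisectIter hJ
  obtain rfl := h.eq_of_mem n I hI I' hI' s hs ((h.mem_bisectIter hI' hJI).2 hs')
  exact hJI

/-- Two intervals that meet are nested. -/
theorem subset_of_mem (h : IsIntervalForest G) (hI : I ∈ G n) (hJ : J ∈ G m) (hnm : n ≤ m)
    (hs : s ∈ I.carrier) (hs' : s ∈ J.carrier) : J.carrier ⊆ I.carrier := by
  obtain ⟨k, rfl⟩ := Nat.exists_eq_add_of_le hnm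
  exact (h.mem_bisectIter hI (h.mem_bisectIter_of_mem hI hJ hs hs')).2

theorem volume_inter_pos_iff (h : IsIntervalForest G) (hI : I ∈ G n) (hJ : J ∈ G m) :
    0 < MeasureTheory.volume (I.carrier ∩ J.carrier) ↔ (I.carrier ∩ J.carrier).Nonempty := by
  constructor
  · intro hpos
    by_contra hne
    rw [Set.not_nonempty_iff_eq_empty] at hne
    simp [hne] at hpos
  · rintro ⟨s, hs, hs'⟩
    have pos : ∀ K : TimeInterval, K.left < K.right → 0 < MeasureTheory.volume K.carrier := by
      intro K hK
      refine lt_of_lt_of_le ?_ (MeasureTheory.measure_mono K.Ico_subset_carrier)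
      rw [Real.volume_Ico, ENNReal.ofReal_pos]
      linarith
    rcases le_total n m with hnm | hnm
    · rw [Set.inter_eq_right.2 (h.subset_of_mem hI hJ hnm hs hs')]
      exact pos J (h.left_lt_right m J hJ)
    · rw [Set.inter_eq_left.2 (h.subset_of_mem hJ hI hnm hs' hs)]
      exact pos I (h.left_lt_right n I hI)

end IsIntervalForest

end IntervalForest

/-! ### The forest of prisms -/

/-- `Q` is contained in `A`, factor by factor. -/
def Prism.Within {d : ℕ} (Q A : Prism d) : Prop :=
  Q.time.carrier ⊆ A.time.carrier ∧ Q.space.carrier ⊆ A.space.carrier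

theorem Prism.Within.refl {d : ℕ} (Q : Prism d) : Q.Within Q := ⟨subset_rfl, subset_rfl⟩

theorem Prism.Within.trans {d : ℕ} {Q A B : Prism d} (h₁ : Q.Within A) (h₂ : A.Within B) :
    Q.Within B := ⟨h₁.1.trans h₂.1, h₁.2.trans h₂.2⟩

/-- The data that determine the infinite forest of all prisms generated by atomic splits: the
uniform refinements of an initial triangulation and of an initial partition of a time interval. -/
structure PrismForest (d : ℕ) where
  s₁ : ℝ
  s₂ : ℝ
  domain : Set (EuclideanSpace ℝ (Fin d))
  space : ℕ → Finset (TaggedSimplex d)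
  time : ℕ → Finset TimeInterval
  s₁_pos : 0 < s₁
  s₂_pos : 0 < s₂
  isBisectionForest : IsBisectionForest domain space
  isIntervalForest : IsIntervalForest time

namespace PrismForest

variable {d : ℕ} (F : PrismForest d)

/-- The number of bisections in time that lead to the prisms of level `ℓ`. -/
noncomputable def generation (ℓ : ℕ) : ℕ := ⌈(ℓ : ℝ) * F.s₂ / (F.s₁ * d)⌉₊

/-- The children of a prism. -/
noncomputable abbrev children (Q : Prism d) : Finset (Prism d) := Q.atomicSplit F.s₁ F.s₂

/-- The nodes of the forest. All products of a simplex and an interval that belong to the same level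
occur. -/
def IsNode (Q : Prism d) : Prop :=
  Q.space ∈ F.space Q.level ∧ Q.time ∈ F.time (F.generation Q.level)

open Classical in
/-- The prisms of level `0`. -/
noncomputable def roots : Finset (Prism d) :=
  (F.time 0 ×ˢ F.space 0).image fun p => ⟨p.1, p.2⟩

theorem generation_zero : F.generation 0 = 0 := by simp [generation]

theorem generation_mono : Monotone F.generation := by
  intro i j hij
  refine Nat.ceil_mono ?_
  have h1 := F.s₁_pos
  have h2 := F.s₂_pos
  have : (i : ℝ) ≤ j := by exact_mod_cast hij
  gcongr

variable {F} {Q Q' R A P X C : Prism d} {ℓ : ℕ}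

theorem IsNode.of_mem {I : TimeInterval} {S : TaggedSimplex d} (hS : S ∈ F.space ℓ)
    (hI : I ∈ F.time (F.generation ℓ)) : F.IsNode ⟨I, S⟩ ∧ (⟨I, S⟩ : Prism d).level = ℓ := by
  have : (⟨I, S⟩ : Prism d).level = ℓ := F.isBisectionForest.level_eq ℓ S hS
  exact ⟨by unfold IsNode; rw [this]; exact ⟨hS, hI⟩, this⟩

theorem IsNode.left_lt_right (h : F.IsNode Q) : Q.time.left < Q.time.right :=
  F.isIntervalForest.left_lt_right _ _ h.2

theorem mem_roots : Q ∈ F.roots ↔ F.IsNode Q ∧ Q.level = 0 := by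
  classical
  simp only [roots, Finset.mem_image, Finset.mem_product, Prod.exists]
  constructor
  · rintro ⟨I, S, ⟨hI, hS⟩, rfl⟩
    exact IsNode.of_mem hS (by rwa [F.generation_zero])
  · rintro ⟨⟨h1, h2⟩, h0⟩
    rw [h0] at h1 h2
    rw [F.generation_zero] at h2
    exact ⟨Q.time, Q.space, ⟨h2, h1⟩, rfl⟩

theorem mem_children : C ∈ F.children Q ↔
    C.time ∈ Q.time.bisectIter (F.generation (Q.level + 1) - F.generation Q.level) ∧
      C.space ∈ Q.space.bisect := by
  classical
  simp only [children, Prism.atomicSplit, Finset.mem_image, Finset.mem_product, Prod.exists]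
  constructor
  · rintro ⟨I, S, h, rfl⟩
    exact h
  · intro h
    exact ⟨_, _, h, rfl⟩

theorem level_of_mem_children (hC : C ∈ F.children Q) : C.level = Q.level + 1 :=
  level_of_mem_bisect (mem_children.1 hC).2

theorem IsNode.children (hQ : F.IsNode Q) (hC : C ∈ F.children Q) : F.IsNode C ∧ C.Within Q := by
  have hl := level_of_mem_children hC
  obtain ⟨h1, h2⟩ := mem_children.1 hC
  obtain ⟨h3, h4⟩ := F.isIntervalForest.mem_bisectIter hQ.2 h1
  rw [Nat.add_sub_of_le (F.generation_mono (Nat.le_succ _))] at h3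
  refine ⟨⟨?_, by rw [hl]; exact h3⟩, h4, F.isBisectionForest.carrier_subset hQ.1 h2⟩
  rw [hl]
  exact (F.isBisectionForest.mem_succ _ _).2 ⟨_, hQ.1, h2⟩

theorem IsNode.exists_parent (hQ : F.IsNode Q) (h0 : Q.level ≠ 0) :
    ∃ P, F.IsNode P ∧ Q ∈ F.children P := by
  obtain ⟨ℓ, hℓ⟩ := Nat.exists_eq_succ_of_ne_zero h0
  obtain ⟨h1, h2⟩ := hQ
  rw [hℓ] at h1 h2
  obtain ⟨S, hS, hQS⟩ := (F.isBisectionForest.mem_succ _ _).1 h1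
  have hg := Nat.add_sub_of_le (F.generation_mono (Nat.le_succ ℓ))
  rw [← hg] at h2
  obtain ⟨I, hI, hQI⟩ := F.isIntervalForest.exists_mem_bisectIter h2
  obtain ⟨h3, h4⟩ := IsNode.of_mem hS hI
  exact ⟨_, h3, mem_children.2 ⟨by rw [h4]; exact hQI, hQS⟩⟩

theorem IsNode.eq_of_within (hQ : F.IsNode Q) (hQ' : F.IsNode Q') (hl : Q.level = Q'.level)
    (hX : F.IsNode X) (h1 : X.Within Q) (h2 : X.Within Q') : Q = Q' := by
  obtain ⟨s, hs⟩ := F.isIntervalForest.carrier_nonempty hX.2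
  have e1 : Q.time = Q'.time := F.isIntervalForest.eq_of_mem _ _ hQ.2 _ (by rw [hl]; exact hQ'.2) s
    (h1.1 hs) (h2.1 hs)
  have e2 : Q.space = Q'.space := F.isBisectionForest.eq_of_subset hQ.1 (by rw [hl]; exact hQ'.1)
    hX.1 h1.2 h2.2
  cases Q; cases Q'
  simp_all

theorem IsNode.within_of_within (hQ : F.IsNode Q) (hA : F.IsNode A) (hl : A.level ≤ Q.level)
    (hX : F.IsNode X) (h1 : X.Within Q) (h2 : X.Within A) : Q.Within A := by
  obtain ⟨s, hs⟩ := F.isIntervalForest.carrier_nonempty hX.2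
  exact ⟨F.isIntervalForest.subset_of_mem hA.2 hQ.2 (F.generation_mono hl) (h2.1 hs) (h1.1 hs),
    F.isBisectionForest.subset_of_subset hQ.1 hA.1 hl hX.1 h1.2 h2.2⟩

theorem IsNode.parent_unique (hP : F.IsNode P) (hQ : F.IsNode Q) (h1 : C ∈ F.children P)
    (h2 : C ∈ F.children Q) : P = Q := by
  have := level_of_mem_children h1
  have := level_of_mem_children h2
  exact hP.eq_of_within hQ (by omega) (hP.children h1).1 (hP.children h1).2 (hQ.children h2).2

theorem IsNode.exists_child (hQ : F.IsNode Q) {s : ℝ} (hs : s ∈ Q.time.carrier)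
    {x : EuclideanSpace ℝ (Fin d)} (hx : x ∈ Q.space.carrier) :
    ∃ C ∈ F.children Q, s ∈ C.time.carrier ∧ x ∈ C.space.carrier := by
  obtain ⟨I, hI, hsI⟩ := F.isIntervalForest.exists_mem_bisectIter_of_mem hQ.2
    (F.generation (Q.level + 1) - F.generation Q.level) hs
  obtain ⟨S, hS, hxS⟩ := F.isBisectionForest.exists_mem_bisect hQ.1 hx
  exact ⟨⟨I, S⟩, mem_children.2 ⟨hI, hS⟩, hsI, hxS⟩

/-- The node of level `j` that contains `Q`. -/
theorem IsNode.exists_ancestor (hQ : F.IsNode Q) {j : ℕ} (hj : j ≤ Q.level) :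
    ∃ A, F.IsNode A ∧ A.level = j ∧ Q.Within A := by
  obtain ⟨S, hS, hQS⟩ := F.isBisectionForest.exists_ancestor hQ.1 hj
  have hg := Nat.add_sub_of_le (F.generation_mono hj)
  have h2 := hQ.2
  rw [← hg] at h2
  obtain ⟨I, hI, hQI⟩ := F.isIntervalForest.exists_mem_bisectIter h2
  obtain ⟨h3, h4⟩ := IsNode.of_mem hS hI
  exact ⟨_, h3, h4, (F.isIntervalForest.mem_bisectIter hI hQI).2, hQS⟩

/-! ### Sets of split prisms -/

/-- A finite set of nodes that contains the parents of its elements: the set of all prisms that have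
been split in the course of some refinement. -/
structure IsLower (F : PrismForest d) (D : Finset (Prism d)) : Prop where
  isNode : ∀ Q ∈ D, F.IsNode Q
  parent_mem : ∀ Q ∈ D, ∀ P, F.IsNode P → Q ∈ F.children P → P ∈ D

open Classical in
/-- The partition obtained by splitting the prisms in `D`. -/
noncomputable def leaves (F : PrismForest d) (D : Finset (Prism d)) : Finset (Prism d) :=
  (F.roots ∪ D.biUnion F.children) \ D

theorem isLower_empty : F.IsLower ∅ := ⟨by simp, by simp⟩

theorem leaves_empty : F.leaves ∅ = F.roots := by
  classical
  simp [leaves]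

namespace IsLower

variable {D D' K : Finset (Prism d)}

theorem mem_leaves (hD : F.IsLower D) : Q ∈ F.leaves D ↔
    F.IsNode Q ∧ Q ∉ D ∧ ∀ P, F.IsNode P → Q ∈ F.children P → P ∈ D := by
  classical
  simp only [leaves, Finset.mem_sdiff, Finset.mem_union, Finset.mem_biUnion]
  constructor
  · rintro ⟨h | ⟨P, hP, hQP⟩, hQ⟩
    · obtain ⟨h1, h2⟩ := mem_roots.1 h
      refine ⟨h1, hQ, fun P _ hQP => ?_⟩
      have := level_of_mem_children hQP
      omega
    · refine ⟨((hD.isNode P hP).children hQP).1, hQ, fun P' hP' hQP' => ?_⟩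
      rwa [hP'.parent_unique (hD.isNode P hP) hQP' hQP]
  · rintro ⟨h1, h2, h3⟩
    refine ⟨?_, h2⟩
    by_cases h0 : Q.level = 0
    · exact Or.inl (mem_roots.2 ⟨h1, h0⟩)
    · obtain ⟨P, hP, hQP⟩ := h1.exists_parent h0
      exact Or.inr ⟨P, h3 P hP hQP, hQP⟩

theorem isNode_of_mem_leaves (hD : F.IsLower D) (hQ : Q ∈ F.leaves D) : F.IsNode Q :=
  (hD.mem_leaves.1 hQ).1

theorem notMem_of_mem_leaves (hD : F.IsLower D) (hQ : Q ∈ F.leaves D) : Q ∉ D :=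
  (hD.mem_leaves.1 hQ).2.1

theorem child_mem (hD : F.IsLower D) (hQ : Q ∈ D) (hC : C ∈ F.children Q) :
    C ∈ D ∨ C ∈ F.leaves D := by
  by_cases h : C ∈ D
  · exact Or.inl h
  · refine Or.inr (hD.mem_leaves.2 ⟨((hD.isNode Q hQ).children hC).1, h, fun P hP hCP => ?_⟩)
    rwa [hP.parent_unique (hD.isNode Q hQ) hCP hC]

theorem ancestor_mem (hD : F.IsLower D) (hQ : Q ∈ D) (hA : F.IsNode A) (hl : A.level ≤ Q.level)
    (hw : Q.Within A) : A ∈ D := by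
  obtain ⟨n, hn⟩ := Nat.exists_eq_add_of_le hl
  induction n generalizing Q with
  | zero =>
    rwa [hA.eq_of_within (hD.isNode Q hQ) (by omega) (hD.isNode Q hQ) hw (Prism.Within.refl Q)]
  | succ n ih =>
    have hQn := hD.isNode Q hQ
    obtain ⟨P, hP, hQP⟩ := hQn.exists_parent (by omega)
    have hPl := level_of_mem_children hQP
    exact ih (hD.parent_mem Q hQ P hP hQP) (by omega)
      (hP.within_of_within hA (by omega) hQn (hP.children hQP).2 hw) (by omega)

theorem ancestor_mem_of_mem_leaves (hD : F.IsLower D) (hQ : Q ∈ F.leaves D) (hA : F.IsNode A)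
    (hl : A.level < Q.level) (hw : Q.Within A) : A ∈ D := by
  obtain ⟨hQn, -, hpar⟩ := hD.mem_leaves.1 hQ
  obtain ⟨P, hP, hQP⟩ := hQn.exists_parent (by omega)
  have hPl := level_of_mem_children hQP
  exact hD.ancestor_mem (hpar P hP hQP) hA (by omega)
    (hP.within_of_within hA (by omega) hQn (hP.children hQP).2 hw)

theorem eq_of_mem_leaves (hD : F.IsLower D) (hQ : Q ∈ F.leaves D) (hA : A ∈ F.leaves D)
    (hX : F.IsNode X) (h1 : X.Within Q) (h2 : X.Within A) : Q = A := by
  wlog hl : A.level ≤ Q.level generalizing Q A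
  · exact (this hA hQ h2 h1 (by omega)).symm
  have hQn := hD.isNode_of_mem_leaves hQ
  have hAn := hD.isNode_of_mem_leaves hA
  rcases hl.lt_or_eq with hl | hl
  · exact absurd (hD.ancestor_mem_of_mem_leaves hQ hAn hl
      (hQn.within_of_within hAn hl.le hX h1 h2)) (hD.notMem_of_mem_leaves hA)
  · exact hQn.eq_of_within hAn hl.symm hX h1 h2

/-- A node that has not been split is contained in a leaf. -/
theorem exists_leaf_above (hD : F.IsLower D) (hR : F.IsNode R) :
    R ∈ D ∨ ∃ A ∈ F.leaves D, A.level ≤ R.level ∧ R.Within A := by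
  induction hl : R.level generalizing R with
  | zero =>
    by_cases h : R ∈ D
    · exact Or.inl h
    · refine Or.inr ⟨R, hD.mem_leaves.2 ⟨hR, h, fun P _ hRP => ?_⟩, hl.le, Prism.Within.refl R⟩
      have := level_of_mem_children hRP
      omega
  | succ n ih =>
    obtain ⟨P, hP, hRP⟩ := hR.exists_parent (by omega)
    have hPl := level_of_mem_children hRP
    rcases ih hP (by omega) with h | ⟨A, hA, hAl, hPA⟩
    · rcases hD.child_mem h hRP with h | h
      · exact Or.inl h
      · exact Or.inr ⟨R, h, hl.le, Prism.Within.refl R⟩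
    · exact Or.inr ⟨A, hA, by omega, (hP.children hRP).2.trans hPA⟩

/-- From a split prism, a hereditary property leads down to a leaf. -/
theorem exists_leaf_below (hD : F.IsLower D) (p : Prism d → Prop)
    (hp : ∀ X, F.IsNode X → p X → ∃ C ∈ F.children X, p C) (hQ : Q ∈ D) (hpQ : p Q) :
    ∃ L ∈ F.leaves D, Q.level < L.level ∧ p L := by
  induction hn : D.sup Prism.level - Q.level generalizing Q with
  | zero =>
    obtain ⟨C, hC, hpC⟩ := hp Q (hD.isNode Q hQ) hpQ
    have hCl := level_of_mem_children hC
    rcases hD.child_mem hQ hC with h | h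
    · have : C.level ≤ D.sup Prism.level := Finset.le_sup (f := Prism.level) h
      omega
    · exact ⟨C, h, by omega, hpC⟩
  | succ n ih =>
    obtain ⟨C, hC, hpC⟩ := hp Q (hD.isNode Q hQ) hpQ
    have hCl := level_of_mem_children hC
    rcases hD.child_mem hQ hC with h | h
    · obtain ⟨L, hL, hlt, hpL⟩ := ih h hpC (by omega)
      exact ⟨L, hL, by omega, hpL⟩
    · exact ⟨C, h, by omega, hpC⟩

theorem union [DecidableEq (Prism d)] (hD : F.IsLower D) (hK : K ⊆ F.leaves D) :
    F.IsLower (D ∪ K) := by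
  constructor
  · intro Q hQ
    rcases Finset.mem_union.1 hQ with h | h
    · exact hD.isNode Q h
    · exact hD.isNode_of_mem_leaves (hK h)
  · intro Q hQ P hP hQP
    apply Finset.mem_union_left
    rcases Finset.mem_union.1 hQ with h | h
    · exact hD.parent_mem Q h P hP hQP
    · exact (hD.mem_leaves.1 (hK h)).2.2 P hP hQP

theorem leaves_union [DecidableEq (Prism d)] (hD : F.IsLower D) (hK : K ⊆ F.leaves D) :
    F.leaves (D ∪ K) = (F.leaves D \ K) ∪ K.biUnion F.children := by
  have key : ∀ Q ∈ K, ∀ C ∈ F.children Q, C ∉ D ∧ C ∉ K := by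
    intro Q hQ C hC
    have hQl := hD.mem_leaves.1 (hK hQ)
    exact ⟨fun h => hQl.2.1 (hD.parent_mem C h Q hQl.1 hC),
      fun h => hQl.2.1 ((hD.mem_leaves.1 (hK h)).2.2 Q hQl.1 hC)⟩
  ext C
  simp only [leaves, Finset.mem_sdiff, Finset.mem_union, Finset.mem_biUnion]
  constructor
  · rintro ⟨h | ⟨Q, hQ | hQ, hC⟩, h2⟩
    · left; exact ⟨⟨Or.inl h, by tauto⟩, by tauto⟩
    · left; exact ⟨⟨Or.inr ⟨Q, hQ, hC⟩, by tauto⟩, by tauto⟩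
    · right; exact ⟨Q, hQ, hC⟩
  · rintro (⟨⟨h | ⟨Q, hQ, hC⟩, h2⟩, h3⟩ | ⟨Q, hQ, hC⟩)
    · tauto
    · exact ⟨Or.inr ⟨Q, Or.inl hQ, hC⟩, by tauto⟩
    · have := key Q hQ C hC
      exact ⟨Or.inr ⟨Q, Or.inr hQ, hC⟩, by tauto⟩

theorem leaves_insert [DecidableEq (Prism d)] (hD : F.IsLower D) (hQ : Q ∈ F.leaves D) :
    F.IsLower (insert Q D) ∧ F.leaves (insert Q D) = (F.leaves D).erase Q ∪ F.children Q := by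
  have hK : {Q} ⊆ F.leaves D := by simpa using hQ
  have e : insert Q D = D ∪ {Q} := by ext; simp
  rw [e, hD.leaves_union hK]
  refine ⟨hD.union hK, ?_⟩
  simp [Finset.sdiff_singleton_eq_erase]

/-- Atomic splits amount to adding leaves to the set of split prisms. -/
theorem exists_of_splitsInto (hD : F.IsLower D) {k : ℕ} {P' : Finset (Prism d)}
    (h : SplitsInto F.s₁ F.s₂ k (F.leaves D) P') :
    ∃ D', F.IsLower D' ∧ D ⊆ D' ∧ P' = F.leaves D' ∧ D'.card = D.card + k := by
  classical
  generalize hP : F.leaves D = P at h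
  induction h with
  | refl P => exact ⟨D, hD, subset_rfl, hP.symm, rfl⟩
  | step h Q hQ ih =>
    obtain ⟨D', hD', hsub, rfl, hcard⟩ := ih hP
    obtain ⟨h1, h2⟩ := hD'.leaves_insert hQ
    refine ⟨insert Q D', h1, hsub.trans (Finset.subset_insert _ _), ?_, ?_⟩
    · rw [h2]
    · rw [Finset.card_insert_of_notMem (hD'.notMem_of_mem_leaves hQ), hcard, add_assoc]

theorem splitsInto (hD : F.IsLower D) (hD' : F.IsLower D') (hsub : D ⊆ D') {k : ℕ}
    (hk : D'.card = D.card + k) : SplitsInto F.s₁ F.s₂ k (F.leaves D) (F.leaves D') := by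
  classical
  induction k generalizing D' with
  | zero =>
    rw [Finset.eq_of_subset_of_card_le hsub (by omega)]
    exact SplitsInto.refl _
  | succ k ih =>
    have hne : (D' \ D).Nonempty := by
      rw [← Finset.card_pos, Finset.card_sdiff_of_subset hsub]; omega
    -- A prism of maximal level was split last.
    obtain ⟨Q, hQ, hmax⟩ := Finset.exists_max_image (D' \ D) Prism.level hne
    obtain ⟨hQ', hQD⟩ := Finset.mem_sdiff.1 hQ
    have hlow : F.IsLower (D'.erase Q) := by
      refine ⟨fun R hR => hD'.isNode R (Finset.mem_of_mem_erase hR), fun R hR P hP hRP => ?_⟩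
      have hR' := Finset.mem_of_mem_erase hR
      refine Finset.mem_erase.2 ⟨?_, hD'.parent_mem R hR' P hP hRP⟩
      rintro rfl
      have hl := level_of_mem_children hRP
      by_cases hRD : R ∈ D
      · exact hQD (hD.parent_mem R hRD _ hP hRP)
      · have := hmax R (Finset.mem_sdiff.2 ⟨hR', hRD⟩)
        omega
    have hleaf : Q ∈ F.leaves (D'.erase Q) := by
      refine hlow.mem_leaves.2 ⟨hD'.isNode Q hQ', by simp, fun P hP hQP => ?_⟩
      refine Finset.mem_erase.2 ⟨?_, hD'.parent_mem Q hQ' P hP hQP⟩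
      rintro rfl
      have := level_of_mem_children hQP
      omega
    have h1 := ih hlow (fun R hR => Finset.mem_erase.2 ⟨fun e => hQD (e ▸ hR), hsub hR⟩)
      (by rw [Finset.card_erase_of_mem hQ']; omega)
    have h2 := SplitsInto.step h1 Q hleaf
    have h3 := (hlow.leaves_insert hleaf).2
    rw [Finset.insert_erase hQ'] at h3
    rwa [h3]

end IsLower

end PrismForest

namespace PrismForest

variable {d : ℕ} {F : PrismForest d} {Q Q' R A P X C L : Prism d} {D D' : Finset (Prism d)} {ℓ : ℕ}

/-! ### Dependencies between splits -/

/-- Splitting `Q` requires splitting the next coarser neighbour `R` in time. -/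
def DepTime (Q R : Prism d) : Prop :=
  R.level + 1 = Q.level ∧ Q.time.Adjacent R.time ∧ Q.space.carrier ⊆ R.space.carrier

/-- Splitting `Q` requires splitting the prism `R` of the same level, with the same time interval
and the same refinement edge. The edge is represented by its midpoint, which determines it among
the simplices of a level. -/
def DepEdge (Q R : Prism d) : Prop :=
  R.level = Q.level ∧ R.time = Q.time ∧ R.space.newVertex = Q.space.newVertex

/-- For `d = 1`: splitting `Q` requires splitting the next coarser neighbour `R` in space. -/
def DepSpace (Q R : Prism d) : Prop :=
  R.level + 1 = Q.level ∧ Q.time.carrier ⊆ R.time.carrier ∧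
    (Q.space.carrier ∩ R.space.carrier).ncard = 1

/-- Splitting `Q` requires splitting `R`. -/
def Dep (Q R : Prism d) : Prop := DepTime Q R ∨ DepEdge Q R ∨ (d = 1 ∧ DepSpace Q R)

/-- Sets of split prisms that contain all prisms on which their elements depend. They correspond to
the admissible partitions. -/
structure IsSaturated (F : PrismForest d) (D : Finset (Prism d)) : Prop where
  isLower : F.IsLower D
  dep_mem : ∀ Q ∈ D, ∀ R, F.IsNode R → Dep Q R → R ∈ D

theorem IsNode.convexDim_inter_eq_iff (hQ : F.IsNode Q) (hR : F.IsNode R) (hl : R.level ≤ Q.level) :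
    convexDim (Q.space.carrier ∩ R.space.carrier) = d ↔ Q.space.carrier ⊆ R.space.carrier :=
  F.isBisectionForest.convexDim_inter_eq_iff hQ.1 hR.1 hl

theorem IsNode.timeAdjacent_iff (hQ : F.IsNode Q) (hR : F.IsNode R) :
    Q.TimeAdjacent R ↔ Q.time.Adjacent R.time :=
  TimeInterval.ncard_closure_inter_eq_one_iff hQ.left_lt_right hR.left_lt_right

theorem IsNode.timeOverlap_iff (hQ : F.IsNode Q) (hR : F.IsNode R) :
    Q.TimeOverlap R ↔ (Q.time.carrier ∩ R.time.carrier).Nonempty :=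
  F.isIntervalForest.volume_inter_pos_iff hQ.2 hR.2

theorem IsNode.timeOverlap_iff_subset (hQ : F.IsNode Q) (hR : F.IsNode R) (hl : R.level ≤ Q.level) :
    Q.TimeOverlap R ↔ Q.time.carrier ⊆ R.time.carrier := by
  rw [hQ.timeOverlap_iff hR]
  constructor
  · rintro ⟨s, hs, hs'⟩
    exact F.isIntervalForest.subset_of_mem hR.2 hQ.2 (F.generation_mono hl) hs' hs
  · intro h
    obtain ⟨s, hs⟩ := F.isIntervalForest.carrier_nonempty hQ.2
    exact ⟨s, hs, h hs⟩

theorem ends_mem_carrier (Q : Prism d) : Q.space.v 0 ∈ Q.space.carrier ∧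
    Q.space.v d ∈ Q.space.carrier :=
  ⟨subset_convexHull _ _ (Q.space.v_mem_vertices _),
    subset_convexHull _ _ (Q.space.v_mem_vertices _)⟩

theorem exists_depEdge_within (hQ : F.IsNode Q) (hA : F.IsNode A) (hl : A.level ≤ Q.level)
    (ht : Q.time.carrier ⊆ A.time.carrier) (hm : Q.space.newVertex ∈ A.space.carrier) :
    ∃ R, F.IsNode R ∧ DepEdge Q R ∧ R.Within A := by
  obtain ⟨B, hB, hBA, hBm⟩ :=
    F.isBisectionForest.exists_descendant_newVertex_eq hQ.1 hA.1 hl hm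
  obtain ⟨h1, h2⟩ := IsNode.of_mem hB hQ.2
  exact ⟨_, h1, ⟨h2, rfl, hBm⟩, ht, hBA⟩

/-! ### Admissible partitions have saturated sets of split prisms -/

theorem vertices_subset_of_mem_bisect {S : TaggedSimplex d} (hS : S ∈ F.space ℓ)
    {x : EuclideanSpace ℝ (Fin d)} (hx : x ∈ S.vertices) :
    ∃ C ∈ S.bisect, x ∈ C.vertices := by
  have hd := F.isBisectionForest.one_le
  rw [S.vertices_eq] at hx
  rcases hx with rfl | rfl | hx
  · exact ⟨_, mem_bisect.2 (Or.inl rfl), by simp [child₀_vertices hd]⟩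
  · exact ⟨_, mem_bisect.2 (Or.inr rfl),
      by simp [child₁_vertices hd (F.isBisectionForest.type_lt hS)]⟩
  · exact ⟨_, mem_bisect.2 (Or.inl rfl), by simp [child₀_vertices hd, hx]⟩

section Admissible

variable {T : ℝ}

theorem dep_mem_of_depEdge (hD : F.IsLower D)
    (hadm : IsAdmissible F.s₁ F.s₂ T F.domain F.roots (F.leaves D)) (hQ : Q ∈ D) (hR : F.IsNode R)
    (h : DepEdge Q R) : R ∈ D := by
  obtain ⟨hl, ht, hm⟩ := h
  have hQn := hD.isNode Q hQ
  have hd := F.isBisectionForest.one_le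
  rcases hD.exists_leaf_above hR with hRD | ⟨A, hA, hAl, hRA⟩
  · exact hRD
  exfalso
  have hAn := hD.isNode_of_mem_leaves hA
  have hlt := hQn.left_lt_right
  -- Below `Q` there is a leaf that has the midpoint of the refinement edge as a vertex.
  obtain ⟨L, hL, hLl, hLt, hLm⟩ := hD.exists_leaf_below
    (fun X => Q.time.left ∈ X.time.carrier ∧ (X = Q ∨ Q.space.newVertex ∈ X.space.vertices))
    (by
      rintro X hX ⟨hXt, hXm⟩
      obtain ⟨I, hI, hsI⟩ := F.isIntervalForest.exists_mem_bisectIter_of_mem hX.2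
        (F.generation (X.level + 1) - F.generation X.level) hXt
      rcases hXm with rfl | hXm
      · exact ⟨⟨I, X.space.child₀⟩, mem_children.2 ⟨hI, mem_bisect.2 (Or.inl rfl)⟩, hsI,
          Or.inr (by
            change X.space.newVertex ∈ X.space.child₀.vertices
            rw [child₀_vertices hd]
            simp)⟩
      · obtain ⟨B, hB, hmB⟩ := vertices_subset_of_mem_bisect hX.1 hXm
        exact ⟨⟨I, B⟩, mem_children.2 ⟨hI, hB⟩, hsI, Or.inr hmB⟩)
    hQ ⟨TimeInterval.left_mem hlt, Or.inl rfl⟩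
  rcases hLm with rfl | hLm
  · omega
  have hLn := hD.isNode_of_mem_leaves hL
  have hmR : Q.space.newVertex ∈ R.space.carrier :=
    hm ▸ F.isBisectionForest.newVertex_mem hR.1
  have hmA := hRA.2 hmR
  have hmL : Q.space.newVertex ∈ L.space.carrier := subset_convexHull _ _ hLm
  have hA' := F.isBisectionForest.isSimplexSet hAn.1
  have hL' := F.isBisectionForest.isSimplexSet hLn.1
  have hAt : Q.time.left ∈ A.time.carrier := hRA.1 (by rw [ht]; exact TimeInterval.left_mem hlt)
  have htT : Q.time.left ∈ Set.Icc 0 T := by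
    have : (Q.time.left, Q.space.newVertex) ∈ Set.Icc 0 T ×ˢ closure F.domain := by
      rw [← hadm.covering]
      exact Set.mem_biUnion hA ⟨hAt, hmA⟩
    exact this.1
  -- By conformity it is then a vertex of the leaf above `R`, too.
  have hmV : Q.space.newVertex ∈ A.space.vertices := by
    rcases hadm.conforming_in_space _ htT L.space ⟨L, hL, hLt, rfl⟩ A.space ⟨A, hA, hAt, rfl⟩ with
      h | h | ⟨⟨W, -, hW, hLW⟩, W', -, hW', hAW'⟩
    · exact hL'.indep.subset_of_convexHull_eq subset_rfl h hLm
    · have : Q.space.newVertex ∈ L.space.carrier ∩ A.space.carrier := ⟨hmL, hmA⟩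
      rw [h] at this
      exact absurd this (Set.notMem_empty _)
    · have h1 : Q.space.newVertex ∈ convexHull ℝ W := hLW ▸ ⟨hmL, hmA⟩
      have h2 := hL'.indep.mem_of_mem_convexHull hW.subset hLm h1
      exact hW'.subset (hL'.indep.subset_of_convexHull_eq hW.subset (hLW.symm.trans hAW') h2)
  -- But it is the midpoint of a segment in that leaf.
  have hext := hA'.indep.mem_extremePoints hmV
  rw [_root_.mem_extremePoints] at hext
  have hends := ends_mem_carrier R
  have hopen : Q.space.newVertex ∈ openSegment ℝ (R.space.v 0) (R.space.v d) := by
    rw [← hm, newVertex]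
    exact ⟨1 / 2, 1 / 2, by norm_num, by norm_num, by norm_num, by
      rw [midpoint_eq_smul_add]; simp only [invOf_eq_inv]; module⟩
  obtain ⟨e1, e2⟩ := hext.2 _ (hRA.2 hends.1) _ (hRA.2 hends.2) hopen
  exact F.isBisectionForest.ne_ends hR.1 (e1.trans e2.symm)

theorem dep_mem_of_depTime (hD : F.IsLower D)
    (hadm : IsAdmissible F.s₁ F.s₂ T F.domain F.roots (F.leaves D)) (hQ : Q ∈ D) (hR : F.IsNode R)
    (h : DepTime Q R) : R ∈ D := by
  obtain ⟨hl, ht, hs⟩ := h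
  have hQn := hD.isNode Q hQ
  rcases hD.exists_leaf_above hR with hRD | ⟨A, hA, hAl, hRA⟩
  · exact hRD
  exfalso
  have hAn := hD.isNode_of_mem_leaves hA
  obtain ⟨L, hL, hLl, hLt, hLs⟩ := hD.exists_leaf_below
    (fun X => X.time.Adjacent R.time ∧ X.space.carrier ⊆ Q.space.carrier)
    (by
      rintro X hX ⟨hXt, hXs⟩
      obtain ⟨I, hI, hsI⟩ := TimeInterval.exists_adjacent X.time
        (F.generation (X.level + 1) - F.generation X.level) hXt
      have hB : X.space.child₀ ∈ X.space.bisect := mem_bisect.2 (Or.inl rfl)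
      exact ⟨⟨I, _⟩, mem_children.2 ⟨hI, hB⟩, hsI,
        (F.isBisectionForest.carrier_subset hX.1 hB).trans hXs⟩)
    hQ ⟨ht, subset_rfl⟩
  have hLn := hD.isNode_of_mem_leaves hL
  have hLA : L.space.carrier ⊆ A.space.carrier := hLs.trans (hs.trans hRA.2)
  have hdis : A.time.carrier ∩ L.time.carrier = ∅ := by
    rw [← Set.not_nonempty_iff_eq_empty]
    rintro ⟨s, hsA, hsL⟩
    have hw : L.Within A :=
      ⟨F.isIntervalForest.subset_of_mem hAn.2 hLn.2 (F.generation_mono (by omega)) hsA hsL, hLA⟩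
    have := hD.eq_of_mem_leaves hL hA hLn (Prism.Within.refl L) hw
    subst this
    omega
  have hadj := hLt.symm.of_subset hAn.left_lt_right hR.left_lt_right hLn.left_lt_right hRA.1 hdis
  have := hadm.irregular_in_time L hL A hA ⟨(hLn.timeAdjacent_iff hAn).2 hadj.symm,
    (hLn.convexDim_inter_eq_iff hAn (by omega)).2 hLA⟩
  omega

theorem dep_mem_of_depSpace (hd : d = 1) (hD : F.IsLower D)
    (hadm : IsAdmissible F.s₁ F.s₂ T F.domain F.roots (F.leaves D)) (hQ : Q ∈ D) (hR : F.IsNode R)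
    (h : DepSpace Q R) : R ∈ D := by
  obtain ⟨hl, ht, hs⟩ := h
  have hQn := hD.isNode Q hQ
  rcases hD.exists_leaf_above hR with hRD | ⟨A, hA, hAl, hRA⟩
  · exact hRD
  exfalso
  have hAn := hD.isNode_of_mem_leaves hA
  obtain ⟨x, hx⟩ := Set.ncard_eq_one.1 hs
  have hxQR : x ∈ Q.space.carrier ∩ R.space.carrier := by rw [hx]; rfl
  obtain ⟨L, hL, hLl, hLx, hLt, hLs⟩ := hD.exists_leaf_below
    (fun X => x ∈ X.space.carrier ∧ X.Within Q)
    (by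
      rintro X hX ⟨hXx, hXQ⟩
      obtain ⟨C, hC, -, hxC⟩ := hX.exists_child (TimeInterval.left_mem hX.left_lt_right) hXx
      exact ⟨C, hC, hxC, (hX.children hC).2.trans hXQ⟩)
    hQ ⟨hxQR.1, Prism.Within.refl Q⟩
  have hLn := hD.isNode_of_mem_leaves hL
  have hnot : ¬Q.space.carrier ⊆ A.space.carrier := fun hsub =>
    hD.notMem_of_mem_leaves hA (hD.ancestor_mem hQ hAn (by omega) ⟨ht.trans hRA.1, hsub⟩)
  have hsing := F.isBisectionForest.inter_subsingleton hd hQn.1 hAn.1 (by omega) hnot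
  have hcard : (L.space.carrier ∩ A.space.carrier).ncard = 1 := by
    rw [Set.ncard_eq_one]
    refine ⟨x, (hsing.anti (Set.inter_subset_inter_left _ hLs)).eq_singleton_of_mem
      ⟨hLx, hRA.2 hxQR.2⟩⟩
  have := hadm.irregular_in_space hd L hL A hA
    ⟨(hLn.timeOverlap_iff_subset hAn (by omega)).2 (hLt.trans (ht.trans hRA.1)), hcard⟩
  omega

theorem isSaturated_of_isAdmissible (hD : F.IsLower D)
    (hadm : IsAdmissible F.s₁ F.s₂ T F.domain F.roots (F.leaves D)) : F.IsSaturated D := by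
  refine ⟨hD, fun Q hQ R hR h => ?_⟩
  rcases h with h | h | ⟨hd, h⟩
  · exact dep_mem_of_depTime hD hadm hQ hR h
  · exact dep_mem_of_depEdge hD hadm hQ hR h
  · exact dep_mem_of_depSpace hd hD hadm hQ hR h

/-! ### Saturated sets yield admissible partitions -/

/-- Two leaves that meet at a time have simplices that meet in a common face. -/
theorem IsSaturated.inter_subset (hD : F.IsSaturated D) (hQ' : Q' ∈ F.leaves D) {t : ℝ}
    (ht' : t ∈ Q'.time.carrier) {n : ℕ} (hX : F.IsNode X) (hXD : X ∈ D ∨ X ∈ F.leaves D)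
    (ht : t ∈ X.time.carrier) (hn : X.level = Q'.level + n) :
    X.space.carrier ∩ Q'.space.carrier ⊆ convexHull ℝ (X.space.vertices ∩ Q'.space.vertices) := by
  have hQn := hD.isLower.isNode_of_mem_leaves hQ'
  have hd := F.isBisectionForest.one_le
  induction n generalizing X with
  | zero =>
    refine F.isBisectionForest.inter_subset hX.1 ?_
    rw [hn]; exact hQn.1
  | succ n ih =>
    obtain ⟨Y, hY, hXY⟩ := hX.exists_parent (by omega)
    have hYl := level_of_mem_children hXY
    have hYD : Y ∈ D := by
      rcases hXD with h | h
      · exact hD.isLower.parent_mem X h Y hY hXY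
      · exact (hD.isLower.mem_leaves.1 h).2.2 Y hY hXY
    have hXw := (hY.children hXY).2
    have htY := hXw.1 ht
    have hYind := F.isBisectionForest.indep hY.1
    have ih' := ih hY (Or.inl hYD) htY (by omega)
    have hm : Y.space.newVertex ∉ Q'.space.carrier := by
      intro hm
      have htsub :=
        F.isIntervalForest.subset_of_mem hQn.2 hY.2 (F.generation_mono (by omega)) ht' htY
      obtain ⟨R, hR, hYR, hRQ⟩ := exists_depEdge_within hY hQn (by omega) htsub hm
      have hRD := hD.dep_mem Y hYD R hR (Or.inr (Or.inl hYR))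
      exact hD.isLower.notMem_of_mem_leaves hQ'
        (hD.isLower.ancestor_mem hRD hQn (by rw [hYR.1]; omega) hRQ)
    obtain ⟨a, b, hh⟩ := exists_isHalf hd hYind (F.isBisectionForest.type_lt hY.1)
      (mem_children.1 hXY).2
    rintro z ⟨hzX, hzQ⟩
    have hz1 : z ∈ convexHull ℝ (insert a (insert (midpoint ℝ a b) Y.space.innerVertices)) := by
      rw [← hh.newVertex_eq, ← hh.vertices_eq]; exact hzX
    have hz2 := hh.split.half_inter_face_subset
      (W := Y.space.vertices ∩ Q'.space.vertices) Set.inter_subset_left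
      (by
        rintro ⟨ha, hb⟩
        apply hm
        rw [hh.newVertex_eq]
        exact (convex_convexHull ℝ _).midpoint_mem (subset_convexHull _ _ ha.2)
          (subset_convexHull _ _ hb.2))
      ⟨hz1, ih' ⟨hXw.2 hzX, hzQ⟩⟩
    rw [← hh.newVertex_eq, ← hh.vertices_eq] at hz2
    refine convexHull_mono ?_ hz2
    rintro u ⟨⟨-, hu⟩, hu'⟩
    exact ⟨hu', hu⟩

theorem IsSaturated.inter_subset_of_mem_leaves (hD : F.IsSaturated D) (hQ : Q ∈ F.leaves D)
    (hQ' : Q' ∈ F.leaves D) {t : ℝ} (ht : t ∈ Q.time.carrier) (ht' : t ∈ Q'.time.carrier) :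
    Q.space.carrier ∩ Q'.space.carrier ⊆ convexHull ℝ (Q.space.vertices ∩ Q'.space.vertices) := by
  wlog hl : Q'.level ≤ Q.level generalizing Q Q'
  · rw [Set.inter_comm, Set.inter_comm Q.space.vertices]
    exact this hQ' hQ ht' ht (by omega)
  obtain ⟨n, hn⟩ := Nat.exists_eq_add_of_le hl
  exact hD.inter_subset hQ' ht' (hD.isLower.isNode_of_mem_leaves hQ) (Or.inr hQ) ht hn

theorem IsSaturated.conforming (hD : F.IsSaturated D) (t : ℝ) :
    Conforming (activeTriangulation t (F.leaves D)) := by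
  rintro S ⟨Q, hQ, ht, rfl⟩ S' ⟨Q', hQ', ht', rfl⟩
  have hc := F.isBisectionForest.ncard_vertices (hD.isLower.isNode_of_mem_leaves hQ).1
  have hc' := F.isBisectionForest.ncard_vertices (hD.isLower.isNode_of_mem_leaves hQ').1
  have hf := (F.isBisectionForest.isSimplexSet (hD.isLower.isNode_of_mem_leaves hQ).1).finite
  have hf' := (F.isBisectionForest.isSimplexSet (hD.isLower.isNode_of_mem_leaves hQ').1).finite
  have heq : Q.space.carrier ∩ Q'.space.carrier =
      convexHull ℝ (Q.space.vertices ∩ Q'.space.vertices) :=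
    subset_antisymm (hD.inter_subset_of_mem_leaves hQ hQ' ht ht')
      (Set.subset_inter (convexHull_mono Set.inter_subset_left)
        (convexHull_mono Set.inter_subset_right))
  by_cases hV : Q.space.vertices = Q'.space.vertices
  · left; rw [carrier, carrier, hV]
  right
  rcases (Q.space.vertices ∩ Q'.space.vertices).eq_empty_or_nonempty with he | hne
  · left; rw [heq, he, convexHull_empty]
  right
  refine ⟨⟨_, hne, ⟨Set.inter_subset_left, fun h => hV ?_⟩, heq⟩,
    ⟨_, hne, ⟨Set.inter_subset_right, fun h => hV ?_⟩, heq⟩⟩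
  · exact Set.eq_of_subset_of_ncard_le (h.trans Set.inter_subset_right) (by omega) hf'
  · exact (Set.eq_of_subset_of_ncard_le (h.trans Set.inter_subset_left) (by omega) hf).symm

theorem IsLower.iUnion_leaves (hD : F.IsLower D) :
    ⋃ Q ∈ F.leaves D, Q.carrier = ⋃ Q ∈ F.roots, Q.carrier := by
  apply subset_antisymm
  · refine Set.iUnion₂_subset fun Q hQ => ?_
    obtain ⟨A, hA, hAl, hQA⟩ := (hD.isNode_of_mem_leaves hQ).exists_ancestor (Nat.zero_le _)
    exact (Set.prod_mono hQA.1 hQA.2).trans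
      (Set.subset_biUnion_of_mem (u := Prism.carrier) (mem_roots.2 ⟨hA, hAl⟩))
  · refine Set.iUnion₂_subset fun Q hQ => ?_
    obtain ⟨hQn, hQl⟩ := mem_roots.1 hQ
    rintro ⟨s, x⟩ ⟨hs, hx⟩
    by_cases hQD : Q ∈ D
    · obtain ⟨L, hL, -, hsL, hxL⟩ := hD.exists_leaf_below
        (fun X => s ∈ X.time.carrier ∧ x ∈ X.space.carrier)
        (fun X hX h => hX.exists_child h.1 h.2) hQD ⟨hs, hx⟩
      exact Set.mem_biUnion hL ⟨hsL, hxL⟩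
    · refine Set.mem_biUnion (hD.mem_leaves.2 ⟨hQn, hQD, fun P hP hQP => ?_⟩) ⟨hs, hx⟩
      have := level_of_mem_children hQP
      omega

theorem IsLower.nonoverlapping (hD : F.IsLower D) (hQ : Q ∈ F.leaves D) (hQ' : Q' ∈ F.leaves D)
    (hne : Q ≠ Q') : Disjoint (interior Q.carrier) (interior Q'.carrier) := by
  wlog hl : Q'.level ≤ Q.level generalizing Q Q'
  · exact (this hQ' hQ hne.symm (by omega)).symm
  rw [Set.disjoint_left]
  intro z hz hz'
  have hQn := hD.isNode_of_mem_leaves hQ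
  have hQn' := hD.isNode_of_mem_leaves hQ'
  apply hne
  refine hD.eq_of_mem_leaves hQ hQ' hQn (Prism.Within.refl Q) ⟨?_, ?_⟩
  · exact F.isIntervalForest.subset_of_mem hQn'.2 hQn.2 (F.generation_mono hl)
      (interior_subset hz').1 (interior_subset hz).1
  · rw [← hQn.convexDim_inter_eq_iff hQn' hl]
    rw [Prism.carrier, interior_prod_eq] at hz hz'
    have hint : (interior (Q.space.carrier ∩ Q'.space.carrier)).Nonempty := by
      rw [interior_inter]; exact ⟨z.2, hz.2, hz'.2⟩
    have hspan := affineSpan_eq_top_of_nonempty_interior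
      (hint.mono (interior_mono (subset_convexHull ℝ _)))
    rw [convexDim, AffineSubspace.vectorSpan_eq_top_of_affineSpan_eq_top ℝ _ _ hspan, finrank_top]
    simp

theorem IsSaturated.irregular_in_time (hD : F.IsSaturated D) (hQ : Q ∈ F.leaves D)
    (hQ' : Q' ∈ F.leaves D) (h : Q.TouchInTime Q') : Q.level ≤ Q'.level + 1 := by
  by_contra hlt
  obtain ⟨h1, h2⟩ := h
  have hQn := hD.isLower.isNode_of_mem_leaves hQ
  have hQn' := hD.isLower.isNode_of_mem_leaves hQ'
  rw [hQn.timeAdjacent_iff hQn'] at h1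
  rw [hQn.convexDim_inter_eq_iff hQn' (by omega)] at h2
  obtain ⟨X, hX, hXl, hQX⟩ := hQn.exists_ancestor (j := Q'.level + 1) (by omega)
  have hXD := hD.isLower.ancestor_mem_of_mem_leaves hQ hX (by omega) hQX
  have hXs := F.isBisectionForest.subset_of_subset hX.1 hQn'.1 (by omega) hQn.1 hQX.2 h2
  have hdis : X.time.carrier ∩ Q'.time.carrier = ∅ := by
    rw [← Set.not_nonempty_iff_eq_empty]
    rintro ⟨s, hs, hs'⟩
    have := F.isIntervalForest.subset_of_mem hQn'.2 hX.2 (F.generation_mono (by omega)) hs' hs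
    exact h1.symm.not_subset hQn'.left_lt_right hQn.left_lt_right (hQX.1.trans this)
  have hadj := h1.of_subset hX.left_lt_right hQn.left_lt_right hQn'.left_lt_right hQX.1 hdis
  exact hD.isLower.notMem_of_mem_leaves hQ'
    (hD.dep_mem X hXD Q' hQn' (Or.inl ⟨hXl.symm, hadj, hXs⟩))

theorem IsSaturated.irregular_in_space (hd : d = 1) (hD : F.IsSaturated D) (hQ : Q ∈ F.leaves D)
    (hQ' : Q' ∈ F.leaves D) (h : Q.TouchInSpace Q') : Q.level ≤ Q'.level + 1 := by
  by_contra hlt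
  obtain ⟨h1, h2⟩ := h
  have hQn := hD.isLower.isNode_of_mem_leaves hQ
  have hQn' := hD.isLower.isNode_of_mem_leaves hQ'
  rw [hQn.timeOverlap_iff_subset hQn' (by omega)] at h1
  obtain ⟨X, hX, hXl, hQX⟩ := hQn.exists_ancestor (j := Q'.level + 1) (by omega)
  have hXD := hD.isLower.ancestor_mem_of_mem_leaves hQ hX (by omega) hQX
  obtain ⟨s, hs⟩ := F.isIntervalForest.carrier_nonempty hQn.2
  have hXt := F.isIntervalForest.subset_of_mem hQn'.2 hX.2 (F.generation_mono (by omega))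
    (h1 hs) (hQX.1 hs)
  obtain ⟨x, hx⟩ := Set.ncard_eq_one.1 h2
  have hxQ : x ∈ Q.space.carrier ∩ Q'.space.carrier := by rw [hx]; rfl
  have hnot : ¬X.space.carrier ⊆ Q'.space.carrier := fun hsub =>
    hD.isLower.notMem_of_mem_leaves hQ'
      (hD.isLower.ancestor_mem hXD hQn' (by omega) ⟨hXt, hsub⟩)
  have hsing := F.isBisectionForest.inter_subsingleton hd hX.1 hQn'.1 (by omega) hnot
  have hcard : (X.space.carrier ∩ Q'.space.carrier).ncard = 1 :=
    Set.ncard_eq_one.2 ⟨x, hsing.eq_singleton_of_mem ⟨hQX.2 hxQ.1, hxQ.2⟩⟩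
  exact hD.isLower.notMem_of_mem_leaves hQ'
    (hD.dep_mem X hXD Q' hQn' (Or.inr (Or.inr ⟨hd, hXl.symm, hXt, hcard⟩)))

theorem IsSaturated.isAdmissible (hD : F.IsSaturated D)
    (hcov : ⋃ Q ∈ F.roots, Q.carrier = Set.Icc 0 T ×ˢ closure F.domain) :
    IsAdmissible F.s₁ F.s₂ T F.domain F.roots (F.leaves D) where
  obtained := ⟨D.card, by
    have := isLower_empty.splitsInto hD.isLower (Finset.empty_subset D) (k := D.card) (by simp)
    rwa [leaves_empty] at this⟩
  covering := hD.isLower.iUnion_leaves.trans hcov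
  nonoverlapping Q hQ Q' hQ' hne := hD.isLower.nonoverlapping hQ hQ' hne
  conforming_in_space t _ := hD.conforming t
  irregular_in_time Q hQ Q' hQ' h := hD.irregular_in_time hQ hQ' h
  irregular_in_space hd Q hQ Q' hQ' h := hD.irregular_in_space hd hQ hQ' h

end Admissible

/-! ### Neighbours and dependencies -/

theorem mem_timeNeighbours {N : Finset (Prism d)} : R ∈ Q.timeNeighbours N ↔
    R ∈ N ∧ R ≠ Q ∧ Q.TimeAdjacent R ∧ convexDim (Q.space.carrier ∩ R.space.carrier) = d ∧
      R.level + 1 = Q.level := by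
  classical
  simp [Prism.timeNeighbours]

theorem mem_spaceNeighbours (hd : 2 ≤ d) {N : Finset (Prism d)} : R ∈ Q.spaceNeighbours N ↔
    R ∈ N ∧ R ≠ Q ∧ Q.TimeOverlap R ∧ 1 ≤ convexDim (Q.space.carrier ∩ R.space.carrier) ∧
      convexDim (Q.space.carrier ∩ R.space.carrier) ≤ d - 1 ∧
      Q.space.refinementEdge ⊆ R.space.carrier := by
  classical
  simp [Prism.spaceNeighbours, hd]

theorem mem_spaceNeighbours_of_eq_one (hd : d = 1) {N : Finset (Prism d)} :
    R ∈ Q.spaceNeighbours N ↔ R ∈ N ∧ R ≠ Q ∧ Q.TimeOverlap R ∧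
      (Q.space.carrier ∩ R.space.carrier).ncard = 1 ∧ R.level + 1 = Q.level := by
  classical
  have : ¬2 ≤ d := by omega
  simp [Prism.spaceNeighbours, this]

theorem mem_neighbours {N : Finset (Prism d)} :
    R ∈ Q.neighbours N ↔ R ∈ Q.timeNeighbours N ∨ R ∈ Q.spaceNeighbours N := by
  classical
  simp [Prism.neighbours]

theorem mem_of_mem_neighbours {N : Finset (Prism d)} (h : R ∈ Q.neighbours N) : R ∈ N := by
  classical
  rcases mem_neighbours.1 h with h | h
  · exact (mem_timeNeighbours.1 h).1
  · unfold Prism.spaceNeighbours at h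
    split_ifs at h
    · exact (Finset.mem_filter.1 h).1
    · exact (Finset.mem_filter.1 h).1

theorem depTime_of_mem_timeNeighbours (hD : F.IsLower D) (hQ : F.IsNode Q)
    (hR : R ∈ Q.timeNeighbours (F.leaves D)) : DepTime Q R := by
  obtain ⟨hR, -, h1, h2, h3⟩ := mem_timeNeighbours.1 hR
  have hRn := hD.isNode_of_mem_leaves hR
  exact ⟨h3, (hQ.timeAdjacent_iff hRn).1 h1, (hQ.convexDim_inter_eq_iff hRn (by omega)).1 h2⟩

theorem depSpace_of_mem_spaceNeighbours (hd : d = 1) (hD : F.IsLower D) (hQ : F.IsNode Q)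
    (hR : R ∈ Q.spaceNeighbours (F.leaves D)) : DepSpace Q R := by
  obtain ⟨hR, -, h1, h2, h3⟩ := (mem_spaceNeighbours_of_eq_one hd).1 hR
  have hRn := hD.isNode_of_mem_leaves hR
  exact ⟨h3, (hQ.timeOverlap_iff_subset hRn (by omega)).1 h1, h2⟩

/-- A neighbour in space contains a prism with the same level and the same refinement edge. -/
theorem exists_depEdge_of_mem_spaceNeighbours (hd : 2 ≤ d) (hD : F.IsLower D) (hQ : F.IsNode Q)
    (hR : R ∈ Q.spaceNeighbours (F.leaves D)) :
    R.level ≤ Q.level ∧ ∃ X, F.IsNode X ∧ DepEdge Q X ∧ X.Within R := by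
  obtain ⟨hR, -, h1, -, -, h4⟩ := (mem_spaceNeighbours hd).1 hR
  have hRn := hD.isNode_of_mem_leaves hR
  have h0 : Q.space.v 0 ∈ R.space.carrier := h4 (left_mem_segment ℝ _ _)
  have h0' : Q.space.v d ∈ R.space.carrier := h4 (right_mem_segment ℝ _ _)
  have hl : R.level ≤ Q.level := F.isBisectionForest.level_le_of_ends_mem hQ.1 hRn.1 h0 h0'
  exact ⟨hl, exists_depEdge_within hQ hRn hl ((hQ.timeOverlap_iff_subset hRn hl).1 h1)
    ((convex_convexHull ℝ _).midpoint_mem h0 h0')⟩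

theorem mem_spaceNeighbours_of_within (hd : 2 ≤ d) (hD : F.IsLower D) (hQ : Q ∈ F.leaves D)
    (hX : F.IsNode X) (h : DepEdge Q X) (hA : A ∈ F.leaves D) (hl : A.level ≤ X.level)
    (hXA : X.Within A) (hne : A ≠ Q) : A ∈ Q.spaceNeighbours (F.leaves D) := by
  obtain ⟨hXl, hXt, hXm⟩ := h
  have hQn := hD.isNode_of_mem_leaves hQ
  have hAn := hD.isNode_of_mem_leaves hA
  have hsub : Q.time.carrier ⊆ A.time.carrier := hXt ▸ hXA.1
  obtain ⟨h0, h1⟩ := F.isBisectionForest.ends_mem_vertices hQn.1 (S' := X.space)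
    (by rw [← hXl]; exact hX.1) (by rw [← hXm]; exact F.isBisectionForest.newVertex_mem hX.1)
  have h0 : Q.space.v 0 ∈ A.space.carrier := hXA.2 (subset_convexHull _ _ h0)
  have h1 : Q.space.v d ∈ A.space.carrier := hXA.2 (subset_convexHull _ _ h1)
  obtain ⟨e0, e1⟩ := ends_mem_carrier Q
  refine (mem_spaceNeighbours hd).2 ⟨hA, hne, (hQn.timeOverlap_iff_subset hAn (by omega)).2 hsub,
    one_le_convexDim ⟨e0, h0⟩ ⟨e1, h1⟩ (F.isBisectionForest.ne_ends hQn.1), ?_,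
    (convex_convexHull ℝ _).segment_subset h0 h1⟩
  have hle := convexDim_le (Q.space.carrier ∩ A.space.carrier)
  by_contra hlt
  have hd' : convexDim (Q.space.carrier ∩ A.space.carrier) = d := by omega
  rw [hQn.convexDim_inter_eq_iff hAn (by omega)] at hd'
  exact hne (hD.eq_of_mem_leaves hA hQ hQn ⟨hsub, hd'⟩ (Prism.Within.refl Q))

theorem level_le_of_mem_neighbours (hD : F.IsLower D) (hQ : F.IsNode Q)
    (hR : R ∈ Q.neighbours (F.leaves D)) : R.level ≤ Q.level := by
  have hd := F.isBisectionForest.one_le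
  rcases mem_neighbours.1 hR with hR | hR
  · have := (depTime_of_mem_timeNeighbours hD hQ hR).1
    omega
  · rcases hd.eq_or_lt with hd | hd
    · have := (depSpace_of_mem_spaceNeighbours hd.symm hD hQ hR).1
      omega
    · exact (exists_depEdge_of_mem_spaceNeighbours hd hD hQ hR).1

theorem depEdge_of_mem_neighbours (hD : F.IsLower D) (hQ : F.IsNode Q)
    (hR : R ∈ Q.neighbours (F.leaves D)) (hl : R.level = Q.level) : DepEdge Q R := by
  have hRn := hD.isNode_of_mem_leaves (mem_of_mem_neighbours hR)
  have hd := F.isBisectionForest.one_le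
  rcases mem_neighbours.1 hR with hR | hR
  · have := (depTime_of_mem_timeNeighbours hD hQ hR).1
    omega
  · rcases hd.eq_or_lt with hd | hd
    · have := (depSpace_of_mem_spaceNeighbours hd.symm hD hQ hR).1
      omega
    · obtain ⟨-, X, hX, hQX, hXR⟩ := exists_depEdge_of_mem_spaceNeighbours hd hD hQ hR
      have hXl := hQX.1
      rwa [hRn.eq_of_within hX (by omega) hX hXR (Prism.Within.refl X)]

/-- Every refinement of the partition that splits `Q` also splits the neighbours of `Q`. -/
theorem IsSaturated.mem_of_mem_neighbours {D'' : Finset (Prism d)} (hD'' : F.IsSaturated D'')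
    (hD : F.IsLower D) (hQ : Q ∈ D'') (hR : R ∈ Q.neighbours (F.leaves D)) : R ∈ D'' := by
  have hQn := hD''.isLower.isNode Q hQ
  have hRn := hD.isNode_of_mem_leaves (PrismForest.mem_of_mem_neighbours hR)
  have hd := F.isBisectionForest.one_le
  rcases mem_neighbours.1 hR with hR | hR
  · exact hD''.dep_mem Q hQ R hRn (Or.inl (depTime_of_mem_timeNeighbours hD hQn hR))
  · rcases hd.eq_or_lt with hd | hd
    · exact hD''.dep_mem Q hQ R hRn
        (Or.inr (Or.inr ⟨hd.symm, depSpace_of_mem_spaceNeighbours hd.symm hD hQn hR⟩))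
    · obtain ⟨hl, X, hX, hQX, hXR⟩ := exists_depEdge_of_mem_spaceNeighbours hd hD hQn hR
      exact hD''.isLower.ancestor_mem (hD''.dep_mem Q hQ X hX (Or.inr (Or.inl hQX))) hRn
        (by rw [hQX.1]; exact hl) hXR

/-! ### Levels across hyperfaces -/

theorem DepEdge.symm (h : DepEdge Q R) : DepEdge R Q := ⟨h.1.symm, h.2.1.symm, h.2.2.symm⟩

/-- If `X` has been split, the leaves above the prisms that share a hyperface with `X` are at least
as fine as `X`. -/
theorem IsSaturated.level_le_of_mem (hd : 2 ≤ d) (hD : F.IsSaturated D) (hX : X ∈ D)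
    {S' : TaggedSimplex d} (hS' : S' ∈ F.space X.level)
    (hc : d ≤ (X.space.vertices ∩ S'.vertices).ncard) (hA : A ∈ F.leaves D)
    (hw : (⟨X.time, S'⟩ : Prism d).Within A) : X.level ≤ A.level := by
  by_contra hlt
  push Not at hlt
  have hXn := hD.isLower.isNode X hX
  have hAn := hD.isLower.isNode_of_mem_leaves hA
  have hAD := hD.isLower.notMem_of_mem_leaves hA
  obtain ⟨hXn', hXl'⟩ := IsNode.of_mem hS' hXn.2
  obtain ⟨Y, hY, hXY⟩ := hXn.exists_parent (by omega)
  have hYl := level_of_mem_children hXY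
  have hYD := hD.isLower.parent_mem X hX Y hY hXY
  rw [hYl] at hS'
  obtain ⟨Z, hZ, hS'Z⟩ := (F.isBisectionForest.mem_succ _ _).1 hS'
  obtain ⟨hYn', hYl'⟩ := IsNode.of_mem hZ hY.2
  have hXY' : (⟨X.time, S'⟩ : Prism d).Within ⟨Y.time, Z⟩ :=
    ⟨(hY.children hXY).2.1, F.isBisectionForest.carrier_subset hZ hS'Z⟩
  rcases F.isBisectionForest.newVertex_mem_or hd hY.1 hZ (mem_children.1 hXY).2 hS'Z hc with h | h
  · refine hAD (hD.isLower.ancestor_mem (hD.dep_mem Y hYD ⟨Y.time, Z⟩ hYn' (Or.inr (Or.inl ⟨hYl', rfl,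
      F.isBisectionForest.newVertex_eq hY.1 hZ h⟩))) hAn (by omega) ?_)
    exact hYn'.within_of_within hAn (by omega) hXn' hXY' hw
  · refine hAD (hD.isLower.ancestor_mem (hD.dep_mem X hX ⟨X.time, S'⟩ hXn' (Or.inr (Or.inl ⟨hXl', rfl,
      F.isBisectionForest.newVertex_eq hXn.1 (by rw [hYl]; exact hS') h⟩))) hAn (by omega) hw)

/-- The leaves above the prisms that share a hyperface with the leaf `Q` are coarser than `Q` by at
most one level. -/
theorem IsSaturated.level_le_of_mem_leaves (hd : 2 ≤ d) (hD : F.IsSaturated D)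
    (hQ : Q ∈ F.leaves D) {S' : TaggedSimplex d} (hS' : S' ∈ F.space Q.level)
    (hc : d ≤ (Q.space.vertices ∩ S'.vertices).ncard) (hA : A ∈ F.leaves D)
    (hw : (⟨Q.time, S'⟩ : Prism d).Within A) : Q.level ≤ A.level + 1 := by
  by_contra hlt
  push Not at hlt
  obtain ⟨hQn, -, hpar⟩ := hD.isLower.mem_leaves.1 hQ
  have hAn := hD.isLower.isNode_of_mem_leaves hA
  obtain ⟨hQn', hQl'⟩ := IsNode.of_mem hS' hQn.2
  obtain ⟨Y, hY, hQY⟩ := hQn.exists_parent (by omega)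
  have hYl := level_of_mem_children hQY
  have hYD := hpar Y hY hQY
  rw [hYl] at hS'
  obtain ⟨Z, hZ, hS'Z⟩ := (F.isBisectionForest.mem_succ _ _).1 hS'
  obtain ⟨hYn', hYl'⟩ := IsNode.of_mem hZ hY.2
  have hQY' : (⟨Q.time, S'⟩ : Prism d).Within ⟨Y.time, Z⟩ :=
    ⟨(hY.children hQY).2.1, F.isBisectionForest.carrier_subset hZ hS'Z⟩
  have := hD.level_le_of_mem hd hYD hZ
    (F.isBisectionForest.le_ncard_parent hY.1 hZ (mem_children.1 hQY).2 hS'Z hc) hA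
    (hYn'.within_of_within hAn (by omega) hQn' hQY' hw)
  omega

/-- If no neighbour in space of the leaf `Q` is coarser than `Q` by exactly one level, then all
prisms around the refinement edge of `Q` are leaves. They are reached from `Q` by crossing
hyperfaces that contain this edge, and the level of the leaves cannot drop by more than one when a
hyperface is crossed. -/
theorem IsSaturated.mem_leaves_of_depEdge (hd : 2 ≤ d) (hD : F.IsSaturated D)
    (hQ : Q ∈ F.leaves D) (hno : ∀ R ∈ Q.spaceNeighbours (F.leaves D), R.level + 1 ≠ Q.level)
    (hR : F.IsNode R) (h : DepEdge Q R) : R ∈ F.leaves D := by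
  obtain ⟨hRl, hRt, hRm⟩ := h
  have hQn := hD.isLower.isNode_of_mem_leaves hQ
  have hchain := F.isBisectionForest.exists_chain hQn.1 (S' := R.space)
    (by rw [← hRl]; exact hR.1) hRm
  have hR' : R = ⟨Q.time, R.space⟩ := by rw [← hRt]
  rw [hR']
  generalize R.space = S at hchain
  induction hchain with
  | refl => exact hQ
  | @tail A B _ hAB ih =>
    obtain ⟨hB, hBm, hc⟩ := hAB
    obtain ⟨hBn, hBl⟩ := IsNode.of_mem hB hQn.2
    have hQB : DepEdge Q ⟨Q.time, B⟩ := ⟨hBl, rfl, hBm⟩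
    rcases hD.isLower.exists_leaf_above hBn with hBD | ⟨L, hL, hLl, hBL⟩
    · exact absurd (hD.dep_mem _ hBD Q hQn (Or.inr (Or.inl hQB.symm)))
        (hD.isLower.notMem_of_mem_leaves hQ)
    · have hAl : (⟨Q.time, A⟩ : Prism d).level = Q.level := by
        have hA := (hD.isLower.isNode_of_mem_leaves ih)
        rcases Relation.ReflTransGen.cases_tail ‹_› with h | ⟨_, _, h, -, -⟩
        · subst h; rfl
        · exact F.isBisectionForest.level_eq _ _ h
      have hstep := hD.level_le_of_mem_leaves hd ih (S' := B) (by rw [hAl]; exact hB) hc hL hBL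
      have hLn := hD.isLower.isNode_of_mem_leaves hL
      suffices hLe : L.level = Q.level by
        rwa [hBn.eq_of_within hLn (by omega) hBn (Prism.Within.refl _) hBL]
      by_cases hLQ : L = Q
      · rw [hLQ]
      · have := hno L (mem_spaceNeighbours_of_within hd hD.isLower hQ hBn hQB hL hLl hBL hLQ)
        omega

/-- In dimension two the refinement edge is a hyperface. -/
theorem IsSaturated.level_le_of_mem_spaceNeighbours (hd : d = 2) (hD : F.IsSaturated D)
    (hQ : Q ∈ F.leaves D) (hR : R ∈ Q.spaceNeighbours (F.leaves D)) : Q.level ≤ R.level + 1 := by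
  have hQn := hD.isLower.isNode_of_mem_leaves hQ
  obtain ⟨hl, X, hX, ⟨hXl, hXt, hXm⟩, hXR⟩ :=
    exists_depEdge_of_mem_spaceNeighbours hd.ge hD.isLower hQn hR
  have hXs : X.space ∈ F.space Q.level := by rw [← hXl]; exact hX.1
  obtain ⟨h0, h1⟩ := F.isBisectionForest.ends_mem_vertices hQn.1 hXs
    (by rw [← hXm]; exact F.isBisectionForest.newVertex_mem hX.1)
  refine hD.level_le_of_mem_leaves hd.ge hQ hXs ?_ (PrismForest.mem_of_mem_neighbours
    (mem_neighbours.2 (Or.inr hR))) (by rw [← hXt]; exact hXR)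
  have hsub : {Q.space.v 0, Q.space.v d} ⊆ Q.space.vertices ∩ X.space.vertices := by
    rintro y (rfl | rfl)
    · exact ⟨Q.space.v_mem_vertices _, h0⟩
    · exact ⟨Q.space.v_mem_vertices _, h1⟩
  have := Set.ncard_le_ncard hsub ((F.isBisectionForest.isSimplexSet hQn.1).finite.inter_of_left _)
  rw [Set.ncard_pair (F.isBisectionForest.ne_ends hQn.1)] at this
  omega

/-- The scheduler never chooses a prism that is coarser than `Q` by more than one level. -/
theorem IsSaturated.level_le_inner [DecidableEq (Prism d)] (hD : F.IsSaturated D)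
    (hQ : Q ∈ F.leaves D) (σ : Scheduler d) (k : ℕ) {Y : Finset (Prism d)}
    (hY : ∀ R ∈ Y, R ∈ F.leaves D → R.level = Q.level)
    (hne : (Q.neighbours (F.leaves D) \ Y).Nonempty) :
    Q.level ≤ (σ.inner k Q (Q.neighbours (F.leaves D) \ Y)).level + 1 := by
  have hQn := hD.isLower.isNode_of_mem_leaves hQ
  have hmem := σ.inner_mem k Q _ hne
  have htime : ∀ R ∈ Q.timeNeighbours (F.leaves D), Q.level ≤ R.level + 1 := fun R hR =>
    (depTime_of_mem_timeNeighbours hD.isLower hQn hR).1.ge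
  suffices h : (∀ R ∈ Q.spaceNeighbours (F.leaves D), Q.level ≤ R.level + 1) ∨ (3 ≤ d ∧
      ∃ R ∈ Q.neighbours (F.leaves D) \ Y, Q.level ≤ R.level + 1) by
    rcases h with h | ⟨hd, R, hR, hRl⟩
    · rcases mem_neighbours.1 (Finset.mem_sdiff.1 hmem).1 with h' | h'
      · exact htime _ h'
      · exact h _ h'
    · exact σ.inner_level hd k Q _ R hR hRl
  have hd1 := F.isBisectionForest.one_le
  rcases hd1.eq_or_lt with hd | hd
  · exact Or.inl fun R hR => (depSpace_of_mem_spaceNeighbours hd.symm hD.isLower hQn hR).1.ge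
  rcases (show 2 ≤ d from hd).eq_or_lt with hd | hd3
  · exact Or.inl fun R hR => hD.level_le_of_mem_spaceNeighbours hd.symm hQ hR
  by_cases hno : ∀ R ∈ Q.spaceNeighbours (F.leaves D), R.level + 1 ≠ Q.level
  · refine Or.inl fun R hR => ?_
    obtain ⟨hl, X, hX, hQX, hXR⟩ := exists_depEdge_of_mem_spaceNeighbours hd hD.isLower hQn hR
    have hXL := hD.mem_leaves_of_depEdge hd hQ hno hX hQX
    have hXl := hQX.1
    rw [hD.isLower.eq_of_mem_leaves (PrismForest.mem_of_mem_neighbours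
      (mem_neighbours.2 (Or.inr hR))) hXL hX hXR (Prism.Within.refl X)]
    omega
  · push Not at hno
    obtain ⟨R, hR, hRl⟩ := hno
    have hR' := mem_neighbours.2 (Or.inr hR)
    refine Or.inr ⟨hd3, R, Finset.mem_sdiff.2 ⟨hR', fun h => ?_⟩, hRl.ge⟩
    have := hY R h (PrismForest.mem_of_mem_neighbours hR')
    omega

/-! ### Absence of coarser neighbours -/

theorem DepEdge.eq (hd : d = 1) (hQ : F.IsNode Q) (hR : F.IsNode R) (h : DepEdge Q R) : R = Q := by
  obtain ⟨hl, ht, hm⟩ := h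
  have hRs : R.space ∈ F.space Q.level := by rw [← hl]; exact hR.1
  obtain ⟨h0, h1⟩ := F.isBisectionForest.ends_mem_vertices hQ.1 hRs
    (by rw [← hm]; exact F.isBisectionForest.newVertex_mem hR.1)
  obtain ⟨e0, e1⟩ := ends_mem_carrier Q
  refine hR.eq_of_within hQ hl hQ ⟨by rw [ht], ?_⟩ (Prism.Within.refl Q)
  by_contra hns
  exact F.isBisectionForest.ne_ends hQ.1 (F.isBisectionForest.inter_subsingleton hd hQ.1 hRs le_rfl
    hns ⟨e0, subset_convexHull _ _ h0⟩ ⟨e1, subset_convexHull _ _ h1⟩)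

/-- If no neighbour of the leaf `Q` is coarser than `Q`, then `Q` depends only on itself, on its
neighbours, and on prisms that have been split. -/
theorem IsSaturated.mem_or_of_dep (hD : F.IsSaturated D) (hQ : Q ∈ F.leaves D)
    (hN : ∀ R ∈ Q.neighbours (F.leaves D), R.level = Q.level) (hR : F.IsNode R) (h : Dep Q R) :
    R ∈ D ∨ R = Q ∨ R ∈ Q.neighbours (F.leaves D) := by
  have hQn := hD.isLower.isNode_of_mem_leaves hQ
  have hd1 := F.isBisectionForest.one_le
  rcases hD.isLower.exists_leaf_above hR with hRD | ⟨A, hA, hAl, hRA⟩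
  · exact Or.inl hRD
  have hAn := hD.isLower.isNode_of_mem_leaves hA
  have heq : A.level = R.level → A = R := fun hl =>
    (hR.eq_of_within hAn hl.symm hR (Prism.Within.refl R) hRA).symm
  have hnot : A.level < Q.level → ¬Q.Within A := fun hl hw => by
    have := hD.isLower.eq_of_mem_leaves hQ hA hQn (Prism.Within.refl Q) hw
    rw [this] at hl
    exact lt_irrefl _ hl
  rcases h with ⟨hl, ht, hs⟩ | h | ⟨hd, hl, ht, hs⟩
  · exfalso
    have hsub := hs.trans hRA.2
    have htA : ¬Q.time.carrier ⊆ A.time.carrier := fun h => hnot (by omega) ⟨h, hsub⟩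
    have hdis : A.time.carrier ∩ Q.time.carrier = ∅ := by
      rw [← Set.not_nonempty_iff_eq_empty]
      rintro ⟨s, hs, hs'⟩
      exact htA (F.isIntervalForest.subset_of_mem hAn.2 hQn.2 (F.generation_mono (by omega)) hs hs')
    have hadj := (hQn.timeAdjacent_iff hAn).2 (ht.symm.of_subset hAn.left_lt_right
      hR.left_lt_right hQn.left_lt_right hRA.1 hdis).symm
    have hdim := (hQn.convexDim_inter_eq_iff hAn (by omega)).2 hsub
    have := hD.irregular_in_time hQ hA ⟨hadj, hdim⟩
    have hlA : A.level + 1 = Q.level := by omega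
    have := hN A (mem_neighbours.2 (Or.inl (mem_timeNeighbours.2
      ⟨hA, fun e => by rw [e] at hlA; omega, hadj, hdim, hlA⟩)))
    omega
  · rcases hd1.eq_or_lt with hd | hd
    · exact Or.inr (Or.inl (h.eq hd.symm hQn hR))
    by_cases hAQ : A = Q
    · rw [← heq (by rw [hAQ]; exact h.1.symm)]
      exact Or.inr (Or.inl hAQ)
    have hmem := mem_neighbours.2 (Or.inr
      (mem_spaceNeighbours_of_within hd hD.isLower hQ hR h hA hAl hRA hAQ))
    rw [← heq ((hN A hmem).trans h.1.symm)]
    exact Or.inr (Or.inr hmem)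
  · exfalso
    have htA := ht.trans hRA.1
    obtain ⟨x, hx⟩ := Set.ncard_eq_one.1 hs
    have hxQ : x ∈ Q.space.carrier ∩ R.space.carrier := by rw [hx]; rfl
    have hsing := F.isBisectionForest.inter_subsingleton hd hQn.1 hAn.1 (by omega)
      fun h => hnot (by omega) ⟨htA, h⟩
    have hcard : (Q.space.carrier ∩ A.space.carrier).ncard = 1 :=
      Set.ncard_eq_one.2 ⟨x, hsing.eq_singleton_of_mem ⟨hxQ.1, hRA.2 hxQ.2⟩⟩
    have hov := (hQn.timeOverlap_iff_subset hAn (by omega)).2 htA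
    have := hD.irregular_in_space hd hQ hA ⟨hov, hcard⟩
    have hlA : A.level + 1 = Q.level := by omega
    have := hN A (mem_neighbours.2 (Or.inr ((mem_spaceNeighbours_of_eq_one hd).2
      ⟨hA, fun e => by rw [e] at hlA; omega, hov, hcard, hlA⟩)))
    omega

/-! ### Specification of the routine -/

theorem DepEdge.trans (h : DepEdge Q R) (h' : DepEdge R X) : DepEdge Q X :=
  ⟨h'.1.trans h.1, h'.2.1.trans h.2.1, h'.2.2.trans h.2.2⟩

theorem DepEdge.refl (Q : Prism d) : DepEdge Q Q := ⟨rfl, rfl, rfl⟩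

theorem exists_finset_nodes (F : PrismForest d) (ℓ : ℕ) :
    ∃ U : Finset (Prism d), ∀ Q, F.IsNode Q → Q.level ≤ ℓ → Q ∈ U := by
  classical
  refine ⟨(Finset.range (ℓ + 1)).biUnion fun j =>
    (F.time (F.generation j) ×ˢ F.space j).image fun p => ⟨p.1, p.2⟩, fun Q hQ hl => ?_⟩
  simp only [Finset.mem_biUnion, Finset.mem_range, Finset.mem_image, Finset.mem_product]
  exact ⟨Q.level, by omega, (Q.time, Q.space), ⟨hQ.2, hQ.1⟩, rfl⟩

/-- A part of the run that started when the prisms in `D` had been split has split those in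
`D' \ D`. These have level less than `b`, and every refinement of the given partition in which `E`
is split contains them. -/
structure Progress (F : PrismForest d) (E : Prism d) (b : ℕ) (D D' : Finset (Prism d))
    (st st' : RunState d) : Prop where
  saturated : F.IsSaturated D'
  subset : D ⊆ D'
  part_eq : st'.part = F.leaves D'
  splits_eq : st'.splits + D.card = st.splits + D'.card
  level_lt : ∀ Q ∈ D', Q ∉ D → Q.level < b
  minimal : ∀ D'', F.IsSaturated D'' → D ⊆ D'' → E ∈ D'' → D' ⊆ D''

theorem Progress.refl {E : Prism d} {b : ℕ} {st : RunState d} (hD : F.IsSaturated D)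
    (hst : st.part = F.leaves D) : F.Progress E b D D st st :=
  ⟨hD, subset_rfl, hst, rfl, fun _ h h' => absurd h h', fun _ _ h _ => h⟩

theorem Progress.trans {E : Prism d} {b : ℕ} {D₁ D₂ D₃ : Finset (Prism d)}
    {st₁ st₂ st₃ : RunState d} (h : F.Progress E b D₁ D₂ st₁ st₂)
    (h' : F.Progress E b D₂ D₃ st₂ st₃) : F.Progress E b D₁ D₃ st₁ st₃ where
  saturated := h'.saturated
  subset := h.subset.trans h'.subset
  part_eq := h'.part_eq
  splits_eq := by
    have := h.splits_eq
    have := h'.splits_eq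
    omega
  level_lt Q hQ hQ' := by
    by_cases hQ2 : Q ∈ D₂
    · exact h.level_lt Q hQ2 hQ'
    · exact h'.level_lt Q hQ hQ2
  minimal D'' hD'' hsub hE := h'.minimal D'' hD'' (h.minimal D'' hD'' hsub hE) hE

/-- `K` consists of leaves that have the level, the time interval and the refinement edge of `E`. -/
def IsPatch (F : PrismForest d) (E : Prism d) (D K : Finset (Prism d)) : Prop :=
  ∀ X ∈ K, X ∈ F.leaves D ∧ DepEdge E X

theorem Progress.isPatch {E : Prism d} {K : Finset (Prism d)} {st st' : RunState d}
    (h : F.Progress E E.level D D' st st') (hD : F.IsSaturated D) (hK : F.IsPatch E D K) :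
    F.IsPatch E D' K := by
  refine fun X hX => ⟨?_, (hK X hX).2⟩
  obtain ⟨h1, h2, h3⟩ := hD.isLower.mem_leaves.1 (hK X hX).1
  refine h.saturated.isLower.mem_leaves.2 ⟨h1, fun hX' => ?_,
    fun P hP hXP => h.subset (h3 P hP hXP)⟩
  have := h.level_lt X hX' h2
  have := (hK X hX).2.1
  omega

/-- The routine terminates on `E` and splits exactly the prisms that have to be split. -/
def PatchSpec (F : PrismForest d) (σ : Scheduler d) (E : Prism d) : Prop :=
  ∀ (D : Finset (Prism d)) (st : RunState d), F.IsSaturated D → E ∈ F.leaves D →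
    st.part = F.leaves D → ∃ st' D', patchRefine F.s₁ F.s₂ σ E st = some st' ∧
      F.Progress E (E.level + 1) D D' st st' ∧ E ∈ D'

section Loops

open scoped Classical

/-- After the loop over the neighbours of `Q`, all prisms on which `Q` depends have been split or
belong to the patch. The elements that have been visited are split or belong to `F_new`, so that a
prism of bounded level is never visited twice, and the loop terminates. -/
theorem innerLoop_spec {σ : Scheduler d} {E : Prism d}
    (ih : ∀ R, R.level < E.level → F.PatchSpec σ R) {K G : Finset (Prism d)} (hQ : Q ∈ G)
    (seen Fnew : Finset (Prism d)) (D : Finset (Prism d)) (st : RunState d) (hD : F.IsSaturated D)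
    (hst : st.part = F.leaves D) (hp : F.IsPatch E D (K ∪ G ∪ Fnew)) (hdis : Disjoint (K ∪ G) Fnew)
    (hseen : ∀ R ∈ seen, R ∈ D ∨ R ∈ Fnew) :
    ∃ st' Fnew' D', innerLoop F.s₁ F.s₂ σ K G Q seen Fnew st = some (st', Fnew') ∧
      F.Progress E E.level D D' st st' ∧ F.IsPatch E D' (K ∪ G ∪ Fnew') ∧
      Disjoint (K ∪ G) Fnew' ∧ Fnew ⊆ Fnew' ∧
      ∀ R, F.IsNode R → Dep Q R → R ∈ D' ∨ R ∈ K ∪ G ∪ Fnew' := by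
  obtain ⟨U, hU⟩ := F.exists_finset_nodes E.level
  induction hn : (U \ seen).card using Nat.strong_induction_on generalizing seen Fnew D st with
  | _ n ihn =>
  subst hn
  have hQE : DepEdge E Q := (hp Q (by simp [hQ])).2
  have hQl : Q ∈ F.leaves D := (hp Q (by simp [hQ])).1
  have hQn := hD.isLower.isNode_of_mem_leaves hQl
  have hlev : Q.level = E.level := hQE.1
  rw [innerLoop]
  split_ifs with hempty
  · refine ⟨st, Fnew, D, rfl, Progress.refl hD hst, hp, hdis, subset_rfl, ?_⟩
    -- All neighbours belong to the patch, since those that have been split are not leaves.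
    have hmem : ∀ R ∈ Q.neighbours (F.leaves D), R ∈ K ∪ G ∪ Fnew := by
      intro R hR
      by_contra hRn
      rw [Finset.mem_union, not_or] at hRn
      have hRs : R ∈ seen := by
        by_contra hRs
        have : R ∈ (Q.neighbours st.part \ (K ∪ G)) \ seen :=
          Finset.mem_sdiff.2 ⟨Finset.mem_sdiff.2 ⟨by rw [hst]; exact hR, hRn.1⟩, hRs⟩
        rw [hempty] at this
        exact absurd this (Finset.notMem_empty _)
      rcases hseen R hRs with h | h
      · exact hD.isLower.notMem_of_mem_leaves (mem_of_mem_neighbours hR) h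
      · exact hRn.2 h
    intro R hR hQR
    rcases hD.mem_or_of_dep hQl (fun R hR => ((hp R (hmem R hR)).2.1).trans hlev.symm) hR hQR with
      h | rfl | h
    · exact Or.inl h
    · exact Or.inr (by simp [hQ])
    · exact Or.inr (hmem R h)
  · have hne := Finset.nonempty_iff_ne_empty.2 hempty
    have hRmem := σ.inner_mem st.choices Q _ hne
    have hlow : Q.level ≤ (σ.inner st.choices Q
        ((Q.neighbours st.part \ (K ∪ G)) \ seen)).level + 1 := by
      rw [sdiff_sdiff_left] at hne ⊢
      rw [hst] at hne ⊢
      refine hD.level_le_inner hQl σ _ (fun R hR hRl => ?_) hne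
      have hRp : R ∈ K ∪ G ∪ Fnew := by
        rcases Finset.mem_union.1 hR with h | h
        · exact Finset.mem_union_left _ h
        · exact Finset.mem_union_right _
            ((hseen R h).resolve_left (hD.isLower.notMem_of_mem_leaves hRl))
      exact (hp R hRp).2.1.trans hlev.symm
    dsimp only
    generalize σ.inner st.choices Q ((Q.neighbours st.part \ (K ∪ G)) \ seen) = R at *
    obtain ⟨hRm, hRseen⟩ := Finset.mem_sdiff.1 hRmem
    obtain ⟨hRN, hRKG⟩ := Finset.mem_sdiff.1 hRm
    rw [hst] at hRN
    have hRleaf := mem_of_mem_neighbours hRN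
    have hRn := hD.isLower.isNode_of_mem_leaves hRleaf
    have hRle := level_le_of_mem_neighbours hD.isLower hQn hRN
    have hcard : (U \ insert R seen).card < (U \ seen).card := by
      refine Finset.card_lt_card ⟨Finset.sdiff_subset_sdiff subset_rfl (Finset.subset_insert _ _),
        fun h => ?_⟩
      have := h (Finset.mem_sdiff.2 ⟨hU R hRn (by omega), hRseen⟩)
      simp at this
    by_cases hlR : Q.level = R.level
    · -- A neighbour of the same level joins the patch.
      rw [if_pos hlR]
      have hER := hQE.trans (depEdge_of_mem_neighbours hD.isLower hQn hRN hlR.symm)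
      obtain ⟨st', Fnew', D', h1, h2, h3, h4, h5, h6⟩ :=
          ihn _ hcard (insert R seen) (insert R Fnew) D
        { st with choices := st.choices + 1 } hD hst
        (by
          intro X hX
          rw [Finset.union_insert, Finset.mem_insert] at hX
          rcases hX with rfl | hX
          · exact ⟨hRleaf, hER⟩
          · exact hp X hX)
        (Finset.disjoint_insert_right.2 ⟨hRKG, hdis⟩)
        (by
          intro X hX
          rcases Finset.mem_insert.1 hX with rfl | hX
          · exact Or.inr (Finset.mem_insert_self _ _)
          · exact (hseen X hX).imp_right (Finset.mem_insert_of_mem))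
        rfl
      exact ⟨st', Fnew', D', h1, ⟨h2.1, h2.2, h2.3, h2.4, h2.5, h2.6⟩, h3, h4,
        (Finset.subset_insert _ _).trans h5, h6⟩
    · -- A coarser neighbour is refined; its children next to `Q` join the patch.
      rw [if_neg hlR]
      have hRlt : R.level + 1 = Q.level := by omega
      obtain ⟨st₁, D₁, e1, hpr, hRD⟩ := ih R (by omega) D { st with choices := st.choices + 1 } hD
        hRleaf hst
      have hpr' : F.Progress E E.level D D₁ st st₁ :=
        ⟨hpr.saturated, hpr.subset, hpr.part_eq, hpr.splits_eq,
          fun X hX hX' => by have := hpr.level_lt X hX hX'; omega,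
          fun D'' hD'' hsub hE => hpr.minimal D'' hD'' hsub (hD''.mem_of_mem_neighbours hD.isLower
            (hD''.dep_mem E hE Q hQn (Or.inr (Or.inl hQE))) hRN)⟩
      have hnew : ∀ Z, Z ∈ (if R ∈ Q.spaceNeighbours st.part then
            Fnew ∪ (R.atomicSplit F.s₁ F.s₂).filter (fun C => C ∈ Q.neighbours st₁.part)
          else Fnew) → Z ∈ Fnew ∨ (Z ∈ F.children R ∧ Z ∈ Q.neighbours (F.leaves D₁)) := by
        intro Z hZ
        split_ifs at hZ
        · rw [← hpr.part_eq]
          simpa using hZ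
        · exact Or.inl hZ
      have hsub : Fnew ⊆ (if R ∈ Q.spaceNeighbours st.part then
            Fnew ∪ (R.atomicSplit F.s₁ F.s₂).filter (fun C => C ∈ Q.neighbours st₁.part)
          else Fnew) := by
        split_ifs
        · exact Finset.subset_union_left
        · exact subset_rfl
      have hp₁ := hpr'.isPatch hD hp
      have hQn₁ := hpr.saturated.isLower
      obtain ⟨st', Fnew', D', h1, h2, h3, h4, h5, h6⟩ := ihn _ hcard (insert R seen) _ D₁
        st₁ hpr.saturated hpr.part_eq
        (by
          intro X hX
          rcases Finset.mem_union.1 hX with hX | hX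
          · exact hp₁ X (Finset.mem_union_left _ hX)
          rcases hnew X hX with hX | ⟨hXR, hXN⟩
          · exact hp₁ X (Finset.mem_union_right _ hX)
          · have := level_of_mem_children hXR
            exact ⟨mem_of_mem_neighbours hXN, hQE.trans
              (depEdge_of_mem_neighbours hpr.saturated.isLower hQn hXN (by omega))⟩)
        (by
          rw [Finset.disjoint_left]
          intro X hX hX'
          rcases hnew X hX' with hX' | ⟨hXR, -⟩
          · exact Finset.disjoint_left.1 hdis hX hX'
          · exact hD.isLower.notMem_of_mem_leaves hRleaf ((hD.isLower.mem_leaves.1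
              (hp X (Finset.mem_union_left _ hX)).1).2.2 R hRn hXR))
        (by
          intro X hX
          rcases Finset.mem_insert.1 hX with rfl | hX
          · exact Or.inl hRD
          · exact (hseen X hX).imp (fun h => hpr.subset h) (fun h => hsub h))
        rfl
      refine ⟨st', Fnew', D', ?_, hpr'.trans h2, h3, h4, hsub.trans h5, h6⟩
      simp only [e1, Option.bind_eq_bind, Option.bind_some]
      exact h1

theorem outerLoop_spec {σ : Scheduler d} {E : Prism d}
    (ih : ∀ R, R.level < E.level → F.PatchSpec σ R) {K G : Finset (Prism d)}
    (todo Fnew : Finset (Prism d)) (htodo : todo ⊆ G) (D : Finset (Prism d)) (st : RunState d)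
    (hD : F.IsSaturated D) (hst : st.part = F.leaves D) (hp : F.IsPatch E D (K ∪ G ∪ Fnew))
    (hdis : Disjoint (K ∪ G) Fnew) :
    ∃ st' Fnew' D', outerLoop F.s₁ F.s₂ σ K G todo Fnew st = some (st', Fnew') ∧
      F.Progress E E.level D D' st st' ∧ F.IsPatch E D' (K ∪ G ∪ Fnew') ∧
      Disjoint (K ∪ G) Fnew' ∧ Fnew ⊆ Fnew' ∧
      ∀ Q ∈ todo, ∀ R, F.IsNode R → Dep Q R → R ∈ D' ∨ R ∈ K ∪ G ∪ Fnew' := by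
  induction hn : todo.card generalizing todo Fnew D st with
  | zero =>
    rw [Finset.card_eq_zero] at hn
    subst hn
    rw [outerLoop, if_pos rfl]
    exact ⟨st, Fnew, D, rfl, Progress.refl hD hst, hp, hdis, subset_rfl, by simp⟩
  | succ n ihn =>
    have hne : todo.Nonempty := by rw [← Finset.card_pos]; omega
    have hQ := σ.outer_mem st.choices todo hne
    rw [outerLoop, if_neg hne.ne_empty]
    dsimp only
    generalize σ.outer st.choices todo = Q at *
    obtain ⟨st₁, F₁, D₁, e1, g2, g3, g4, g5, g6⟩ := innerLoop_spec ih (htodo hQ) ∅ Fnew D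
      { st with choices := st.choices + 1 } hD hst hp hdis (by simp)
    obtain ⟨st', F', D', h1, h2, h3, h4, h5, h6⟩ := ihn (todo.erase Q) F₁
      ((Finset.erase_subset _ _).trans htodo) D₁ st₁ g2.saturated g2.part_eq g3 g4
      (by rw [Finset.card_erase_of_mem hQ, hn]; rfl)
    refine ⟨st', F', D', ?_, Progress.trans ⟨g2.1, g2.2, g2.3, g2.4, g2.5, g2.6⟩ h2, h3, h4,
      g5.trans h5, fun X hX R hR hXR => ?_⟩
    · simp only [e1, Option.bind_eq_bind, Option.bind_some]
      exact h1
    · by_cases hXQ : X = Q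
      · rw [hXQ] at hXR
        exact (g6 R hR hXR).imp (fun h => h2.subset h)
          (fun h => Finset.union_subset_union_right h5 h)
      · exact h6 X (Finset.mem_erase.2 ⟨hXQ, hX⟩) R hR hXR

/-- The loop terminates since `K` grows within the finite set of prisms of bounded level. -/
theorem whileLoop_spec {σ : Scheduler d} {E : Prism d}
    (ih : ∀ R, R.level < E.level → F.PatchSpec σ R) (K G : Finset (Prism d))
    (D : Finset (Prism d)) (st : RunState d) (hD : F.IsSaturated D) (hst : st.part = F.leaves D)
    (hp : F.IsPatch E D (K ∪ G)) (hdis : Disjoint K G)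
    (hdep : ∀ Q ∈ K, ∀ R, F.IsNode R → Dep Q R → R ∈ D ∨ R ∈ K ∪ G) :
    ∃ st' K' D', whileLoop F.s₁ F.s₂ σ K G st = some (st', K') ∧
      F.Progress E E.level D D' st st' ∧ F.IsPatch E D' K' ∧ K ∪ G ⊆ K' ∧
      ∀ Q ∈ K', ∀ R, F.IsNode R → Dep Q R → R ∈ D' ∨ R ∈ K' := by
  obtain ⟨U, hU⟩ := F.exists_finset_nodes E.level
  induction hn : (U \ K).card using Nat.strong_induction_on generalizing K G D st with
  | _ n ihn =>
  subst hn
  rw [whileLoop]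
  split_ifs with hempty
  · subst hempty
    rw [Finset.union_empty] at hp hdep
    exact ⟨st, K, D, rfl, Progress.refl hD hst, hp, by simp, hdep⟩
  · obtain ⟨Q, hQ⟩ := Finset.nonempty_iff_ne_empty.2 hempty
    obtain ⟨st₁, F₁, D₁, e1, g2, g3, g4, -, g6⟩ := outerLoop_spec ih (K := K) G ∅ subset_rfl D st hD
      hst (by rwa [Finset.union_empty]) (by simp)
    have hQp := hp Q (Finset.mem_union_right _ hQ)
    have hcard : (U \ (K ∪ G)).card < (U \ K).card := by
      refine Finset.card_lt_card ⟨Finset.sdiff_subset_sdiff subset_rfl Finset.subset_union_left,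
        fun h => ?_⟩
      have := h (Finset.mem_sdiff.2 ⟨hU Q (hD.isLower.isNode_of_mem_leaves hQp.1) hQp.2.1.le,
        fun h => Finset.disjoint_left.1 hdis h hQ⟩)
      simp [hQ] at this
    obtain ⟨st', K', D', h1, h2, h3, h4, h5⟩ :=
      ihn _ hcard (K ∪ G) F₁ D₁ st₁ g2.saturated g2.part_eq
      g3 g4 (fun X hX R hR hXR => by
        rcases Finset.mem_union.1 hX with hX | hX
        · exact (hdep X hX R hR hXR).imp (fun h => g2.subset h)
            (fun h => Finset.mem_union_left _ h)
        · exact g6 X hX R hR hXR) rfl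
    refine ⟨st', K', D', ?_, g2.trans h2, h3, Finset.subset_union_left.trans h4, h5⟩
    simp only [e1, Option.bind_eq_bind, Option.bind_some]
    exact h1

theorem patchSpec (F : PrismForest d) (σ : Scheduler d) (E : Prism d) : F.PatchSpec σ E := by
  induction hn : E.level using Nat.strong_induction_on generalizing E with
  | _ n ihn =>
  subst hn
  intro D st hD hE hst
  obtain ⟨st₁, K, D₁, e1, h2, h3, h4, h5⟩ :=
    whileLoop_spec (fun R hR => ihn _ hR R rfl) ∅ {E} D st hD
    hst (by
      intro X hX
      rw [Finset.empty_union, Finset.mem_singleton] at hX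
      subst hX
      exact ⟨hE, DepEdge.refl X⟩) (by simp) (by simp)
  have hEK : E ∈ K := h4 (by simp)
  have hKl : K ⊆ F.leaves D₁ := fun X hX => (h3 X hX).1
  have hlow := h2.saturated.isLower
  have hdisj : Disjoint D₁ K := Finset.disjoint_left.2 fun X hX hXK =>
    hlow.notMem_of_mem_leaves (hKl hXK) hX
  have hcard := Finset.card_union_of_disjoint hdisj
  have hsplits := h2.splits_eq
  refine ⟨{ st₁ with
      part := (st₁.part \ K) ∪ K.biUnion (Prism.atomicSplit F.s₁ F.s₂)
      splits := st₁.splits + K.card }, D₁ ∪ K, ?_, ⟨⟨hlow.union hKl, fun Q hQ R hR hQR => ?_⟩,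
    h2.subset.trans Finset.subset_union_left, ?_, ?_, fun Q hQ hQD => ?_,
    fun D'' hD'' hsub hE'' => ?_⟩,
    Finset.mem_union_right _ hEK⟩
  · rw [patchRefine]
    simp only [e1, Option.bind_eq_bind, Option.bind_some]
  · rcases Finset.mem_union.1 hQ with hQ | hQ
    · exact Finset.mem_union_left _ (h2.saturated.dep_mem Q hQ R hR hQR)
    · exact Finset.mem_union.2 (h5 Q hQ R hR hQR)
  · rw [hlow.leaves_union hKl, ← h2.part_eq]
  · dsimp only
    omega
  · rcases Finset.mem_union.1 hQ with hQ | hQ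
    · have := h2.level_lt Q hQ hQD
      omega
    · have := (h3 Q hQ).2.1
      omega
  · refine Finset.union_subset (h2.minimal D'' hD'' hsub hE'') fun X hX => ?_
    exact hD''.dep_mem E hE'' X (hlow.isNode_of_mem_leaves (hKl hX)) (Or.inr (Or.inl (h3 X hX).2))

end Loops

end PrismForest

/-! ### The forest of the initial partition -/

open Classical in
/-- The intervals of the partition of `[t 0, t N]` with the nodes `t i`. -/
noncomputable def gridIntervals {N : ℕ} (t : Fin (N + 1) → ℝ) : Finset TimeInterval :=
  (Finset.univ : Finset (Fin N)).image fun i : Fin N =>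
    ⟨t i.castSucc, t i.succ, decide ((i : ℕ) + 1 = N)⟩

theorem isIntervalForest_gridIntervals {N : ℕ} {t : Fin (N + 1) → ℝ} (ht : StrictMono t) :
    IsIntervalForest (intervalRefinement (gridIntervals t)) := by
  classical
  have key : ∀ i j : Fin N, i < j → ∀ s : ℝ,
      s ∈ (⟨t i.castSucc, t i.succ, decide ((i : ℕ) + 1 = N)⟩ : TimeInterval).carrier →
      s ∉ (⟨t j.castSucc, t j.succ, decide ((j : ℕ) + 1 = N)⟩ : TimeInterval).carrier := by
    intro i j hij s hs hs'
    have hlt : (i : ℕ) < j := hij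
    have hi : ¬(i : ℕ) + 1 = N := by have := j.isLt; omega
    have h1 : s < t i.succ := by
      simpa [TimeInterval.carrier, hi] using (show s ∈ Set.Ico _ _ by
        simpa [TimeInterval.carrier, hi] using hs).2
    have h2 := (TimeInterval.carrier_subset_Icc _ hs').1
    have h3 : t i.succ ≤ t j.castSucc := ht.monotone (by
      rw [Fin.le_def, Fin.val_succ, Fin.val_castSucc]; omega)
    dsimp only at h2
    linarith
  apply isIntervalForest_intervalRefinement
  · intro I hI
    obtain ⟨i, -, rfl⟩ := Finset.mem_image.1 hI
    exact ht Fin.castSucc_lt_succ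
  · intro I hI J hJ s hs hs'
    obtain ⟨i, -, rfl⟩ := Finset.mem_image.1 hI
    obtain ⟨j, -, rfl⟩ := Finset.mem_image.1 hJ
    rcases lt_trichotomy i j with h | rfl | h
    · exact absurd hs' (key i j h s hs)
    · rfl
    · exact absurd hs (key j i h s hs')

/-- The forest of prisms generated by the initial partition. -/
noncomputable def initialForest {d N : ℕ} {s₁ s₂ : ℝ} (hd : 1 ≤ d) (hs₁ : 0 < s₁) (hs₂ : 0 < s₂)
    {Ω : Set (EuclideanSpace ℝ (Fin d))} (hΩ : IsBoundedLipschitzDomain Ω)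
    {t : Fin (N + 1) → ℝ} (ht : StrictMono t) {γ : ℕ} {T₀ : Finset (TaggedSimplex d)}
    (hT₀ : IsInitialTriangulation Ω γ T₀) : PrismForest d where
  s₁ := s₁
  s₂ := s₂
  domain := Ω
  space := uniformRefinement T₀
  time := intervalRefinement (gridIntervals t)
  s₁_pos := hs₁
  s₂_pos := hs₂
  isBisectionForest := isBisectionForest_uniformRefinement hd hΩ hT₀
  isIntervalForest := isIntervalForest_gridIntervals ht

open Classical in
theorem initialPartition_eq {d N : ℕ} (t : Fin (N + 1) → ℝ) (T₀ : Finset (TaggedSimplex d)) :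
    initialPartition t T₀ =
      (gridIntervals t ×ˢ T₀).image fun p => (⟨p.1, p.2⟩ : Prism d) := by
  ext Q
  simp only [initialPartition, gridIntervals, Finset.mem_image, Finset.mem_product,
    Finset.mem_univ, true_and, Prod.exists]
  constructor
  · rintro ⟨i, S, hS, rfl⟩
    exact ⟨_, S, ⟨⟨i, rfl⟩, hS⟩, rfl⟩
  · rintro ⟨_, S, ⟨⟨i, rfl⟩, hS⟩, rfl⟩
    exact ⟨i, S, hS, rfl⟩

theorem mainTheorem4 (d : ℕ) (hd : 1 ≤ d) (s₁ s₂ T : ℝ) (hs₁ : 0 < s₁) (hs₂ : 0 < s₂) (hT : 0 < T)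
    (Ω : Set (EuclideanSpace ℝ (Fin d))) (hΩ : IsBoundedLipschitzDomain Ω)
    (N : ℕ) (t : Fin (N + 1) → ℝ) (ht : StrictMono t) (ht₀ : t 0 = 0) (htN : t (Fin.last N) = T)
    (γ : ℕ) (T₀ : Finset (TaggedSimplex d)) (hT₀ : IsInitialTriangulation Ω γ T₀)
    (P : Finset (Prism d)) (hP : IsAdmissible s₁ s₂ T Ω (initialPartition t T₀) P)
    (E : Prism d) (hE : E ∈ P) (σ : Scheduler d) :
    -- the routine terminates, with a final state `R`
    ∃ R : RunState d, patchRefine s₁ s₂ σ E ⟨P, 0, 0⟩ = some R ∧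
      -- the returned partition has the same properties, and `E` has been refined
      IsAdmissible s₁ s₂ T Ω (initialPartition t T₀) R.part ∧ E ∉ R.part ∧
      -- it arises by the counted atomic splits, and their number is minimal
      SplitsInto s₁ s₂ R.splits P R.part ∧
      (∀ (k : ℕ) (P' : Finset (Prism d)),
        IsAdmissible s₁ s₂ T Ω (initialPartition t T₀) P' → SplitsInto s₁ s₂ k P P' → E ∉ P' →
          R.splits ≤ k) ∧
      -- the level of the new elements is bounded
      ∀ Q ∈ R.part, Q ∉ P → Q.level ≤ E.level + 1 := by
  classical
  obtain ⟨F, rfl, rfl, rfl, hroots⟩ : ∃ F : PrismForest d, F.s₁ = s₁ ∧ F.s₂ = s₂ ∧ F.domain = Ω ∧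
      F.roots = initialPartition t T₀ :=
    ⟨initialForest hd hs₁ hs₂ hΩ ht hT₀, rfl, rfl, rfl, (initialPartition_eq t T₀).symm⟩
  rw [← hroots] at hP ⊢
  obtain ⟨n, hn⟩ := hP.obtained
  rw [← PrismForest.leaves_empty] at hn
  obtain ⟨D, hD, -, rfl, -⟩ := PrismForest.isLower_empty.exists_of_splitsInto hn
  have hsat := PrismForest.isSaturated_of_isAdmissible hD hP
  obtain ⟨R, D', hR, hprog, hED'⟩ := F.patchSpec σ E D ⟨F.leaves D, 0, 0⟩ hsat hE rfl
  have hlow := hprog.saturated.isLower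
  have hcard : D'.card = D.card + R.splits := by
    have := hprog.splits_eq
    dsimp only at this
    omega
  refine ⟨R, hR, ?_⟩
  rw [hprog.part_eq]
  refine ⟨hprog.saturated.isAdmissible (hD.iUnion_leaves.symm.trans hP.covering),
    fun h => hlow.notMem_of_mem_leaves h hED', hD.splitsInto hlow hprog.subset hcard,
    fun k P' hP' hk hEP' => ?_, fun Q hQ hQP => ?_⟩
  · obtain ⟨D'', hD'', hsub, rfl, hk'⟩ := hD.exists_of_splitsInto hk
    have hE'' : E ∈ D'' := by
      by_contra h
      obtain ⟨h1, -, h3⟩ := hD.mem_leaves.1 hE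
      exact hEP' (hD''.mem_leaves.2 ⟨h1, h, fun P hP hEP => hsub (h3 P hP hEP)⟩)
    have := Finset.card_le_card (hprog.minimal D''
      (PrismForest.isSaturated_of_isAdmissible hD'' hP') hsub hE'')
    omega
  · -- A new element is a child of a prism that was split during the run.
    obtain ⟨h1, h2, h3⟩ := hlow.mem_leaves.1 hQ
    by_cases h0 : Q.level = 0
    · omega
    obtain ⟨P, hP, hQP'⟩ := h1.exists_parent h0
    have hPD : P ∉ D := fun h => by
      rcases hD.child_mem h hQP' with h | h
      · exact h2 (hprog.subset h)
      · exact hQP h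
    have := hprog.level_lt P (h3 P hP hQP') hPD
    have := PrismForest.level_of_mem_children hQP'
    omega
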